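/- Let $n\ge 1$, let $e^{it\Delta}f(x)=\int_{\mathbb R^n}e^{2\pi i(x\cdot\xi-2\pi t|\xi|^2)}\hat f(\xi)\,d\xi$ with $\hat f(\xi)=\int f(x)e^{-2\pi i x\cdot\xi}\,dx$, let $e_1=(1,0,\dots,0)\in\mathbb R^n$, and for $N,R\ge1$ put $$P_R=\{(x,t)\in\mathbb R^n\times[-R,R]:\ x-4\pi tNe_1\in Q_R\},$$ where $Q_R\subset\mathbb R^n$ is the cube with centre $0$ and side length $R$. Write $\|F\|_{L^p_xL^r_t(S)}=\big\|\,\|F(x,t)\mathbf 1_S(x,t)\|_{L^r_t(\mathbb R)}\big\|_{L^p_x(\mathbb R^n)}$. Call a pair $f_1,f_2\in L^2(\mathbb R^n)$ $N$-admissible if $\operatorname{supp}\hat f_1,\operatorname{supp}\hat f_2\subset\mathbb B^n(Ne_1,1)=\{\xi:|\xi-Ne_1|\le1\}$ and $\operatorname{dist}(\operatorname{supp}\hat f_1,\operatorname{supp}\hat f_2)\ge\frac12$. Let $2\le p_0\le r_0\le\infty$, $p_0<p\le\infty$, $r_0<r\le\infty$, and let $(A_\epsilon)_{\epsilon>0}$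 be a family of constants. Then there is a constant $C$, depending only on $n,p_0,r_0,p,r$ and $(A_\epsilon)_{\epsilon>0}$, such that for every $N\ge1$ the following holds. If $$\big\||e^{it\Delta}f_1\,e^{it\Delta}f_2|^{\frac12}\big\|_{L_x^{p_0}L_t^{r_0}(P_R)}\le A_\epsilon\,N^{\frac1{p_0}-\frac1{r_0}}R^{\epsilon}\,\|f_1\|_{L^2}^{\frac12}\|f_2\|_{L^2}^{\frac12}$$ for all $\epsilon>0$, all $R\ge1$ and all $N$-admissible pairs $f_1,f_2$, then $$\big\||e^{it\Delta}f_1\,e^{it\Delta}f_2|^{\frac12}\big\|_{L_x^{p}L_t^{r}(\mathbb R^{n+1})}\le C\,N^{\frac1p-\frac1r}\,\|f_1\|_{L^2}^{\frac12}\|f_2\|_{L^2}^{\frac12}$$ for all $N$-admissible pairs $f_1,f_2$. (Here $1/\infty=0$.) -/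

import Mathlib

open MeasureTheory Topology FourierTransform
open scoped ENNReal

noncomputable section

/-- `L²(ℝⁿ; ℂ)`. -/
abbrev L2Space (n : ℕ) : Type :=
  Lp (α := EuclideanSpace ℝ (Fin n)) ℂ 2

/-- The unit vector `e₁ = (1, 0, …, 0)`. -/
def e1 (n : ℕ) [NeZero n] : EuclideanSpace ℝ (Fin n) :=
  EuclideanSpace.single (0 : Fin n) (1 : ℝ)

/-- The Schrödinger wave
`e^{itΔ} f (x) = ∫ e^{2πi (x·ξ - 2π t |ξ|²)} f̂(ξ) dξ`, where `f̂` is the `L²` Fourier transform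
(normalised by `f̂(ξ) = ∫ f(x) e^{-2πi x·ξ} dx`). It is only used for `f̂` of bounded support, so that
the integral converges absolutely for all `(x, t)`. -/
def schrodingerWave {n : ℕ} (f : L2Space n) (x : EuclideanSpace ℝ (Fin n)) (t : ℝ) : ℂ :=
  ∫ ξ : EuclideanSpace ℝ (Fin n),
    Complex.exp (2 * Real.pi * Complex.I *
      ((inner ℝ x ξ - 2 * Real.pi * t * ‖ξ‖ ^ 2 : ℝ) : ℂ)) * (𝓕 f : L2Space n) ξ

/-- The Fourier support of `f`: the (essential) support of the `L²` function `f̂`, i.e. the points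
no neighbourhood of which carries `f̂ = 0` almost everywhere. -/
def fourierSupport {n : ℕ} (f : L2Space n) : Set (EuclideanSpace ℝ (Fin n)) :=
  {ξ | ∀ U ∈ 𝓝 ξ, ¬ ∀ᵐ η ∂(volume.restrict U), (𝓕 f : L2Space n) η = 0}

/-- `f̂₁`, `f̂₂` are supported in the closed ball `𝔹ⁿ(N e₁, 1)`, and
`dist (supp f̂₁, supp f̂₂) ≥ 1/2`. -/
def AdmissiblePair {n : ℕ} [NeZero n] (N : ℝ) (f₁ f₂ : L2Space n) : Prop :=
  fourierSupport f₁ ⊆ Metric.closedBall (N • e1 n) 1 ∧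
  fourierSupport f₂ ⊆ Metric.closedBall (N • e1 n) 1 ∧
  ∀ ξ ∈ fourierSupport f₁, ∀ η ∈ fourierSupport f₂, 1 / 2 ≤ dist ξ η

/-- The cube `Q_R(x₀)` with centre `x₀` and side length `R`. -/
def cube {n : ℕ} (R : ℝ) (x₀ : EuclideanSpace ℝ (Fin n)) : Set (EuclideanSpace ℝ (Fin n)) :=
  {y | ∀ i, |y i - x₀ i| ≤ R / 2}

/-- The parallelepiped `P_R = {(x, t) : |t| ≤ R, x - 4π t N e₁ ∈ Q_R(0)}`. -/
def wavePipe (n : ℕ) [NeZero n] (N R : ℝ) : Set (EuclideanSpace ℝ (Fin n) × ℝ) :=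
  {z | z.2 ∈ Set.Icc (-R) R ∧ z.1 - (4 * Real.pi * z.2 * N) • e1 n ∈ cube R 0}

/-- The mixed norm `‖F‖_{L^p_x L^r_t(S)}`, with values in `[0, ∞]`. -/
def mixedNorm {n : ℕ} (p r : ℝ≥0∞) (S : Set (EuclideanSpace ℝ (Fin n) × ℝ))
    (F : EuclideanSpace ℝ (Fin n) × ℝ → ℝ) : ℝ≥0∞ :=
  eLpNorm (fun x => eLpNorm (fun t => S.indicator F (x, t)) r volume) p volume

/-- The function `|e^{itΔ} f₁ (x) · e^{itΔ} f₂ (x)|^{1/2}` of `(x, t)`. -/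
def bilinearWave {n : ℕ} (f₁ f₂ : L2Space n) (z : EuclideanSpace ℝ (Fin n) × ℝ) : ℝ :=
  ‖schrodingerWave f₁ z.1 z.2 * schrodingerWave f₂ z.1 z.2‖ ^ (1 / 2 : ℝ)

end

/-!
The statement is an `ε`-removal theorem: a local bilinear estimate with a loss `R ^ ε` implies a
global one without loss, for slightly larger exponents. The argument works throughout with
`|e^{itΔ}f₁ e^{itΔ}f₂|` and the halved exponents, for which the mixed norms obey the triangle
inequality.

*Discretisation.* In the frame moving with velocity `4πN e₁` the frequencies lie in the unit ball, and
the waves are essentially constant at unit scale. Space-time is cut into cells, indexed by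
`(Fin n → ℤ) × ℤ`, on which this applies; under discretisation the mixed norm over space-time becomes
`(4πN) ^ (1/P - 1/Q)` times the mixed norm `dNorm` of sequences (`cNorm_comp_cell`), which is exactly the
power of `N` in both estimates. To compare the values of a wave at a point and at the lattice point of
its cell, the exponential of the difference of the phases is expanded into a rapidly convergent sum
of products (`enorm_extendWave_le_tsum_monomial`), so no smooth cutoff is needed and the supports
of the frequency functions do not change.

*From finite sets to the whole lattice.* Mixed norms over the lattice are monotone in the exponents,
and a bound with the loss `|F| ^ κ`, for all finite sets `F` of lattice points and all `κ > 0`, yields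
a global bound for larger exponents, by decomposing according to the dyadic size of the values and
the dyadic length of the rows (`exists_dNorm_le_of_finset_bound`).

*Finite sets.* A finite set `F` is covered by `K` families of balls of radii that increase rapidly
from one family to the next, so that each ball has at most `|F| ^ (1/K)` neighbours in its family up
to a distance that is a large power of the radius (`exists_sparse_cover`). For one such sparse family
the local estimate is applied on each ball to localised versions of the functions (`dNorm_ball_le`).
The localised functions are almost orthogonal: their squared norms sum to at most the number of
neighbours times the squared norm of the function (`sum_lintegral_sq_localPiece_le`). This is a Bessel
inequality, whose Gram matrix is bounded by the decay of the Fourier transform of a Gaussian on the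
paraboloid (`sum_sq_norm_integral_waveChar_le`). The triangle inequality and the Cauchy-Schwarz
inequality over the balls give `dNorm_sparse_le`, and choosing `K` large and `ε` small gives
`exists_dNorm_finset_le`.

*Preserving admissibility.* Localisation to a ball of radius `R` blurs the frequencies by `1/R`, which
could destroy the condition on the supports. Therefore the localised functions are also shifted by
`O(1/R)` in suitable directions, which exist once the supports have small diameter
(`exists_inward_separating_shift`); the general case is reduced to this one by cutting the unit
ball into finitely many cells.
-/

/-! ### Lebesgue norms of nonnegative functions -/

theorem eLpNorm_iSup_le_of_directed {α ι : Type*} [MeasurableSpace α] [Countable ι]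
    {μ : Measure α} (p : ℝ≥0∞) {f : ι → α → ℝ≥0∞} (hf : ∀ i, Measurable (f i))
    (hd : Directed (· ≤ ·) f) :
    eLpNorm (fun x => ⨆ i, f i x) p μ ≤ ⨆ i, eLpNorm (f i) p μ := by
  rcases eq_or_ne p 0 with rfl | hp0
  · simp
  rcases eq_or_ne p ∞ with rfl | hp
  · simp only [eLpNorm_exponent_top]
    refine essSup_le_of_ae_le _ ?_
    have : ∀ᵐ x ∂μ, ∀ i, f i x ≤ eLpNormEssSup (f i) μ :=
      ae_all_iff.2 fun i => by simpa using enorm_ae_le_eLpNormEssSup (f i) μ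
    filter_upwards [this] with x hx
    simp only [enorm_eq_self]
    exact iSup_mono hx
  · have hp' : 0 < p.toReal := ENNReal.toReal_pos hp0 hp
    simp only [eLpNorm_eq_lintegral_rpow_enorm_toReal hp0 hp, enorm_eq_self]
    have h1 : ∀ x, (⨆ i, f i x) ^ p.toReal = ⨆ i, f i x ^ p.toReal := fun x =>
      (ENNReal.orderIsoRpow p.toReal hp').map_iSup _
    simp only [h1]
    rw [lintegral_iSup_directed (fun i => ((hf i).pow_const _).aemeasurable)]
    · exact ((ENNReal.orderIsoRpow (1 / p.toReal) (by positivity)).map_iSup _).le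
    · intro i j
      obtain ⟨k, hik, hjk⟩ := hd i j
      exact ⟨k, fun x => ENNReal.rpow_le_rpow (hik x) hp'.le,
        fun x => ENNReal.rpow_le_rpow (hjk x) hp'.le⟩

/-- The triangle inequality for countable sums of nonnegative functions. -/
theorem eLpNorm_tsum_le {α ι : Type*} [MeasurableSpace α] [Countable ι]
    {μ : Measure α} {p : ℝ≥0∞} (hp : 1 ≤ p) {f : ι → α → ℝ≥0∞} (hf : ∀ i, Measurable (f i)) :
    eLpNorm (fun x => ∑' i, f i x) p μ ≤ ∑' i, eLpNorm (f i) p μ := by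
  simp only [ENNReal.tsum_eq_iSup_sum]
  refine (eLpNorm_iSup_le_of_directed p (f := fun (s : Finset ι) x => ∑ i ∈ s, f i x)
    (fun s => Finset.measurable_sum s fun i _ => hf i) ?_).trans (iSup_mono fun s => ?_)
  · intro s t
    classical
    exact ⟨s ∪ t, fun x => Finset.sum_le_sum_of_subset Finset.subset_union_left,
      fun x => Finset.sum_le_sum_of_subset Finset.subset_union_right⟩
  · have := eLpNorm_sum_le (s := s) (f := f) (μ := μ) (p := p)
      (fun i _ => (hf i).aestronglyMeasurable) hp
    refine le_trans (le_of_eq ?_) this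
    congr 1
    ext x
    simp

/-- The `ℓ^p` norms decrease in `p`. -/
theorem eLpNorm_count_anti {α : Type*} [MeasurableSpace α] [MeasurableSingletonClass α]
    [Countable α] {p q : ℝ≥0∞} (hp : p ≠ 0) (hpq : p ≤ q) (f : α → ℝ≥0∞) :
    eLpNorm f q Measure.count ≤ eLpNorm f p Measure.count := by
  have hle : ∀ x, f x ≤ eLpNorm f p Measure.count := by
    intro x
    rcases eq_or_ne p ∞ with rfl | hp'
    · simp only [eLpNorm_exponent_top]
      have h := enorm_ae_le_eLpNormEssSup f Measure.count
      rw [Measure.ae_count_iff] at h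
      simpa using h x
    · have hpos := ENNReal.toReal_pos hp hp'
      rw [eLpNorm_eq_lintegral_rpow_enorm_toReal hp hp', lintegral_count]
      calc f x = (f x ^ p.toReal) ^ (1 / p.toReal) := by
            rw [← ENNReal.rpow_mul, mul_one_div_cancel hpos.ne', ENNReal.rpow_one]
        _ ≤ _ := ENNReal.rpow_le_rpow
            (by simpa using ENNReal.le_tsum (f := fun a => ‖f a‖ₑ ^ p.toReal) x) (by positivity)
  rcases eq_or_ne q ∞ with rfl | hq
  · simp only [eLpNorm_exponent_top]
    exact essSup_le_of_ae_le _ (Filter.Eventually.of_forall fun x => by simpa using hle x)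
  have hp' : p ≠ ∞ := ne_top_of_le_ne_top hq hpq
  have hq0 : q ≠ 0 := fun h => hp (by simpa [h] using hpq)
  have hpos := ENNReal.toReal_pos hp hp'
  have hqos := ENNReal.toReal_pos hq0 hq
  have hpqr : p.toReal ≤ q.toReal := ENNReal.toReal_mono hq hpq
  set S := eLpNorm f p Measure.count with hS
  have hSp : ∑' x, f x ^ p.toReal = S ^ p.toReal := by
    rw [hS, eLpNorm_eq_lintegral_rpow_enorm_toReal hp hp', lintegral_count, ← ENNReal.rpow_mul,
      one_div_mul_cancel hpos.ne', ENNReal.rpow_one]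
    simp
  have key : ∑' x, f x ^ q.toReal ≤ S ^ q.toReal := by
    calc ∑' x, f x ^ q.toReal ≤ ∑' x, f x ^ p.toReal * S ^ (q.toReal - p.toReal) := by
          refine ENNReal.tsum_le_tsum fun x => ?_
          calc f x ^ q.toReal = f x ^ (p.toReal + (q.toReal - p.toReal)) := by ring_nf
            _ = f x ^ p.toReal * f x ^ (q.toReal - p.toReal) :=
              ENNReal.rpow_add_of_nonneg _ _ hpos.le (by linarith)
            _ ≤ _ := by gcongr; exact hle x
      _ = S ^ p.toReal * S ^ (q.toReal - p.toReal) := by rw [ENNReal.tsum_mul_right, hSp]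
      _ = S ^ q.toReal := by
        rw [← ENNReal.rpow_add_of_nonneg _ _ hpos.le (by linarith)]; ring_nf
  rw [eLpNorm_eq_lintegral_rpow_enorm_toReal hq0 hq, lintegral_count]
  simp only [enorm_eq_self]
  calc (∑' x, f x ^ q.toReal) ^ (1 / q.toReal) ≤ (S ^ q.toReal) ^ (1 / q.toReal) := by gcongr
    _ = S := by rw [← ENNReal.rpow_mul, mul_one_div_cancel hqos.ne', ENNReal.rpow_one]

theorem eLpNorm_const_mul_le {α : Type*} [MeasurableSpace α] {μ : Measure α} {c : ℝ≥0∞}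
    (hc : c ≠ ∞) (p : ℝ≥0∞) (f : α → ℝ≥0∞) :
    eLpNorm (fun x => c * f x) p μ ≤ c * eLpNorm f p μ := by
  lift c to NNReal using hc
  exact eLpNorm_le_nnreal_smul_eLpNorm_of_ae_le_mul'
    (Filter.Eventually.of_forall fun x => by simp) p

/-- The mixed norm `ℓ^P(α; ℓ^Q(β))` of a nonnegative function on `α × β`. -/
noncomputable def dNorm {α β : Type*} [MeasurableSpace α] [MeasurableSpace β] (P Q : ℝ≥0∞)
    (A : α → β → ℝ≥0∞) : ℝ≥0∞ :=
  eLpNorm (fun y => eLpNorm (A y) Q Measure.count) P Measure.count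

section dNorm

variable {α β : Type*} [MeasurableSpace α] [MeasurableSpace β]

theorem dNorm_mono {P Q : ℝ≥0∞} {A B : α → β → ℝ≥0∞} (h : ∀ y s, A y s ≤ B y s) :
    dNorm P Q A ≤ dNorm P Q B :=
  eLpNorm_mono_enorm fun y => by
    simpa using eLpNorm_mono_enorm fun s => by simpa using h y s

theorem dNorm_const_mul_le {c : ℝ≥0∞} (hc : c ≠ ∞) {P Q : ℝ≥0∞} (A : α → β → ℝ≥0∞) :
    dNorm P Q (fun y s => c * A y s) ≤ c * dNorm P Q A := by
  refine le_trans (eLpNorm_mono_enorm fun y => ?_) (eLpNorm_const_mul_le hc P _)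
  simpa using eLpNorm_const_mul_le hc Q (A y)

variable [DiscreteMeasurableSpace α] [DiscreteMeasurableSpace β]

theorem dNorm_tsum_le {ι : Type*} [Countable ι] {P Q : ℝ≥0∞} (hP : 1 ≤ P) (hQ : 1 ≤ Q)
    (A : ι → α → β → ℝ≥0∞) :
    dNorm P Q (fun y s => ∑' i, A i y s) ≤ ∑' i, dNorm P Q (A i) := by
  refine le_trans (eLpNorm_mono_enorm fun y => ?_)
    (eLpNorm_tsum_le hP fun i => Measurable.of_discrete)
  simpa using eLpNorm_tsum_le hQ fun i => Measurable.of_discrete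

theorem dNorm_sum_le {ι : Type*} (S : Finset ι) {P Q : ℝ≥0∞} (hP : 1 ≤ P) (hQ : 1 ≤ Q)
    (A : ι → α → β → ℝ≥0∞) :
    dNorm P Q (fun y s => ∑ i ∈ S, A i y s) ≤ ∑ i ∈ S, dNorm P Q (A i) := by
  have := dNorm_tsum_le hP hQ fun i : S => A i
  simp only [tsum_fintype] at this
  rw [Finset.sum_coe_sort S (fun i => dNorm P Q (A i))] at this
  refine le_trans (dNorm_mono fun y s => ?_) this
  rw [Finset.sum_coe_sort S (fun i => A i y s)]

theorem dNorm_anti [Countable α] [Countable β] {P Q P' Q' : ℝ≥0∞} (hP : P ≠ 0) (hQ : Q ≠ 0)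
    (hPP : P ≤ P') (hQQ : Q ≤ Q') (A : α → β → ℝ≥0∞) : dNorm P' Q' A ≤ dNorm P Q A := by
  refine le_trans (eLpNorm_mono_enorm fun y => ?_) (eLpNorm_count_anti hP hPP _)
  simpa using eLpNorm_count_anti hQ hQQ (A y)

end dNorm

/-! ### From finite sets to global mixed norms -/

section Levels

variable {α β : Type*} [MeasurableSpace α] [MeasurableSpace β]
  [DiscreteMeasurableSpace α] [DiscreteMeasurableSpace β]

theorem eLpNorm_count_indicator_const (p : ℝ≥0∞) (hp : p ≠ 0) (hp' : p ≠ ∞) (v : ℝ≥0∞)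
    (T : Finset α) :
    eLpNorm ((T : Set α).indicator fun _ => v) p Measure.count =
      v * (T.card : ℝ≥0∞) ^ (1 / p.toReal) := by
  rw [eLpNorm_indicator_const (MeasurableSet.of_discrete) hp hp', Measure.count_apply_finset]
  simp

theorem dNorm_le_of_card_le {P Q : ℝ≥0∞} (hP : P ≠ 0) (hP' : P ≠ ∞) (hQ : Q ≠ 0) (hQ' : Q ≠ ∞)
    {A : α → β → ℝ≥0∞} {v : ℝ≥0∞} {M : ℕ} (T : Finset α) (S : α → Finset β)
    (hS : ∀ y ∈ T, (S y).card ≤ M)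
    (hA : ∀ y s, A y s ≤ v) (hA' : ∀ y s, A y s ≠ 0 → y ∈ T ∧ s ∈ S y) :
    dNorm P Q A ≤ v * (M : ℝ≥0∞) ^ (1 / Q.toReal) * (T.card : ℝ≥0∞) ^ (1 / P.toReal) := by
  rw [← eLpNorm_count_indicator_const P hP hP']
  refine eLpNorm_mono_enorm fun y => ?_
  simp only [enorm_eq_self]
  by_cases hy : y ∈ T
  · rw [Set.indicator_of_mem (by exact_mod_cast hy)]
    calc eLpNorm (A y) Q Measure.count
        ≤ eLpNorm ((S y : Set β).indicator fun _ => v) Q Measure.count := by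
          refine eLpNorm_mono_enorm fun s => ?_
          simp only [enorm_eq_self]
          by_cases hs : A y s = 0
          · simp [hs]
          · rw [Set.indicator_of_mem (by exact_mod_cast (hA' y s hs).2)]
            exact hA y s
      _ = v * ((S y).card : ℝ≥0∞) ^ (1 / Q.toReal) := eLpNorm_count_indicator_const Q hQ hQ' v _
      _ ≤ _ := by
        gcongr
        exact_mod_cast hS y hy
  · have : A y = 0 := by
      ext s
      by_contra h
      exact hy (hA' y s h).1
    simp [this]

theorem le_dNorm_of_le_card {P Q : ℝ≥0∞} (hP : P ≠ 0) (hP' : P ≠ ∞) (hQ : Q ≠ 0) (hQ' : Q ≠ ∞)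
    {A : α → β → ℝ≥0∞} {v : ℝ≥0∞} {M : ℕ} (T : Finset α) (S : α → Finset β)
    (hS : ∀ y ∈ T, M ≤ (S y).card)
    (hA : ∀ y ∈ T, ∀ s ∈ S y, v ≤ A y s) :
    v * (M : ℝ≥0∞) ^ (1 / Q.toReal) * (T.card : ℝ≥0∞) ^ (1 / P.toReal) ≤ dNorm P Q A := by
  rw [← eLpNorm_count_indicator_const P hP hP']
  refine eLpNorm_mono_enorm fun y => ?_
  simp only [enorm_eq_self]
  by_cases hy : y ∈ T
  · rw [Set.indicator_of_mem (by exact_mod_cast hy)]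
    calc v * (M : ℝ≥0∞) ^ (1 / Q.toReal) ≤ v * ((S y).card : ℝ≥0∞) ^ (1 / Q.toReal) := by
          gcongr
          exact_mod_cast hS y hy
      _ = eLpNorm ((S y : Set β).indicator fun _ => v) Q Measure.count :=
          (eLpNorm_count_indicator_const Q hQ hQ' v _).symm
      _ ≤ eLpNorm (A y) Q Measure.count := by
          refine eLpNorm_mono_enorm fun s => ?_
          simp only [enorm_eq_self]
          by_cases hs : s ∈ S y
          · rw [Set.indicator_of_mem (by exact_mod_cast hs)]
            exact hA y hy s hs
          · rw [Set.indicator_of_notMem (by exact_mod_cast hs)]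
            exact zero_le
  · rw [Set.indicator_of_notMem (by exact_mod_cast hy)]
    exact zero_le

open Classical in
theorem dNorm_le_iSup_finset [Countable α] [Countable β] (P Q : ℝ≥0∞) (A : α → β → ℝ≥0∞) :
    dNorm P Q A ≤
      ⨆ F : Finset (α × β), dNorm P Q (fun y s => if (y, s) ∈ F then A y s else 0) := by
  have hmono : ∀ {F G : Finset (α × β)}, F ⊆ G → ∀ y s,
      (if (y, s) ∈ F then A y s else 0) ≤ (if (y, s) ∈ G then A y s else 0) := by
    intro F G hFG y s
    by_cases h : (y, s) ∈ F
    · simp [h, hFG h]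
    · simp [h]
  have h1 : ∀ y, eLpNorm (A y) Q Measure.count ≤ ⨆ F : Finset (α × β),
      eLpNorm (fun s => if (y, s) ∈ F then A y s else 0) Q Measure.count := by
    intro y
    refine le_trans (eLpNorm_mono_enorm fun s => ?_)
      (eLpNorm_iSup_le_of_directed Q
        (f := fun (F : Finset (α × β)) s => if (y, s) ∈ F then A y s else 0)
        (fun _ => Measurable.of_discrete) fun F G => ⟨F ∪ G, ?_, ?_⟩)
    · simp only [enorm_eq_self]
      exact le_iSup_of_le {(y, s)} (by simp)
    · exact fun s => hmono Finset.subset_union_left y s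
    · exact fun s => hmono Finset.subset_union_right y s
  refine le_trans (eLpNorm_mono_enorm fun y => ?_)
    (eLpNorm_iSup_le_of_directed P
        (f := fun (F : Finset (α × β)) y =>
          eLpNorm (fun s => if (y, s) ∈ F then A y s else 0) Q Measure.count)
        (fun _ => Measurable.of_discrete) fun F G => ⟨F ∪ G, ?_, ?_⟩)
  · simpa using h1 y
  · exact fun y => eLpNorm_mono_enorm fun s => by
      simpa only [enorm_eq_self] using hmono Finset.subset_union_left y s
  · exact fun y => eLpNorm_mono_enorm fun s => by
      simpa only [enorm_eq_self] using hmono Finset.subset_union_right y s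

/-- The exponents at one dyadic level: if `T` rows of length about `2 ^ j` at height `2 ^ (-k)`
obey the bound with exponents `1 / a`, `1 / b` and loss `κ`, then with slightly larger exponents
their norm decays geometrically in `k` and `j`. -/
theorem dyadic_level_bound {a b s κ : ℝ} (hb' : b ≤ 1)
    (hs : 0 < s) (hs' : s ≤ 1 / 2) (hκ : 0 < κ) (hκb : κ ≤ b * s / 4)
    {T k j : ℕ} (hT : T ≠ 0)
    (h : (1 / 2 : ℝ) ^ (k + 1) * ((2 ^ j : ℕ) : ℝ) ^ b * (T : ℝ) ^ a ≤
      ((T * 2 ^ (j + 1) : ℕ) : ℝ) ^ κ) :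
    (1 / 2 : ℝ) ^ k * ((2 ^ (j + 1) : ℕ) : ℝ) ^ (b * (1 - s)) *
        (T : ℝ) ^ ((a - κ) * (1 - s / 2)) ≤
      8 * ((2 : ℝ) ^ (-(s / 2))) ^ k * ((2 : ℝ) ^ (-(b * s / 4))) ^ j := by
  obtain ⟨L, hL⟩ : ∃ L : ℝ, (T : ℝ) = (2 : ℝ) ^ L :=
    ⟨Real.logb 2 T, by
      rw [Real.rpow_logb (by norm_num) (by norm_num)]; exact_mod_cast Nat.pos_of_ne_zero hT⟩
  have e1 : ∀ m : ℕ, (1 / 2 : ℝ) ^ m = (2 : ℝ) ^ (-(m : ℝ)) := fun m => by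
    rw [Real.rpow_neg (by norm_num), Real.rpow_natCast]; simp
  have e2 : ∀ m : ℕ, ((2 ^ m : ℕ) : ℝ) = (2 : ℝ) ^ (m : ℝ) := fun m => by
    rw [Real.rpow_natCast]; simp
  have e8 : (8 : ℝ) = (2 : ℝ) ^ (3 : ℝ) := by norm_num
  have h2 : (0 : ℝ) ≤ 2 := by norm_num
  have h2' : (0 : ℝ) < 2 := by norm_num
  rw [Nat.cast_mul, e1, e2, e2, hL, ← Real.rpow_add h2', ← Real.rpow_mul h2, ← Real.rpow_mul h2,
    ← Real.rpow_add h2', ← Real.rpow_add h2', ← Real.rpow_mul h2,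
    Real.rpow_le_rpow_left_iff (by norm_num)] at h
  rw [e1, e2, hL, e8, ← Real.rpow_mul h2, ← Real.rpow_mul h2, ← Real.rpow_mul_natCast h2,
    ← Real.rpow_mul_natCast h2, ← Real.rpow_add h2',
    ← Real.rpow_add h2', ← Real.rpow_add h2', ← Real.rpow_add h2',
    Real.rpow_le_rpow_left_iff (by norm_num)]
  push_cast at h ⊢
  have hk : (0 : ℝ) ≤ k := Nat.cast_nonneg k
  have hj : (0 : ℝ) ≤ j := Nat.cast_nonneg j
  have h3 : L * (a - κ) ≤ k + 1 - j * b + (j + 1) * κ := by linarith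
  have h4 : L * (a - κ) * (1 - s / 2) ≤ (k + 1 - j * b + (j + 1) * κ) * (1 - s / 2) :=
    mul_le_mul_of_nonneg_right h3 (by linarith)
  have h5 : (j : ℝ) * κ ≤ j * (b * s / 4) := mul_le_mul_of_nonneg_left hκb hj
  have hb : 0 < b := by by_contra hb; nlinarith
  have h6 : 0 ≤ κ * s * j := by positivity
  nlinarith [mul_pos hb hs, mul_pos hκ hs]

open Classical in
/-- The bound for a finitely supported `A`, by decomposition into the parts where `A` is about
`K * 2 ^ (-k)` on rows containing about `2 ^ j` such points. -/
theorem dNorm_le_of_finset_bound_aux {P Q P' Q' : ℝ≥0∞} {a b s κ K : ℝ}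
    (hP : 1 ≤ P) (hP' : P ≠ ∞) (hQ : 1 ≤ Q) (hQ' : Q ≠ ∞)
    (hPP : 1 ≤ P') (hPP' : P' ≠ ∞) (hQQ : 1 ≤ Q') (hQQ' : Q' ≠ ∞)
    (ha : a = 1 / P.toReal) (hb : b = 1 / Q.toReal)
    (hs : 0 < s) (hs' : s ≤ 1 / 2) (hκ : 0 < κ) (hκb : κ ≤ b * s / 4)
    (hPa : 1 / P'.toReal = (a - κ) * (1 - s / 2)) (hQb : 1 / Q'.toReal = b * (1 - s))
    (hK : 0 < K) (A : α → β → ℝ≥0∞) (F₀ : Finset (α × β))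
    (hA0 : ∀ y s, A y s ≠ 0 → (y, s) ∈ F₀)
    (hA : ∀ F : Finset (α × β), dNorm P Q (fun y s => if (y, s) ∈ F then A y s else 0) ≤
      ENNReal.ofReal K * (F.card : ℝ≥0∞) ^ κ) :
    dNorm P' Q' A ≤ ∑' k : ℕ, ∑' j : ℕ, ENNReal.ofReal
      (K * (8 * ((2 : ℝ) ^ (-(s / 2))) ^ k * ((2 : ℝ) ^ (-(b * s / 4))) ^ j)) := by
  have hP0 : P ≠ 0 := (zero_lt_one.trans_le hP).ne'
  have hQ0 : Q ≠ 0 := (zero_lt_one.trans_le hQ).ne'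
  have hPP0 : P' ≠ 0 := (zero_lt_one.trans_le hPP).ne'
  have hQQ0 : Q' ≠ 0 := (zero_lt_one.trans_le hQQ).ne'
  have hb1 : b ≤ 1 := by
    rw [hb]
    have : 1 ≤ Q.toReal := by simpa using ENNReal.toReal_mono hQ' hQ
    exact div_le_one_of_le₀ this (by linarith)
  -- the hypothesis for one-point sets bounds `A`, so that only the levels `k ≥ 0` occur
  have hbound : ∀ y s, A y s ≤ ENNReal.ofReal K := by
    intro y s
    have h1 := le_dNorm_of_le_card hP0 hP' hQ0 hQ' (v := A y s) (M := 1) {y} (fun _ => {s})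
      (A := fun y' s' => if (y', s') ∈ ({(y, s)} : Finset (α × β)) then A y' s' else 0)
      (by simp) (by simp)
    simpa using h1.trans (hA {(y, s)})
  -- the part of the level `k`, and the rows of it with between `2 ^ j` and `2 ^ (j + 1)` points
  set lev : ℕ → α × β → Prop := fun k z =>
    ENNReal.ofReal (K * (1 / 2) ^ (k + 1)) ≤ A z.1 z.2 ∧
      A z.1 z.2 ≤ ENNReal.ofReal (K * (1 / 2) ^ k) with hlev
  set row : ℕ → α → Finset β := fun k y =>
    (F₀.filter fun z => z.1 = y ∧ lev k z).image Prod.snd with hrow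
  have mem_row : ∀ k y t, t ∈ row k y ↔ (y, t) ∈ F₀ ∧ lev k (y, t) := by
    intro k y t
    simp only [hrow, Finset.mem_image, Finset.mem_filter, Prod.exists]
    constructor
    · rintro ⟨y', t', ⟨h1, h2, h3⟩, h4⟩
      subst h2 h4
      exact ⟨h1, h3⟩
    · rintro ⟨h1, h3⟩
      exact ⟨y, t, ⟨h1, rfl, h3⟩, rfl⟩
  set Y : ℕ → ℕ → Finset α := fun k j =>
    (F₀.image Prod.fst).filter fun y => row k y ≠ ∅ ∧ Nat.log 2 (row k y).card = j with hY
  set G : ℕ → ℕ → α → β → ℝ≥0∞ := fun k j y t =>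
    if y ∈ Y k j ∧ t ∈ row k y then ENNReal.ofReal (K * (1 / 2) ^ k) else 0 with hG
  have hcard : ∀ k j, ∀ y ∈ Y k j, 2 ^ j ≤ (row k y).card ∧ (row k y).card ≤ 2 ^ (j + 1) := by
    intro k j y hy
    obtain ⟨-, h1, h2⟩ := Finset.mem_filter.1 hy
    have h3 : (row k y).card ≠ 0 := by simpa using h1
    rw [← h2]
    exact ⟨Nat.pow_log_le_self 2 h3, (Nat.lt_pow_succ_log_self (by norm_num) _).le⟩
  have hAG : ∀ y t, A y t ≤ ∑' z : ℕ × ℕ, G z.1 z.2 y t := by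
    intro y t
    by_cases h0 : A y t = 0
    · simp [h0]
    have hfin : A y t ≠ ∞ := ne_top_of_le_ne_top ENNReal.ofReal_ne_top (hbound y t)
    have hpos : 0 < (A y t).toReal := ENNReal.toReal_pos h0 hfin
    have hle : (A y t).toReal / K ≤ 1 := by
      rw [div_le_one hK]
      exact ENNReal.toReal_le_of_le_ofReal hK.le (hbound y t)
    obtain ⟨k, hk1, hk2⟩ := exists_nat_pow_near_of_lt_one (div_pos hpos hK) hle
      (y := (1 / 2 : ℝ)) (by norm_num) (by norm_num)
    rw [lt_div_iff₀ hK] at hk1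
    rw [div_le_iff₀ hK] at hk2
    have hl : lev k (y, t) := by
      constructor
      · rw [← ENNReal.ofReal_toReal hfin]
        exact ENNReal.ofReal_le_ofReal (by linarith)
      · rw [← ENNReal.ofReal_toReal hfin]
        exact ENNReal.ofReal_le_ofReal (by linarith)
    have ht : t ∈ row k y := (mem_row k y t).2 ⟨hA0 y t h0, hl⟩
    have hy : y ∈ Y k (Nat.log 2 (row k y).card) :=
      Finset.mem_filter.2 ⟨Finset.mem_image.2 ⟨(y, t), hA0 y t h0, rfl⟩,
        Finset.ne_empty_of_mem ht, rfl⟩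
    refine le_trans ?_ (ENNReal.le_tsum (k, Nat.log 2 (row k y).card))
    simp only [hG, hy, ht, and_self, if_true]
    exact hl.2
  have hmain : ∀ k j, dNorm P' Q' (G k j) ≤ ENNReal.ofReal
      (K * (8 * ((2 : ℝ) ^ (-(s / 2))) ^ k * ((2 : ℝ) ^ (-(b * s / 4))) ^ j)) := by
    intro k j
    have h1 : dNorm P' Q' (G k j) ≤ _ :=
      dNorm_le_of_card_le hPP0 hPP' hQQ0 hQQ' (v := ENNReal.ofReal (K * (1 / 2) ^ k))
        (M := 2 ^ (j + 1)) (Y k j) (row k) (fun y hy => (hcard k j y hy).2)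
        (fun y t => by simp only [hG]; split_ifs <;> simp)
        (fun y t h => by
          by_contra h'
          exact h (by simp only [hG]; rw [if_neg h']))
    refine h1.trans ?_
    by_cases hT : (Y k j).card = 0
    · have : 0 < 1 / P'.toReal := by
        have := ENNReal.toReal_pos hPP0 hPP'
        positivity
      rw [hT]
      simp [ENNReal.toReal_pos hPP0 hPP']
    set T := (Y k j).card with hTdef
    have hTpos : (0 : ℝ) < T := by exact_mod_cast Nat.pos_of_ne_zero hT
    set F : Finset (α × β) := F₀.filter fun z => z.1 ∈ Y k j ∧ z.2 ∈ row k z.1 with hF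
    have hFcard : F.card ≤ T * 2 ^ (j + 1) := by
      have : F ⊆ (Y k j).biUnion fun y => (row k y).image fun t => (y, t) := by
        rintro ⟨y, t⟩ hz
        obtain ⟨-, h2, h3⟩ := Finset.mem_filter.1 hz
        exact Finset.mem_biUnion.2 ⟨y, h2, Finset.mem_image.2 ⟨t, h3, rfl⟩⟩
      refine (Finset.card_le_card this).trans ?_
      exact Finset.card_biUnion_le_card_mul _ _ _ fun y hy =>
        Finset.card_image_le.trans (hcard k j y hy).2
    have h2 := le_dNorm_of_le_card hP0 hP' hQ0 hQ' (A := fun y s => if (y, s) ∈ F then A y s else 0)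
      (v := ENNReal.ofReal (K * (1 / 2) ^ (k + 1))) (M := 2 ^ j) (Y k j) (row k)
      (fun y hy => (hcard k j y hy).1) (fun y hy t ht => by
        have h3 := (mem_row k y t).1 ht
        rw [if_pos (Finset.mem_filter.2 ⟨h3.1, hy, ht⟩)]
        exact h3.2.1)
    have h3 := h2.trans (hA F)
    have h4 : ENNReal.ofReal K * (F.card : ℝ≥0∞) ^ κ ≤
        ENNReal.ofReal K * ((T * 2 ^ (j + 1) : ℕ) : ℝ≥0∞) ^ κ := by
      gcongr
    have h5 := h3.trans h4
    have cast_rpow : ∀ (m : ℕ) (x : ℝ), m ≠ 0 →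
        ((m : ℝ≥0∞)) ^ x = ENNReal.ofReal ((m : ℝ) ^ x) := by
      intro m x hm
      rw [← ENNReal.ofReal_rpow_of_pos (by exact_mod_cast Nat.pos_of_ne_zero hm),
        ENNReal.ofReal_natCast]
    rw [← ha, ← hb, cast_rpow _ _ (by positivity), cast_rpow _ _ hT,
      cast_rpow _ _ (mul_ne_zero hT (by positivity)), ← ENNReal.ofReal_mul (by positivity),
      ← ENNReal.ofReal_mul (by positivity), ← ENNReal.ofReal_mul (by positivity),
      ENNReal.ofReal_le_ofReal_iff (by positivity)] at h5
    rw [hPa, hQb, cast_rpow _ _ (by positivity), cast_rpow _ _ hT,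
      ← ENNReal.ofReal_mul (by positivity), ← ENNReal.ofReal_mul (by positivity)]
    refine ENNReal.ofReal_le_ofReal ?_
    have h6 := dyadic_level_bound hb1 hs hs' hκ hκb hT (k := k) (j := j) (a := a)
      (le_of_mul_le_mul_left (by linarith) hK)
    calc _ = K * ((1 / 2 : ℝ) ^ k * ((2 ^ (j + 1) : ℕ) : ℝ) ^ (b * (1 - s)) *
        (T : ℝ) ^ ((a - κ) * (1 - s / 2))) := by ring
      _ ≤ _ := mul_le_mul_of_nonneg_left h6 hK.le
  calc dNorm P' Q' A ≤ dNorm P' Q' (fun y t => ∑' z : ℕ × ℕ, G z.1 z.2 y t) := dNorm_mono hAG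
    _ ≤ ∑' z : ℕ × ℕ, dNorm P' Q' (G z.1 z.2) := dNorm_tsum_le hPP hQQ fun z : ℕ × ℕ => G z.1 z.2
    _ ≤ ∑' z : ℕ × ℕ, _ := ENNReal.tsum_le_tsum fun z => hmain z.1 z.2
    _ = _ := ENNReal.tsum_prod (f := fun k j => ENNReal.ofReal
      (K * (8 * ((2 : ℝ) ^ (-(s / 2))) ^ k * ((2 : ℝ) ^ (-(b * s / 4))) ^ j)))

open Classical in
/-- If the mixed norm of `A` over every finite set `F` is bounded up to the loss of an arbitrarily
small power of the cardinality of `F`, then the mixed norm of `A` with any larger exponents is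
bounded. -/
theorem exists_dNorm_le_of_finset_bound [Countable α] [Countable β] {P₀ Q₀ P Q : ℝ≥0∞}
    (hP₀ : 1 ≤ P₀) (hQ₀ : 1 ≤ Q₀) (hP : P₀ < P) (hQ : Q₀ < Q) (K : ℝ → ℝ) :
    ∃ C : ℝ, ∀ A : α → β → ℝ≥0∞,
      (∀ κ > 0, ∀ F : Finset (α × β), dNorm P₀ Q₀ (fun y s => if (y, s) ∈ F then A y s else 0) ≤
        ENNReal.ofReal (K κ) * (F.card : ℝ≥0∞) ^ κ) → dNorm P Q A ≤ ENNReal.ofReal C := by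
  obtain ⟨P₁, hP₁, hP₁'⟩ := exists_between hP
  obtain ⟨Q₁, hQ₁, hQ₁'⟩ := exists_between hQ
  have hP₀t : P₀ ≠ ∞ := hP.ne_top
  have hQ₀t : Q₀ ≠ ∞ := hQ.ne_top
  have hp₀ : 1 ≤ P₀.toReal := by simpa using ENNReal.toReal_mono hP₀t hP₀
  have hq₀ : 1 ≤ Q₀.toReal := by simpa using ENNReal.toReal_mono hQ₀t hQ₀
  have hp₁ : P₀.toReal < P₁.toReal := (ENNReal.toReal_lt_toReal hP₀t hP₁'.ne_top).2 hP₁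
  have hq₁ : Q₀.toReal < Q₁.toReal := (ENNReal.toReal_lt_toReal hQ₀t hQ₁'.ne_top).2 hQ₁
  set a := 1 / P₀.toReal with ha
  set b := 1 / Q₀.toReal with hb
  have ha0 : 0 < a := by positivity
  have hb0 : 0 < b := by positivity
  have hpa : P₀.toReal = 1 / a := by rw [ha]; simp
  have hqb : Q₀.toReal = 1 / b := by rw [hb]; simp
  -- `P'`, `Q'` are intermediate exponents with `1 / Q'` and `1 / P'` slightly below `b` and `a`,
  -- of the form for which the dyadic levels are summable
  set s := min (1 / 2) (min (1 - P₀.toReal / P₁.toReal) (1 - Q₀.toReal / Q₁.toReal)) with hs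
  have hs0 : 0 < s := by
    refine lt_min (by norm_num) (lt_min ?_ ?_)
    · rw [sub_pos, div_lt_one (by linarith)]; exact hp₁
    · rw [sub_pos, div_lt_one (by linarith)]; exact hq₁
  have hs1 : s ≤ 1 / 2 := min_le_left _ _
  have hs2 : P₀.toReal / P₁.toReal ≤ 1 - s := by
    have : s ≤ 1 - P₀.toReal / P₁.toReal := (min_le_right _ _).trans (min_le_left _ _)
    linarith
  have hs3 : Q₀.toReal / Q₁.toReal ≤ 1 - s := by
    have : s ≤ 1 - Q₀.toReal / Q₁.toReal := (min_le_right _ _).trans (min_le_right _ _)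
    linarith
  set κ := min (a * s / 4) (b * s / 4) with hκ
  have hκ0 : 0 < κ := lt_min (by positivity) (by positivity)
  have hκa : κ ≤ a * s / 4 := min_le_left _ _
  have hκb : κ ≤ b * s / 4 := min_le_right _ _
  have hx0 : a * (1 - s) ≤ (a - κ) * (1 - s / 2) := by nlinarith
  have hx1 : 0 < (a - κ) * (1 - s / 2) := lt_of_lt_of_le (by nlinarith) hx0
  have hy1 : 0 < b * (1 - s) := by nlinarith
  have ha1 : a ≤ 1 := by rw [ha, div_le_one (by linarith)]; exact hp₀
  have hb1 : b ≤ 1 := by rw [hb, div_le_one (by linarith)]; exact hq₀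
  set P' := ENNReal.ofReal (1 / ((a - κ) * (1 - s / 2))) with hP'
  set Q' := ENNReal.ofReal (1 / (b * (1 - s))) with hQ'
  have hPr : P'.toReal = 1 / ((a - κ) * (1 - s / 2)) := ENNReal.toReal_ofReal (by positivity)
  have hQr : Q'.toReal = 1 / (b * (1 - s)) := ENNReal.toReal_ofReal (by positivity)
  have hP'1 : 1 ≤ P' := by
    rw [hP', ← ENNReal.ofReal_one]
    refine ENNReal.ofReal_le_ofReal ?_
    rw [le_div_iff₀ hx1]
    nlinarith
  have hQ'1 : 1 ≤ Q' := by
    rw [hQ', ← ENNReal.ofReal_one]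
    refine ENNReal.ofReal_le_ofReal ?_
    rw [le_div_iff₀ hy1]
    nlinarith
  have hP'P : P' ≤ P := by
    refine le_trans ?_ hP₁'.le
    rw [hP', ENNReal.ofReal_le_iff_le_toReal hP₁'.ne_top, div_le_iff₀ hx1]
    rw [div_le_iff₀ (by linarith)] at hs2
    have : 1 ≤ P₁.toReal * (a * (1 - s)) := by
      calc 1 = a * P₀.toReal := by rw [hpa]; field_simp
        _ ≤ a * ((1 - s) * P₁.toReal) := by gcongr
        _ = _ := by ring
    nlinarith
  have hQ'Q : Q' ≤ Q := by
    refine le_trans ?_ hQ₁'.le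
    rw [hQ', ENNReal.ofReal_le_iff_le_toReal hQ₁'.ne_top, div_le_iff₀ hy1]
    rw [div_le_iff₀ (by linarith)] at hs3
    calc 1 = b * Q₀.toReal := by rw [hqb]; field_simp
        _ ≤ b * ((1 - s) * Q₁.toReal) := by gcongr
        _ = _ := by ring
  set K₁ := max (K κ) 1 with hK₁
  have hK₁0 : 0 < K₁ := lt_max_of_lt_right one_pos
  set S : ℝ≥0∞ := ∑' k : ℕ, ∑' j : ℕ, ENNReal.ofReal
      (K₁ * (8 * ((2 : ℝ) ^ (-(s / 2))) ^ k * ((2 : ℝ) ^ (-(b * s / 4))) ^ j)) with hS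
  have geom : ∀ x : ℝ, 0 < x → ∑' k : ℕ, ENNReal.ofReal (((2 : ℝ) ^ (-x)) ^ k) ≠ ∞ := by
    intro x hx
    simp only [ENNReal.ofReal_pow (Real.rpow_nonneg zero_le_two _)]
    rw [ENNReal.tsum_geometric, Ne, ENNReal.inv_eq_top, tsub_eq_zero_iff_le, not_le,
      ENNReal.ofReal_lt_one]
    exact Real.rpow_lt_one_of_one_lt_of_neg (by norm_num) (by linarith)
  have hSfin : S ≠ ∞ := by
    have : S = ENNReal.ofReal (K₁ * 8) * (∑' k : ℕ, ENNReal.ofReal (((2 : ℝ) ^ (-(s / 2))) ^ k)) *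
        ∑' j : ℕ, ENNReal.ofReal (((2 : ℝ) ^ (-(b * s / 4))) ^ j) := by
      rw [hS, mul_assoc, ← ENNReal.tsum_mul_right, ← ENNReal.tsum_mul_left]
      refine tsum_congr fun k => ?_
      rw [← ENNReal.tsum_mul_left, ← ENNReal.tsum_mul_left]
      refine tsum_congr fun j => ?_
      rw [← ENNReal.ofReal_mul (by positivity), ← ENNReal.ofReal_mul (by positivity)]
      ring_nf
    rw [this]
    exact ENNReal.mul_ne_top (ENNReal.mul_ne_top ENNReal.ofReal_ne_top (geom _ (by positivity)))
      (geom _ (by positivity))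
  refine ⟨S.toReal, fun A hA => ?_⟩
  rw [ENNReal.ofReal_toReal hSfin]
  refine (dNorm_anti (zero_lt_one.trans_le hP'1).ne' (zero_lt_one.trans_le hQ'1).ne'
    hP'P hQ'Q A).trans ((dNorm_le_iSup_finset P' Q' A).trans (iSup_le fun F₀ => ?_))
  refine dNorm_le_of_finset_bound_aux (P := P₀) (Q := Q₀) hP₀ hP₀t hQ₀ hQ₀t hP'1
    ENNReal.ofReal_ne_top hQ'1
    ENNReal.ofReal_ne_top ha hb hs0 hs1 hκ0 hκb (by rw [hPr]; simp) (by rw [hQr]; simp) hK₁0 _ F₀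
    (fun y t h => ?_) fun F => ?_
  · by_contra h'
    exact h (by simp [h'])
  · refine le_trans (dNorm_mono fun y t => ?_) ((hA κ hκ0 F).trans ?_)
    · split_ifs <;> simp
    · gcongr
      exact le_max_left _ _

end Levels

/-! ### Coverings by sparse families of balls -/

theorem exists_separated_net {X : Type*} [PseudoMetricSpace X] (F : Finset X) {r : ℝ}
    (hr : 0 ≤ r) :
    ∃ G ⊆ F, (∀ x ∈ G, ∀ y ∈ G, x ≠ y → r < dist x y) ∧ ∀ x ∈ F, ∃ z ∈ G, dist x z ≤ r := by
  classical
  set C := F.powerset.filter fun G => ∀ x ∈ G, ∀ y ∈ G, x ≠ y → r < dist x y with hC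
  have hne : C.Nonempty := ⟨∅, by simp [hC]⟩
  obtain ⟨G, hG, hmax⟩ := C.exists_max_image Finset.card hne
  obtain ⟨hGF, hsep⟩ := Finset.mem_filter.1 hG
  refine ⟨G, Finset.mem_powerset.1 hGF, hsep, fun x hx => ?_⟩
  by_contra! h
  have hxG : x ∉ G := fun hxG => by simpa using (h x hxG).trans_le' hr
  have hins : insert x G ∈ C := by
    refine Finset.mem_filter.2 ⟨Finset.mem_powerset.2
      (Finset.insert_subset hx (Finset.mem_powerset.1 hGF)), fun a ha b hb hab => ?_⟩
    rcases Finset.mem_insert.1 ha with rfl | ha' <;> rcases Finset.mem_insert.1 hb with rfl | hb'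
    · exact absurd rfl hab
    · exact h b hb'
    · rw [dist_comm]; exact h a ha'
    · exact hsep a ha' b hb' hab
  have := hmax _ hins
  rw [Finset.card_insert_of_notMem hxG] at this
  omega

/-- A finite set `F` is covered by `K` families of balls, the `k`-th one of radius `2 R k`, such that
a ball of the `k`-th family has at most `|F| ^ (1 / K)` centres of that family within distance
`R (k + 1) / 4`. A point `x` belongs to the `k`-th family if the number of points of `F` near `x`
grows by at most a factor `|F| ^ (1 / K)` between the scales `R k` and `R (k + 1)`. -/
theorem exists_sparse_cover {X : Type*} [PseudoMetricSpace X] (F : Finset X) (K : ℕ)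
    (R : ℕ → ℝ) (hR0 : ∀ k, 0 < R k) (hR : ∀ k, 2 * R k ≤ R (k + 1)) (hK : K ≠ 0) :
    ∃ G : ℕ → Finset X, (∀ k, G k ⊆ F) ∧
      (∀ x ∈ F, ∃ k < K, ∃ z ∈ G k, dist x z ≤ 2 * R k) ∧
      ∀ k, ∀ z ∈ G k, (((G k).filter fun z' => dist z z' ≤ R (k + 1) / 4).card : ℝ) ≤
        (F.card : ℝ) ^ (1 / K : ℝ) := by
  classical
  set D : ℝ := (F.card : ℝ) ^ (1 / K : ℝ) with hD
  have hD0 : 0 ≤ D := by positivity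
  set n : ℕ → X → ℕ := fun k x => (F.filter fun y => dist x y ≤ R k).card with hn
  have hn1 : ∀ k, ∀ x ∈ F, 1 ≤ n k x := fun k x hx =>
    Finset.card_pos.2 ⟨x, Finset.mem_filter.2 ⟨hx, by simpa using (hR0 k).le⟩⟩
  set Fk : ℕ → Finset X := fun k => F.filter fun x => (n (k + 1) x : ℝ) ≤ D * n k x with hFk
  choose G hGF hGsep hGcov using fun k => exists_separated_net (Fk k) (mul_pos two_pos (hR0 k)).le
  refine ⟨G, fun k => (hGF k).trans (Finset.filter_subset _ _), fun x hx => ?_, fun k z hz => ?_⟩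
  · -- otherwise the number of points near `x` would grow by more than `|F| ^ (1 / K)` at each of
    -- `K` scales and exceed `|F|`
    by_contra! h
    have hk : ∀ k < K, D * n k x < n (k + 1) x := by
      intro k hk
      by_contra! h'
      obtain ⟨z, hz, hxz⟩ := hGcov k x (Finset.mem_filter.2 ⟨hx, h'⟩)
      exact absurd hxz (not_le.2 (h k hk z hz))
    have hpos : (0 : ℝ) < F.card := by exact_mod_cast Finset.card_pos.2 ⟨x, hx⟩
    have hDpos : 0 < D := Real.rpow_pos_of_pos hpos _
    have hind : ∀ k ≤ K, k ≠ 0 → D ^ k < n k x := by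
      intro k
      induction k with
      | zero => simp
      | succ k ih =>
        intro hkK _
        rcases eq_or_ne k 0 with rfl | hk0
        · have h1 := hk 0 (by omega)
          have h2 : (1 : ℝ) ≤ n 0 x := by exact_mod_cast hn1 0 x hx
          simp only [zero_add, pow_one]
          nlinarith
        · have h1 := hk k (by omega)
          have h2 := ih (by omega) hk0
          rw [pow_succ']
          nlinarith
    have h1 := hind K le_rfl hK
    rw [hD, ← Real.rpow_natCast, ← Real.rpow_mul hpos.le,
      one_div_mul_cancel (by exact_mod_cast hK), Real.rpow_one] at h1
    have h2 : n K x ≤ F.card := Finset.card_filter_le _ _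
    have : F.card < n K x := by exact_mod_cast h1
    omega
  · set J := (G k).filter fun z' => dist z z' ≤ R (k + 1) / 4 with hJ
    set U := F.filter fun y => dist z y ≤ R (k + 1) / 4 + R k with hU
    have hzF : z ∈ F := (Finset.mem_filter.1 (hGF k hz)).1
    have hRk := hR k
    have hRk0 := hR0 k
    have hUpos : (0 : ℝ) < U.card := by
      exact_mod_cast Finset.card_pos.2
        ⟨z, Finset.mem_filter.2 ⟨hzF, by simp only [dist_self]; linarith⟩⟩
    -- the balls of radius `R k` around the separated points of `J` are disjoint, and each of them
    -- contains a fraction at least `1 / D` of the points of `U`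
    have hsum : ∑ z' ∈ J, n k z' ≤ U.card := by
      rw [← Finset.card_biUnion]
      · refine Finset.card_le_card fun y hy => ?_
        obtain ⟨z', hz', hy'⟩ := Finset.mem_biUnion.1 hy
        obtain ⟨hyF, hyd⟩ := Finset.mem_filter.1 hy'
        have := (Finset.mem_filter.1 hz').2
        exact Finset.mem_filter.2 ⟨hyF, by linarith [dist_triangle z z' y]⟩
      · intro a ha b hb hab
        rw [Function.onFun, Finset.disjoint_left]
        intro y hya hyb
        have h1 := (Finset.mem_filter.1 hya).2
        have h2 := (Finset.mem_filter.1 hyb).2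
        have h3 := hGsep k a (Finset.mem_filter.1 ha).1 b (Finset.mem_filter.1 hb).1 hab
        linarith [dist_triangle_right a b y]
    have hlow : ∀ z' ∈ J, (U.card : ℝ) ≤ D * n k z' := by
      intro z' hz'
      obtain ⟨hz'G, hz'd⟩ := Finset.mem_filter.1 hz'
      refine le_trans ?_ (Finset.mem_filter.1 (hGF k hz'G)).2
      have : U ⊆ F.filter fun y => dist z' y ≤ R (k + 1) := by
        intro y hy
        obtain ⟨hyF, hyd⟩ := Finset.mem_filter.1 hy
        refine Finset.mem_filter.2 ⟨hyF, ?_⟩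
        have := dist_triangle_left z' y z
        linarith
      exact_mod_cast Finset.card_le_card this
    have h1 : (J.card : ℝ) * U.card ≤ D * U.card := by
      calc (J.card : ℝ) * U.card = ∑ z' ∈ J, (U.card : ℝ) := by simp
        _ ≤ ∑ z' ∈ J, D * n k z' := Finset.sum_le_sum hlow
        _ = D * (∑ z' ∈ J, n k z' : ℕ) := by rw [← Finset.mul_sum]; push_cast; rfl
        _ ≤ D * U.card := by gcongr
    exact le_of_mul_le_mul_right h1 hUpos

/-! ### Separation of variables in an exponential -/

theorem summable_norm_pow_div_factorial_sigma (J : Type*) [Fintype J] (Λ : ℂ) :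
    Summable (fun p : Σ m : ℕ, (Fin m → J) => ‖Λ‖ ^ p.1 / (p.1.factorial : ℝ)) := by
  rw [summable_sigma_of_nonneg (fun _ => by positivity)]
  refine ⟨fun m => Summable.of_finite, ?_⟩
  have : (fun m : ℕ => ∑' _ : Fin m → J, ‖Λ‖ ^ m / (m.factorial : ℝ)) =
      fun m : ℕ => (Fintype.card J * ‖Λ‖) ^ m / (m.factorial : ℝ) := by
    ext m
    rw [tsum_fintype, Finset.sum_const, Finset.card_univ, Fintype.card_fun, Fintype.card_fin,
      nsmul_eq_mul, mul_pow]
    push_cast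
    ring
  rw [this]
  exact Real.summable_pow_div_factorial _

theorem norm_prod_le_one {ι : Type*} [Fintype ι] {u : ι → ℂ} (hu : ∀ j, ‖u j‖ ≤ 1) :
    ‖∏ l, u l‖ ≤ 1 := by
  rw [norm_prod]
  exact Finset.prod_le_one (fun _ _ => norm_nonneg _) fun l _ => hu l

/-- The exponential of a dot product as a rapidly convergent sum of products. -/
theorem hasSum_cexp_dot {J : Type*} [Fintype J] (Λ : ℂ) {u v : J → ℂ} (hu : ∀ j, ‖u j‖ ≤ 1)
    (hv : ∀ j, ‖v j‖ ≤ 1) :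
    HasSum (fun p : Σ m : ℕ, (Fin m → J) =>
      Λ ^ p.1 / (p.1.factorial : ℂ) * ((∏ l, u (p.2 l)) * ∏ l, v (p.2 l)))
      (Complex.exp (Λ * ∑ j, u j * v j)) := by
  have h1 : HasSum (fun m : ℕ => (Λ * ∑ j, u j * v j) ^ m / (m.factorial : ℂ))
      (Complex.exp (Λ * ∑ j, u j * v j)) := by
    rw [Complex.exp_eq_exp_ℂ]
    exact NormedSpace.expSeries_div_hasSum_exp _
  refine HasSum.sigma_of_hasSum h1 (fun m => ?_) ?_
  · have : (Λ * ∑ j, u j * v j) ^ m / (m.factorial : ℂ) = ∑ f : Fin m → J,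
        Λ ^ m / (m.factorial : ℂ) * ((∏ l, u (f l)) * ∏ l, v (f l)) := by
      rw [mul_pow, Fintype.sum_pow, ← Finset.mul_sum]
      simp only [Finset.prod_mul_distrib]
      ring
    rw [this]
    exact hasSum_fintype _
  · refine Summable.of_norm_bounded (summable_norm_pow_div_factorial_sigma J Λ) fun p => ?_
    rw [norm_mul, norm_div, norm_pow, Complex.norm_natCast, norm_mul]
    have h2 := norm_prod_le_one fun l => hu (p.2 l)
    have h3 := norm_prod_le_one fun l => hv (p.2 l)
    calc _ ≤ ‖Λ‖ ^ p.1 / (p.1.factorial : ℝ) * (1 * 1) := by gcongr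
      _ = _ := by ring

/-! ### Decay of the Fourier transform of a Gaussian on the paraboloid -/

section Phase

variable {n : ℕ}

/-- The phase `X · ζ - 2π t |ζ|²` of the Schrödinger wave, as a function of `z = (X, t)` and `ζ`. -/
noncomputable def wavePhase (z : EuclideanSpace ℝ (Fin n) × ℝ)
    (ζ : EuclideanSpace ℝ (Fin n)) : ℝ :=
  inner ℝ z.1 ζ - 2 * Real.pi * z.2 * ‖ζ‖ ^ 2

/-- The plane wave `e^{2πi (X · ζ - 2π t |ζ|²)}`. -/
noncomputable def waveChar (z : EuclideanSpace ℝ (Fin n) × ℝ) (ζ : EuclideanSpace ℝ (Fin n)) : ℂ :=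
  Complex.exp (2 * Real.pi * Complex.I * (wavePhase z ζ : ℂ))

@[fun_prop]
theorem continuous_waveChar (z : EuclideanSpace ℝ (Fin n) × ℝ) : Continuous (waveChar z) := by
  unfold waveChar wavePhase
  fun_prop

theorem norm_waveChar (z : EuclideanSpace ℝ (Fin n) × ℝ) (ζ : EuclideanSpace ℝ (Fin n)) :
    ‖waveChar z ζ‖ = 1 := by
  rw [waveChar, show (2 * Real.pi * Complex.I * (wavePhase z ζ : ℂ) : ℂ) =
    ((2 * Real.pi * wavePhase z ζ : ℝ) : ℂ) * Complex.I by push_cast; ring]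
  exact Complex.norm_exp_ofReal_mul_I _

theorem waveChar_add (z w : EuclideanSpace ℝ (Fin n) × ℝ) (ζ : EuclideanSpace ℝ (Fin n)) :
    waveChar (z + w) ζ = waveChar z ζ * waveChar w ζ := by
  rw [waveChar, waveChar, waveChar, ← Complex.exp_add]
  congr 1
  simp only [wavePhase, Prod.fst_add, Prod.snd_add, inner_add_left]
  push_cast
  ring

theorem waveChar_sub (z w : EuclideanSpace ℝ (Fin n) × ℝ) (ζ : EuclideanSpace ℝ (Fin n)) :
    waveChar (z - w) ζ = waveChar z ζ * (starRingEnd ℂ) (waveChar w ζ) := by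
  rw [waveChar, waveChar, waveChar, ← Complex.exp_conj, ← Complex.exp_add]
  congr 1
  simp only [wavePhase, Prod.fst_sub, Prod.snd_sub, inner_sub_left, map_mul, Complex.conj_I,
    Complex.conj_ofReal, map_ofNat]
  push_cast
  ring

/-- The exact size of the Fourier transform of a Gaussian of width `h` centred at `ζ₀` on the
paraboloid. -/
theorem norm_integral_gaussian_waveChar {h : ℝ} (hh : 0 < h) (ζ₀ : EuclideanSpace ℝ (Fin n))
    (z : EuclideanSpace ℝ (Fin n) × ℝ) :
    ‖∫ ζ, (Real.exp (-Real.pi * ‖ζ - ζ₀‖ ^ 2 / h ^ 2) : ℂ) * waveChar z ζ‖ =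
      (Real.pi / ‖(Real.pi / h ^ 2 + 4 * Real.pi ^ 2 * z.2 * Complex.I : ℂ)‖) ^ (n / 2 : ℝ) *
      Real.exp (-(Real.pi ^ 2 * ‖z.1 - (4 * Real.pi * z.2) • ζ₀‖ ^ 2 *
        ((Real.pi / h ^ 2) / ((Real.pi / h ^ 2) ^ 2 + (4 * Real.pi ^ 2 * z.2) ^ 2)))) := by
  set b : ℂ := (Real.pi / h ^ 2 + 4 * Real.pi ^ 2 * z.2 * Complex.I : ℂ) with hb
  have hb' : b = ((Real.pi / h ^ 2 : ℝ) : ℂ) + ((4 * Real.pi ^ 2 * z.2 : ℝ) : ℂ) * Complex.I := by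
    rw [hb]; push_cast; ring
  have hbre : b.re = Real.pi / h ^ 2 := by
    rw [hb', Complex.add_re, Complex.re_ofReal_mul, Complex.ofReal_re, Complex.I_re]; ring
  have hbim : b.im = 4 * Real.pi ^ 2 * z.2 := by
    rw [hb', Complex.add_im, Complex.im_ofReal_mul, Complex.ofReal_im, Complex.I_im]; ring
  have hbpos : 0 < b.re := by rw [hbre]; positivity
  have hb0 : b ≠ 0 := fun h0 => by rw [h0] at hbpos; simp at hbpos
  set w := z.1 - (4 * Real.pi * z.2) • ζ₀ with hw
  have h1 : ∫ ζ, (Real.exp (-Real.pi * ‖ζ - ζ₀‖ ^ 2 / h ^ 2) : ℂ) * waveChar z ζ =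
      waveChar z ζ₀ * ∫ v : EuclideanSpace ℝ (Fin n),
        Complex.exp (-b * ‖v‖ ^ 2 + (2 * Real.pi * Complex.I) * inner ℝ w v) := by
    rw [← integral_add_right_eq_self _ ζ₀, ← integral_const_mul]
    congr 1
    ext v
    rw [waveChar, waveChar, Complex.ofReal_exp, ← Complex.exp_add, ← Complex.exp_add]
    congr 1
    have e1 : wavePhase z (v + ζ₀) = wavePhase z ζ₀ + inner ℝ w v - 2 * Real.pi * z.2 * ‖v‖ ^ 2 := by
      simp only [wavePhase, hw, inner_add_right, inner_sub_left, real_inner_smul_left,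
        norm_add_sq_real]
      rw [real_inner_comm v ζ₀]
      ring
    rw [e1, add_sub_cancel_right, hb]
    push_cast
    ring
  rw [h1, norm_mul, norm_waveChar, one_mul, GaussianFourier.integral_cexp_neg_mul_sq_norm_add hbpos,
    norm_mul, finrank_euclideanSpace_fin]
  congr 1
  · have : ((n : ℂ) / 2) = ((n / 2 : ℝ) : ℂ) := by push_cast; ring
    rw [this, Complex.norm_cpow_real, norm_div, Complex.norm_real, Real.norm_of_nonneg Real.pi_pos.le]
  · rw [Complex.norm_exp]
    congr 1
    have : ((2 * Real.pi * Complex.I) ^ 2 * ‖w‖ ^ 2 / (4 * b) : ℂ) =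
        ((-(Real.pi ^ 2 * ‖w‖ ^ 2) : ℝ) : ℂ) * b⁻¹ := by
      field_simp
      push_cast
      rw [Complex.I_sq]
      ring
    rw [this, Complex.re_ofReal_mul, Complex.inv_re, Complex.normSq_apply, hbre, hbim]
    ring

theorem norm_integral_gaussian_waveChar_le {h : ℝ} (hh : 0 < h) (ζ₀ : EuclideanSpace ℝ (Fin n))
    (z : EuclideanSpace ℝ (Fin n) × ℝ) :
    ‖∫ ζ, (Real.exp (-Real.pi * ‖ζ - ζ₀‖ ^ 2 / h ^ 2) : ℂ) * waveChar z ζ‖ ≤ h ^ n := by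
  rw [norm_integral_gaussian_waveChar hh]
  have hb : Real.pi / h ^ 2 ≤ ‖(Real.pi / h ^ 2 + 4 * Real.pi ^ 2 * z.2 * Complex.I : ℂ)‖ := by
    refine le_trans (le_of_eq ?_) (Complex.re_le_norm _)
    rw [show (Real.pi / h ^ 2 + 4 * Real.pi ^ 2 * z.2 * Complex.I : ℂ) =
      ((Real.pi / h ^ 2 : ℝ) : ℂ) + ((4 * Real.pi ^ 2 * z.2 : ℝ) : ℂ) * Complex.I by push_cast; ring,
      Complex.add_re, Complex.re_ofReal_mul, Complex.ofReal_re, Complex.I_re]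
    ring
  have hπ := Real.pi_pos
  have hA : 0 < Real.pi / h ^ 2 := by positivity
  have h1 : Real.pi / ‖(Real.pi / h ^ 2 + 4 * Real.pi ^ 2 * z.2 * Complex.I : ℂ)‖ ≤ h ^ 2 := by
    rw [div_le_iff₀ (hA.trans_le hb)]
    calc Real.pi = h ^ 2 * (Real.pi / h ^ 2) := by field_simp
      _ ≤ _ := by gcongr
  calc _ ≤ (h ^ 2) ^ (n / 2 : ℝ) * 1 := by
        gcongr
        rw [Real.exp_le_one_iff, neg_nonpos]
        positivity
    _ = h ^ n := by
        rw [mul_one, ← Real.rpow_natCast h 2, ← Real.rpow_mul hh.le]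
        push_cast
        rw [mul_div_cancel₀ _ two_ne_zero, Real.rpow_natCast]

/-- Far from the origin the Fourier transform of the Gaussian gains a factor `M`. -/
theorem norm_integral_gaussian_waveChar_le_div [NeZero n] {h M : ℝ} (hh : 0 < h) (hh1 : h ≤ 1)
    (hM : 1 ≤ M) {ζ₀ : EuclideanSpace ℝ (Fin n)} (hζ₀ : ‖ζ₀‖ ≤ 2)
    {z : EuclideanSpace ℝ (Fin n) × ℝ}
    (hz : 41 * M ^ 3 / h ^ 2 ≤ ‖z.1‖ ∨ 41 * M ^ 3 / h ^ 2 ≤ |z.2|) :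
    ‖∫ ζ, (Real.exp (-Real.pi * ‖ζ - ζ₀‖ ^ 2 / h ^ 2) : ℂ) * waveChar z ζ‖ ≤ h ^ n / M := by
  have hπ := Real.pi_pos
  have hπ3 := Real.pi_gt_three
  have hπ4 := Real.pi_lt_d2
  have hM23 : M ^ 2 ≤ M ^ 3 := pow_le_pow_right₀ hM (by norm_num)
  rcases le_or_gt (M ^ 2 / h ^ 2) |z.2| with ht | ht
  · rw [norm_integral_gaussian_waveChar hh]
    have hb : 4 * Real.pi ^ 2 * |z.2| ≤
        ‖(Real.pi / h ^ 2 + 4 * Real.pi ^ 2 * z.2 * Complex.I : ℂ)‖ := by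
      refine le_trans (le_of_eq ?_) (Complex.abs_im_le_norm _)
      rw [show (Real.pi / h ^ 2 + 4 * Real.pi ^ 2 * z.2 * Complex.I : ℂ) =
        ((Real.pi / h ^ 2 : ℝ) : ℂ) + ((4 * Real.pi ^ 2 * z.2 : ℝ) : ℂ) * Complex.I by
          push_cast; ring,
        Complex.add_im, Complex.im_ofReal_mul, Complex.ofReal_im, Complex.I_im, zero_add, mul_one,
        abs_mul, abs_of_pos (by positivity : 0 < 4 * Real.pi ^ 2)]
    have ht0 : 0 < |z.2| := lt_of_lt_of_le (by positivity) ht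
    have h1 : Real.pi / ‖(Real.pi / h ^ 2 + 4 * Real.pi ^ 2 * z.2 * Complex.I : ℂ)‖ ≤
        (h / M) ^ 2 := by
      rw [div_le_iff₀ (lt_of_lt_of_le (by positivity) hb)]
      calc Real.pi ≤ 4 * Real.pi ^ 2 * 1 := by nlinarith
        _ = (h / M) ^ 2 * (4 * Real.pi ^ 2 * (M ^ 2 / h ^ 2)) := by field_simp
        _ ≤ (h / M) ^ 2 * (4 * Real.pi ^ 2 * |z.2|) := by gcongr
        _ ≤ _ := by gcongr
    calc _ ≤ ((h / M) ^ 2) ^ (n / 2 : ℝ) * 1 := by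
          gcongr
          rw [Real.exp_le_one_iff, neg_nonpos]
          positivity
      _ = h ^ n / M ^ n := by
          rw [mul_one, ← Real.rpow_natCast (h / M) 2, ← Real.rpow_mul (by positivity)]
          push_cast
          rw [mul_div_cancel₀ _ two_ne_zero, Real.rpow_natCast, div_pow]
      _ ≤ h ^ n / M := by
          gcongr
          exact le_self_pow₀ hM (NeZero.ne n)
  · have hX : 41 * M ^ 3 / h ^ 2 ≤ ‖z.1‖ := by
      rcases hz with hz | hz
      · exact hz
      · exfalso
        have : M ^ 2 / h ^ 2 ≤ 41 * M ^ 3 / h ^ 2 := by gcongr; nlinarith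
        linarith
    have h0 : 0 ≤ Real.pi / ‖(Real.pi / h ^ 2 + 4 * Real.pi ^ 2 * z.2 * Complex.I : ℂ)‖ := by
      positivity
    have h1 : (Real.pi / ‖(Real.pi / h ^ 2 + 4 * Real.pi ^ 2 * z.2 * Complex.I : ℂ)‖) ^
        (n / 2 : ℝ) ≤ h ^ n := by
      have := norm_integral_gaussian_waveChar_le hh (0 : EuclideanSpace ℝ (Fin n)) (0, z.2)
      rw [norm_integral_gaussian_waveChar hh] at this
      simpa using this
    rw [norm_integral_gaussian_waveChar hh]
    set w := z.1 - (4 * Real.pi * z.2) • ζ₀ with hw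
    have hwlow : 15 * M ^ 3 / h ^ 2 ≤ ‖w‖ := by
      have h2 : ‖(4 * Real.pi * z.2) • ζ₀‖ ≤ 26 * M ^ 3 / h ^ 2 := by
        rw [norm_smul, Real.norm_eq_abs, abs_mul, abs_of_pos (by positivity : 0 < 4 * Real.pi)]
        calc 4 * Real.pi * |z.2| * ‖ζ₀‖ ≤ 4 * 3.15 * (M ^ 2 / h ^ 2) * 2 := by gcongr
          _ ≤ 26 * (M ^ 3 / h ^ 2) := by
            have : M ^ 2 / h ^ 2 ≤ M ^ 3 / h ^ 2 := by gcongr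
            have : 0 ≤ M ^ 2 / h ^ 2 := by positivity
            nlinarith
          _ = _ := by ring
      have h3 := norm_sub_norm_le z.1 ((4 * Real.pi * z.2) • ζ₀)
      have h4 : 41 * M ^ 3 / h ^ 2 = 15 * M ^ 3 / h ^ 2 + 26 * M ^ 3 / h ^ 2 := by ring
      linarith
    have hq : h ^ 2 / (160 * Real.pi * M ^ 4) ≤
        (Real.pi / h ^ 2) / ((Real.pi / h ^ 2) ^ 2 + (4 * Real.pi ^ 2 * z.2) ^ 2) := by
      have h5 : (4 * Real.pi ^ 2 * z.2) ^ 2 ≤ 159 * M ^ 4 * (Real.pi / h ^ 2) ^ 2 := by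
        have h6 : z.2 ^ 2 ≤ (M ^ 2 / h ^ 2) ^ 2 := by
          rw [← sq_abs]
          gcongr
        calc (4 * Real.pi ^ 2 * z.2) ^ 2 = 16 * Real.pi ^ 2 * Real.pi ^ 2 * z.2 ^ 2 := by ring
          _ ≤ 16 * 3.15 ^ 2 * Real.pi ^ 2 * (M ^ 2 / h ^ 2) ^ 2 := by gcongr
          _ ≤ 159 * Real.pi ^ 2 * (M ^ 2 / h ^ 2) ^ 2 := by gcongr; norm_num
          _ = _ := by field_simp
      have h6 : (Real.pi / h ^ 2) ^ 2 + (4 * Real.pi ^ 2 * z.2) ^ 2 ≤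
          160 * M ^ 4 * (Real.pi / h ^ 2) ^ 2 := by
        have : 1 ≤ M ^ 4 := one_le_pow₀ hM
        have : 0 ≤ (Real.pi / h ^ 2) ^ 2 := by positivity
        nlinarith
      calc h ^ 2 / (160 * Real.pi * M ^ 4) =
          (Real.pi / h ^ 2) / (160 * M ^ 4 * (Real.pi / h ^ 2) ^ 2) := by field_simp
        _ ≤ _ := by gcongr
    have hy : M ≤ Real.pi ^ 2 * ‖w‖ ^ 2 *
        ((Real.pi / h ^ 2) / ((Real.pi / h ^ 2) ^ 2 + (4 * Real.pi ^ 2 * z.2) ^ 2)) := by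
      calc M ≤ M ^ 2 * 1 := by nlinarith
        _ ≤ M ^ 2 * (225 * Real.pi / (160 * h ^ 2)) := by
            gcongr
            rw [le_div_iff₀ (by positivity)]
            nlinarith [pow_le_one₀ hh.le hh1 (n := 2)]
        _ = Real.pi ^ 2 * (15 * M ^ 3 / h ^ 2) ^ 2 * (h ^ 2 / (160 * Real.pi * M ^ 4)) := by
            field_simp
            ring
        _ ≤ _ := by gcongr
    calc _ ≤ h ^ n * Real.exp (-M) := by gcongr
      _ ≤ h ^ n * M⁻¹ := by
        gcongr
        rw [Real.exp_neg]
        gcongr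
        linarith [Real.add_one_le_exp M]
      _ = _ := by rw [div_eq_mul_inv]

end Phase

/-! ### Almost orthogonality of distant plane waves -/

section Bessel

variable {n : ℕ}

theorem integrable_gaussian {h : ℝ} (hh : 0 < h) (ζ₀ : EuclideanSpace ℝ (Fin n)) :
    Integrable fun ζ : EuclideanSpace ℝ (Fin n) => Real.exp (-Real.pi * ‖ζ - ζ₀‖ ^ 2 / h ^ 2) := by
  have h1 := (GaussianFourier.integrable_cexp_neg_mul_sq_norm_add
    (V := EuclideanSpace ℝ (Fin n)) (b := (Real.pi / h ^ 2 : ℝ))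
    (by rw [Complex.ofReal_re]; positivity) 0 0).norm.comp_sub_right ζ₀
  refine h1.congr (Filter.Eventually.of_forall fun ζ => ?_)
  simp only [Complex.norm_exp]
  congr 1
  rw [zero_mul, add_zero, ← Complex.ofReal_pow, ← Complex.ofReal_neg, ← Complex.ofReal_mul,
    Complex.ofReal_re]
  ring

/-- A Bessel inequality for the plane waves `waveChar (Z i)` over a set `S` of diameter about `h`:
after majorising the indicator function of `S` by a Gaussian, the Gram matrix is the Fourier
transform of that Gaussian on the paraboloid. -/
theorem sum_sq_norm_integral_waveChar_le {ι : Type*} (I : Finset ι)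
    (Z : ι → EuclideanSpace ℝ (Fin n) × ℝ) {S : Set (EuclideanSpace ℝ (Fin n))}
    (hSm : MeasurableSet S) {h D : ℝ} (hh : 0 < h) (hD0 : 0 < D) (ζ₀ : EuclideanSpace ℝ (Fin n))
    (hS : ∀ ζ ∈ S, ‖ζ - ζ₀‖ ^ 2 ≤ n * h ^ 2) (κ : ι → ι → ℝ) (hκ : ∀ i j, κ i j = κ j i)
    (hκ' : ∀ i ∈ I, ∀ j ∈ I, ‖∫ ζ, (Real.exp (-Real.pi * ‖ζ - ζ₀‖ ^ 2 / h ^ 2) : ℂ) *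
      waveChar (Z i - Z j) ζ‖ ≤ κ i j)
    (hD : ∀ i ∈ I, ∑ j ∈ I, κ i j ≤ D) {u : EuclideanSpace ℝ (Fin n) → ℂ}
    (hu : Integrable u) (hu2 : Integrable fun ζ => ‖u ζ‖ ^ 2) :
    ∑ i ∈ I, ‖∫ ζ in S, waveChar (Z i) ζ * u ζ‖ ^ 2 ≤
      Real.exp (Real.pi * n) * D * ∫ ζ in S, ‖u ζ‖ ^ 2 := by
  set J : ι → ℂ := fun i => ∫ ζ in S, waveChar (Z i) ζ * u ζ with hJ
  set T : EuclideanSpace ℝ (Fin n) → ℂ := fun ζ =>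
    ∑ i ∈ I, (starRingEnd ℂ) (J i) * waveChar (Z i) ζ with hT
  set A := ∑ i ∈ I, ‖J i‖ ^ 2 with hA
  set B := Real.exp (Real.pi * n) * D with hB
  have hB0 : 0 < B := by positivity
  set G : EuclideanSpace ℝ (Fin n) → ℝ := fun ζ => Real.exp (-Real.pi * ‖ζ - ζ₀‖ ^ 2 / h ^ 2) with hG
  have hGint : Integrable G := integrable_gaussian hh ζ₀
  -- by duality `∑ ‖J i‖ ^ 2 = ∫ T u` over `S`, where the norm of `T` is controlled by the Gram matrix
  have hTc : Continuous T := by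
    simp only [hT]
    fun_prop
  have hTb : ∀ ζ, ‖T ζ‖ ≤ ∑ i ∈ I, ‖J i‖ := by
    intro ζ
    refine (norm_sum_le _ _).trans (Finset.sum_le_sum fun i _ => ?_)
    rw [norm_mul, norm_waveChar, mul_one, RCLike.norm_conj]
  have hwu : ∀ i, Integrable fun ζ => waveChar (Z i) ζ * u ζ := fun i =>
    hu.bdd_mul (c := 1) (continuous_waveChar _).aestronglyMeasurable
      (Filter.Eventually.of_forall fun ζ => (norm_waveChar _ _).le)
  have hTu : Integrable fun ζ => T ζ * u ζ :=
    hu.bdd_mul (c := ∑ i ∈ I, ‖J i‖) hTc.aestronglyMeasurable (Filter.Eventually.of_forall hTb)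
  have hGT : Integrable fun ζ => G ζ * ‖T ζ‖ ^ 2 := by
    refine hGint.mul_bdd (c := (∑ i ∈ I, ‖J i‖) ^ 2)
      (hTc.norm.pow 2).aestronglyMeasurable (Filter.Eventually.of_forall fun ζ => ?_)
    rw [norm_pow, norm_norm]
    exact pow_le_pow_left₀ (norm_nonneg _) (hTb ζ) 2
  have hlow : ∀ ζ ∈ S, ‖T ζ‖ ^ 2 ≤ Real.exp (Real.pi * n) * (G ζ * ‖T ζ‖ ^ 2) := by
    intro ζ hζ
    have : 1 ≤ Real.exp (Real.pi * n) * G ζ := by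
      rw [hG, ← Real.exp_add, Real.one_le_exp_iff]
      have : Real.pi * ‖ζ - ζ₀‖ ^ 2 / h ^ 2 ≤ Real.pi * n := by
        rw [div_le_iff₀ (by positivity), mul_assoc]
        exact mul_le_mul_of_nonneg_left (hS ζ hζ) Real.pi_pos.le
      have e : -Real.pi * ‖ζ - ζ₀‖ ^ 2 / h ^ 2 = -(Real.pi * ‖ζ - ζ₀‖ ^ 2 / h ^ 2) := by ring
      rw [e]
      linarith
    rw [← mul_assoc]
    exact le_mul_of_one_le_left (by positivity) this
  have hGTle : ∫ ζ, G ζ * ‖T ζ‖ ^ 2 ≤ D * A := by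
    have h1 : ((∫ ζ, G ζ * ‖T ζ‖ ^ 2 : ℝ) : ℂ) = ∑ i ∈ I, ∑ j ∈ I,
        (starRingEnd ℂ) (J i) * J j * ∫ ζ, (G ζ : ℂ) * waveChar (Z i - Z j) ζ := by
      rw [← integral_complex_ofReal]
      have h2 : ∀ i j, Integrable fun ζ => (starRingEnd ℂ) (J i) * J j *
          ((G ζ : ℂ) * waveChar (Z i - Z j) ζ) := fun i j =>
        ((hGint.ofReal (𝕜 := ℂ)).mul_bdd (c := 1) (continuous_waveChar _).aestronglyMeasurable
          (Filter.Eventually.of_forall fun ζ => (norm_waveChar _ _).le)).const_mul _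
      simp only [← integral_const_mul]
      have h4 : ∀ ζ, ((G ζ * ‖T ζ‖ ^ 2 : ℝ) : ℂ) = ∑ i ∈ I, ∑ j ∈ I,
          (starRingEnd ℂ) (J i) * J j * ((G ζ : ℂ) * waveChar (Z i - Z j) ζ) := by
        intro ζ
        push_cast
        rw [← Complex.mul_conj', hT]
        simp only [map_sum, map_mul, Complex.conj_conj, waveChar_sub]
        rw [Finset.sum_mul_sum, Finset.mul_sum]
        simp only [Finset.mul_sum]
        exact Finset.sum_congr rfl fun i _ => Finset.sum_congr rfl fun j _ => by ring
      simp only [h4]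
      rw [integral_finsetSum _ fun i _ => integrable_finsetSum _ fun j _ => h2 i j]
      exact Finset.sum_congr rfl fun i _ => integral_finsetSum _ fun j _ => h2 i j
    have h3 : ∫ ζ, G ζ * ‖T ζ‖ ^ 2 ≤ ∑ i ∈ I, ∑ j ∈ I, ‖J i‖ * ‖J j‖ * κ i j := by
      have h4 : 0 ≤ ∫ ζ, G ζ * ‖T ζ‖ ^ 2 := integral_nonneg fun ζ => by positivity
      rw [← Real.norm_of_nonneg h4, ← Complex.norm_real, h1]
      refine (norm_sum_le _ _).trans (Finset.sum_le_sum fun i hi => (norm_sum_le _ _).trans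
        (Finset.sum_le_sum fun j hj => ?_))
      rw [norm_mul, norm_mul, RCLike.norm_conj]
      exact mul_le_mul_of_nonneg_left (hκ' i hi j hj) (by positivity)
    have hκ0 : ∀ i ∈ I, ∀ j ∈ I, 0 ≤ κ i j := fun i hi j hj => (norm_nonneg _).trans (hκ' i hi j hj)
    have h5 : ∑ i ∈ I, ∑ j ∈ I, ‖J i‖ ^ 2 * κ i j ≤ D * A := by
      rw [hA, Finset.mul_sum]
      refine Finset.sum_le_sum fun i hi => ?_
      rw [← Finset.mul_sum, mul_comm]
      exact mul_le_mul_of_nonneg_right (hD i hi) (by positivity)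
    have h6 : ∑ i ∈ I, ∑ j ∈ I, ‖J j‖ ^ 2 * κ i j ≤ D * A := by
      rw [Finset.sum_comm]
      simpa only [hκ] using h5
    have h7 : ∑ i ∈ I, ∑ j ∈ I, ‖J i‖ * ‖J j‖ * κ i j ≤
        (∑ i ∈ I, ∑ j ∈ I, ‖J i‖ ^ 2 * κ i j) / 2 + (∑ i ∈ I, ∑ j ∈ I, ‖J j‖ ^ 2 * κ i j) / 2 := by
      simp only [Finset.sum_div, ← Finset.sum_add_distrib]
      refine Finset.sum_le_sum fun i hi => Finset.sum_le_sum fun j hj => ?_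
      nlinarith [mul_nonneg (sq_nonneg (‖J i‖ - ‖J j‖)) (hκ0 i hi j hj)]
    linarith
  have hA1 : A ≤ ∫ ζ in S, ‖T ζ * u ζ‖ := by
    have h1 : ((A : ℝ) : ℂ) = ∫ ζ in S, T ζ * u ζ := by
      simp only [hT, Finset.sum_mul, mul_assoc]
      rw [integral_finsetSum _ fun i _ => ((hwu i).const_mul _).integrableOn]
      simp only [integral_const_mul]
      rw [hA]
      push_cast
      refine Finset.sum_congr rfl fun i _ => ?_
      rw [mul_comm, Complex.mul_conj, Complex.normSq_eq_norm_sq]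
      push_cast
      rfl
    have h2 : 0 ≤ A := Finset.sum_nonneg fun i _ => by positivity
    rw [← Real.norm_of_nonneg h2, ← Complex.norm_real, h1]
    exact norm_integral_le_integral_norm _
  -- the weights `B` and `1 / B` in the arithmetic-geometric mean inequality balance both terms
  have hA2 : ∫ ζ in S, ‖T ζ * u ζ‖ ≤ ∫ ζ in S, (B / 2 * ‖u ζ‖ ^ 2 +
      Real.exp (Real.pi * n) / (2 * B) * (G ζ * ‖T ζ‖ ^ 2)) := by
    refine setIntegral_mono_on hTu.norm.integrableOn
      ((hu2.const_mul _).add (hGT.const_mul _)).integrableOn hSm fun ζ hζ => ?_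
    have h1 : ‖T ζ * u ζ‖ ≤ B / 2 * ‖u ζ‖ ^ 2 + 1 / (2 * B) * ‖T ζ‖ ^ 2 := by
      rw [norm_mul]
      have : B / 2 * ‖u ζ‖ ^ 2 + 1 / (2 * B) * ‖T ζ‖ ^ 2 - ‖T ζ‖ * ‖u ζ‖ =
        1 / (2 * B) * (B * ‖u ζ‖ - ‖T ζ‖) ^ 2 := by field_simp; ring
      have : 0 ≤ 1 / (2 * B) * (B * ‖u ζ‖ - ‖T ζ‖) ^ 2 := by positivity
      linarith
    have h2 : 1 / (2 * B) * ‖T ζ‖ ^ 2 ≤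
        1 / (2 * B) * (Real.exp (Real.pi * n) * (G ζ * ‖T ζ‖ ^ 2)) :=
      mul_le_mul_of_nonneg_left (hlow ζ hζ) (by positivity)
    calc _ ≤ _ := h1
      _ ≤ B / 2 * ‖u ζ‖ ^ 2 + 1 / (2 * B) * (Real.exp (Real.pi * n) * (G ζ * ‖T ζ‖ ^ 2)) := by
        linarith
      _ = _ := by ring
  have hA3 : ∫ ζ in S, (B / 2 * ‖u ζ‖ ^ 2 +
      Real.exp (Real.pi * n) / (2 * B) * (G ζ * ‖T ζ‖ ^ 2)) ≤
      B / 2 * (∫ ζ in S, ‖u ζ‖ ^ 2) + A / 2 := by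
    rw [integral_add (hu2.const_mul _).integrableOn (hGT.const_mul _).integrableOn,
      integral_const_mul, integral_const_mul]
    have h1 : ∫ ζ in S, G ζ * ‖T ζ‖ ^ 2 ≤ ∫ ζ, G ζ * ‖T ζ‖ ^ 2 :=
      setIntegral_le_integral hGT (Filter.Eventually.of_forall fun ζ => by
        simp only [Pi.zero_apply]; positivity)
    have h2 : Real.exp (Real.pi * n) / (2 * B) * (∫ ζ in S, G ζ * ‖T ζ‖ ^ 2) ≤
        Real.exp (Real.pi * n) / (2 * B) * (D * A) :=
      mul_le_mul_of_nonneg_left (h1.trans hGTle) (by positivity)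
    have h3 : Real.exp (Real.pi * n) / (2 * B) * (D * A) = A / 2 := by
      rw [hB]; field_simp
    linarith
  linarith

end Bessel

/-! ### Averages over shifted cells -/

section Cells

variable {n : ℕ}

/-- The index of the cell of the lattice `∏ h i ℤ` that contains `x`. -/
noncomputable def cellIndex (h : Fin n → ℝ) (x : EuclideanSpace ℝ (Fin n)) : Fin n → ℤ :=
  fun i => ⌊x i / h i⌋

@[fun_prop]
theorem measurable_cellIndex (h : Fin n → ℝ) : Measurable (cellIndex h) := by
  unfold cellIndex
  refine measurable_pi_lambda _ fun i => Int.measurable_floor.comp ?_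
  fun_prop

theorem volume_cellIndex_eq {h : Fin n → ℝ} (hh : ∀ i, 0 < h i) (k : Fin n → ℤ) :
    volume (cellIndex h ⁻¹' {k}) = ∏ i, ENNReal.ofReal (h i) := by
  have h1 : cellIndex h ⁻¹' {k} = (WithLp.ofLp : EuclideanSpace ℝ (Fin n) → Fin n → ℝ) ⁻¹'
      (Set.univ.pi fun i => Set.Ico (k i * h i) (k i * h i + h i)) := by
    ext x
    simp only [Set.mem_preimage, Set.mem_singleton_iff, Set.mem_pi, Set.mem_univ, true_implies,
      Set.mem_Ico, cellIndex, funext_iff, Int.floor_eq_iff]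
    refine forall_congr' fun i => ?_
    rw [le_div_iff₀ (hh i), div_lt_iff₀ (hh i)]
    constructor <;> rintro ⟨a, b⟩ <;> constructor <;> linarith
  rw [h1, (PiLp.volume_preserving_ofLp (Fin n)).measure_preimage
    (MeasurableSet.univ_pi fun i => measurableSet_Ico).nullMeasurableSet, Real.volume_pi_Ico]
  simp

theorem lintegral_eq_tsum_fiber {α I : Type*} [MeasurableSpace α] [MeasurableSpace I] [Countable I]
    [MeasurableSingletonClass I] {μ : Measure α} {c : α → I} (hc : Measurable c) (f : α → ℝ≥0∞) :
    ∫⁻ x, f x ∂μ = ∑' k, ∫⁻ x in c ⁻¹' {k}, f x ∂μ := by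
  rw [← lintegral_iUnion (fun k => hc (measurableSet_singleton k))]
  · rw [← Set.preimage_iUnion, Set.iUnion_of_singleton, Set.preimage_univ, Measure.restrict_univ]
  · intro i j hij
    exact Disjoint.preimage _ (by simpa using hij)

end Cells

section LocalAverage

variable {E I J : Type*} [NormedAddCommGroup E] [MeasurableSpace E] [BorelSpace E]
  [MeasurableSpace I] [Countable I] [MeasurableSingletonClass I]

/-- The function that on the shift by `w` of a cell `c = k` is `v` times the average of `u` over the
cell; `m` is the common volume of the cells. -/
noncomputable def shiftedAverage (μ : Measure E) (c : E → I) (w : E) (m : ℝ) (u v : E → ℂ)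
    (ζ' : E) : ℂ :=
  v ζ' * ((m : ℂ)⁻¹ * ∫ ζ in c ⁻¹' {c (ζ' - w)}, u ζ ∂μ)

theorem measurable_shiftedAverage {μ : Measure E} {c : E → I} (hc : Measurable c) (w : E) (m : ℝ)
    {u v : E → ℂ} (hv : Measurable v) : Measurable (shiftedAverage μ c w m u v) := by
  unfold shiftedAverage
  refine hv.mul (measurable_const.mul ?_)
  exact (measurable_of_countable fun k : I => ∫ ζ in c ⁻¹' {k}, u ζ ∂μ).comp
    (hc.comp (measurable_id.sub_const w))

omit [MeasurableSpace I] [Countable I] [MeasurableSingletonClass I] in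
theorem volume_preimage_shift {μ : Measure E} [μ.IsAddHaarMeasure] {c : E → I} (w : E) (k : I) :
    μ {ζ' | c (ζ' - w) = k} = μ (c ⁻¹' {k}) := by
  have := measure_preimage_add_right μ (-w) (c ⁻¹' {k})
  rw [← this]
  congr 1
  ext x
  simp [sub_eq_add_neg]

theorem lintegral_sq_shiftedAverage_le {μ : Measure E} [μ.IsAddHaarMeasure] {c : E → I}
    (hc : Measurable c) (w : E) {m : ℝ} (hm : 0 < m)
    (hμ : ∀ k, μ (c ⁻¹' {k}) = ENNReal.ofReal m) (u : E → ℂ) {v : E → ℂ} (hv : ∀ ζ, ‖v ζ‖ ≤ 1) :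
    ∫⁻ ζ', ‖shiftedAverage μ c w m u v ζ'‖ₑ ^ 2 ∂μ ≤
      ∑' k, ENNReal.ofReal (m⁻¹ * ‖∫ ζ in c ⁻¹' {k}, u ζ ∂μ‖ ^ 2) := by
  have hc' : Measurable fun ζ' => c (ζ' - w) := hc.comp (measurable_id.sub_const w)
  rw [lintegral_eq_tsum_fiber hc']
  refine ENNReal.tsum_le_tsum fun k => ?_
  have hk : μ ((fun ζ' => c (ζ' - w)) ⁻¹' {k}) = ENNReal.ofReal m :=
    (volume_preimage_shift w k).trans (hμ k)
  calc ∫⁻ ζ' in (fun ζ' => c (ζ' - w)) ⁻¹' {k}, ‖shiftedAverage μ c w m u v ζ'‖ₑ ^ 2 ∂μ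
      ≤ ∫⁻ _ in (fun ζ' => c (ζ' - w)) ⁻¹' {k},
          ENNReal.ofReal ((m⁻¹ * ‖∫ ζ in c ⁻¹' {k}, u ζ ∂μ‖) ^ 2) ∂μ := by
        refine setLIntegral_mono measurable_const fun ζ' hζ' => ?_
        rw [← ofReal_norm, ← ENNReal.ofReal_pow (norm_nonneg _)]
        refine ENNReal.ofReal_le_ofReal (pow_le_pow_left₀ (norm_nonneg _) ?_ 2)
        have : c (ζ' - w) = k := hζ'
        rw [shiftedAverage, this, norm_mul, norm_mul, norm_inv, Complex.norm_real,
          Real.norm_of_nonneg hm.le]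
        exact mul_le_of_le_one_left (by positivity) (hv ζ')
    _ = ENNReal.ofReal ((m⁻¹ * ‖∫ ζ in c ⁻¹' {k}, u ζ ∂μ‖) ^ 2) * ENNReal.ofReal m := by
        rw [setLIntegral_const, hk]
    _ = _ := by
        rw [← ENNReal.ofReal_mul (by positivity)]
        congr 1
        field_simp

/-- If the kernel `e` factors through `e'` and an exponential of a dot product whenever `ζ'` lies in
the shifted cell of `ζ`, then the integral of `g` against `e` is a rapidly convergent combination
of integrals of shifted averages against `e'`. -/
theorem hasSum_integral_shiftedAverage [SecondCountableTopology E] [Fintype J] {μ : Measure E}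
    [μ.IsAddHaarMeasure] [SFinite μ] {c : E → I} (hc : Measurable c) (w : E) {m : ℝ} (hm : 0 < m)
    (hμ : ∀ k, μ (c ⁻¹' {k}) = ENNReal.ofReal m) {g : E → ℂ} (hg : Integrable g μ)
    (hgm : Measurable g) {a b : J → E → ℂ} (ham : ∀ j, Measurable (a j))
    (hbm : ∀ j, Measurable (b j)) (ha : ∀ j ζ, ‖a j ζ‖ ≤ 1) (hb : ∀ j ζ, ‖b j ζ‖ ≤ 1) (Λ : ℂ)
    {u : J → ℂ} (hu : ∀ j, ‖u j‖ ≤ 1) {e e' : E → ℂ} (hem : Measurable e) (he'm : Measurable e')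
    (he : ∀ ζ, ‖e ζ‖ ≤ 1) (he' : ∀ ζ, ‖e' ζ‖ ≤ 1)
    (hee : ∀ ζ ζ', g ζ ≠ 0 → c (ζ' - w) = c ζ →
      e ζ = e' ζ' * Complex.exp (Λ * ∑ j, u j * (a j ζ * b j ζ'))) :
    HasSum (fun p : Σ l : ℕ, (Fin l → J) =>
      Λ ^ p.1 / (p.1.factorial : ℂ) * (∏ l, u (p.2 l)) *
        ∫ ζ', e' ζ' * shiftedAverage μ c w m (fun ζ => (∏ l, a (p.2 l) ζ) * g ζ)
          (fun ζ' => ∏ l, b (p.2 l) ζ') ζ' ∂μ) (∫ ζ, e ζ * g ζ ∂μ) := by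
  classical
  set H : E × E → ℂ := fun z => if c (z.2 - w) = c z.1 then (m : ℂ)⁻¹ * g z.1 else 0 with hH
  have hset : MeasurableSet {z : E × E | c (z.2 - w) = c z.1} :=
    measurableSet_eq_fun (hc.comp (measurable_snd.sub_const w)) (hc.comp measurable_fst)
  have hHm : Measurable H :=
    Measurable.ite hset (measurable_const.mul (hgm.comp measurable_fst)) measurable_const
  have hfib : ∀ ζ, μ {ζ' | c (ζ' - w) = c ζ} = ENNReal.ofReal m := fun ζ =>
    (volume_preimage_shift w _).trans (hμ _)
  have hfibm : ∀ ζ, MeasurableSet {ζ' | c (ζ' - w) = c ζ} := fun ζ =>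
    (hc.comp (measurable_id.sub_const w)) (measurableSet_singleton (c ζ))
  have hHsec : ∀ ζ, (fun ζ' => H (ζ, ζ')) =
      {ζ' | c (ζ' - w) = c ζ}.indicator fun _ => (m : ℂ)⁻¹ * g ζ := by
    intro ζ
    ext ζ'
    simp [hH, Set.indicator_apply]
  have hHint : Integrable H (μ.prod μ) := by
    rw [integrable_prod_iff hHm.aestronglyMeasurable]
    refine ⟨Filter.Eventually.of_forall fun ζ => ?_, ?_⟩
    · rw [hHsec, integrable_indicator_iff (hfibm ζ)]
      exact integrableOn_const (by rw [hfib]; exact ENNReal.ofReal_ne_top)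
    · refine hg.norm.congr (Filter.Eventually.of_forall fun ζ => ?_)
      have : (fun ζ' => ‖H (ζ, ζ')‖) =
          {ζ' | c (ζ' - w) = c ζ}.indicator fun _ => ‖(m : ℂ)⁻¹ * g ζ‖ := by
        ext ζ'
        rw [congrFun (hHsec ζ) ζ', norm_indicator_eq_indicator_norm]
      simp only
      rw [this, integral_indicator_const _ (hfibm ζ), Measure.real, hfib,
        ENNReal.toReal_ofReal hm.le, norm_mul, norm_inv, Complex.norm_real,
        Real.norm_of_nonneg hm.le, smul_eq_mul, mul_inv_cancel_left₀ hm.ne']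
  set F : (Σ l : ℕ, (Fin l → J)) → E × E → ℂ := fun p z =>
    Λ ^ p.1 / (p.1.factorial : ℂ) * ((∏ l, u (p.2 l)) *
      ∏ l, (a (p.2 l) z.1 * b (p.2 l) z.2)) * (e' z.2 * H z) with hF
  have hab : ∀ j ζ ζ', ‖a j ζ * b j ζ'‖ ≤ 1 := fun j ζ ζ' => by
    rw [norm_mul]
    exact mul_le_one₀ (ha j ζ) (norm_nonneg _) (hb j ζ')
  have hFle : ∀ p z, ‖F p z‖ ≤ ‖Λ‖ ^ p.1 / (p.1.factorial : ℝ) * ‖H z‖ := by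
    intro p z
    have h1 := norm_prod_le_one fun l => hu (p.2 l)
    have h2 := norm_prod_le_one fun l => hab (p.2 l) z.1 z.2
    simp only [hF]
    rw [norm_mul, norm_mul, norm_mul, norm_mul, norm_div, norm_pow, Complex.norm_natCast]
    calc _ ≤ ‖Λ‖ ^ p.1 / (p.1.factorial : ℝ) * (1 * 1) * (1 * ‖H z‖) := by
          gcongr
          exact he' z.2
      _ = _ := by ring
  have hFint : ∀ p, Integrable (F p) (μ.prod μ) := by
    intro p
    refine (hHint.norm.const_mul _).mono' (Measurable.aestronglyMeasurable ?_)
      (Filter.Eventually.of_forall (hFle p))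
    simp only [hF]
    fun_prop
  have hsum : HasSum (fun p => ∫ z, F p z ∂(μ.prod μ)) (∫ z, ∑' p, F p z ∂(μ.prod μ)) := by
    refine hasSum_integral_of_summable_integral_norm hFint ?_
    refine Summable.of_nonneg_of_le (fun p => integral_nonneg fun z => norm_nonneg _) (fun p => ?_)
      ((summable_norm_pow_div_factorial_sigma J Λ).mul_right (∫ z, ‖H z‖ ∂(μ.prod μ)))
    rw [← integral_const_mul]
    exact integral_mono (hFint p).norm (hHint.norm.const_mul _) (hFle p)
  have h1 : ∫ z, ∑' p, F p z ∂(μ.prod μ) = ∫ ζ, e ζ * g ζ ∂μ := by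
    have e1 : ∀ z, ∑' p, F p z = e z.1 * H z := by
      intro z
      by_cases hz : H z = 0
      · simp [hF, hz]
      have hz1 : c (z.2 - w) = c z.1 := by
        by_contra h
        exact hz (by simp [hH, h])
      have hz2 : g z.1 ≠ 0 := fun h => hz (by simp [hH, h])
      rw [hee z.1 z.2 hz2 hz1, mul_right_comm]
      have := ((hasSum_cexp_dot Λ hu fun j => hab j z.1 z.2).mul_right (e' z.2 * H z)).tsum_eq
      rw [hF, this]
      ring
    simp only [e1]
    have e2 : Integrable (fun z : E × E => e z.1 * H z) (μ.prod μ) :=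
      hHint.bdd_mul (c := 1) (hem.comp measurable_fst).aestronglyMeasurable
        (Filter.Eventually.of_forall fun z => he z.1)
    rw [integral_prod _ e2]
    refine integral_congr_ae (Filter.Eventually.of_forall fun ζ => ?_)
    simp only
    rw [integral_const_mul, hHsec, integral_indicator_const _ (hfibm ζ), Measure.real, hfib,
      ENNReal.toReal_ofReal hm.le, Complex.real_smul, mul_inv_cancel_left₀]
    exact_mod_cast hm.ne'
  rw [h1] at hsum
  convert hsum using 2 with p
  rw [integral_prod_symm _ (hFint p), ← integral_const_mul]
  refine integral_congr_ae (Filter.Eventually.of_forall fun ζ' => ?_)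
  have h2 : (fun ζ => F p (ζ, ζ')) = (c ⁻¹' {c (ζ' - w)}).indicator fun ζ =>
      (Λ ^ p.1 / (p.1.factorial : ℂ) * (∏ l, u (p.2 l)) * e' ζ' * (∏ l, b (p.2 l) ζ') * (m : ℂ)⁻¹) *
        ((∏ l, a (p.2 l) ζ) * g ζ) := by
    ext ζ
    by_cases h : c (ζ' - w) = c ζ
    · rw [Set.indicator_of_mem (by simp [h])]
      simp only [hF, hH, h, if_true, Finset.prod_mul_distrib]
      ring
    · rw [Set.indicator_of_notMem (by simpa using fun h' => h h'.symm)]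
      simp [hF, hH, h]
  simp only
  rw [h2, integral_indicator (hc (measurableSet_singleton _)), integral_const_mul, shiftedAverage]
  ring

end LocalAverage

/-! ### Localisation of waves to balls in space-time -/

section Localisation

variable {n : ℕ}

/-- The extension operator of the paraboloid: the Schrödinger wave at `(X, t)` whose Fourier
transform is `g`. -/
noncomputable def extendWave (g : EuclideanSpace ℝ (Fin n) → ℂ)
    (z : EuclideanSpace ℝ (Fin n) × ℝ) : ℂ :=
  ∫ ζ, waveChar z ζ * g ζ

/-- The corner of the cell with index `k` in the lattice `h ℤⁿ`. -/
noncomputable def cellCorner (h : ℝ) (k : Fin n → ℤ) : EuclideanSpace ℝ (Fin n) :=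
  WithLp.toLp 2 fun i => k i * h

/-- The components of the point `(X, t)`; the component `none` is the time. -/
noncomputable def spaceTimeCoord (z : EuclideanSpace ℝ (Fin n) × ℝ) : Option (Fin n) → ℝ
  | some i => z.1 i
  | none => z.2

/-- The components of the point `(ζ, -2π|ζ|²)` of the paraboloid. -/
noncomputable def paraboloidCoord (ζ : EuclideanSpace ℝ (Fin n)) : Option (Fin n) → ℝ
  | some i => ζ i
  | none => -(2 * Real.pi * ‖ζ‖ ^ 2)

theorem wavePhase_eq_sum (z : EuclideanSpace ℝ (Fin n) × ℝ) (ζ : EuclideanSpace ℝ (Fin n)) :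
    wavePhase z ζ = ∑ o, spaceTimeCoord z o * paraboloidCoord ζ o := by
  rw [Fintype.sum_option, wavePhase, PiLp.inner_apply]
  simp only [spaceTimeCoord, paraboloidCoord, RCLike.inner_apply, conj_trivial]
  rw [Finset.sum_congr rfl fun i _ => mul_comm (ζ i) (z.1 i)]
  ring

@[fun_prop]
theorem measurable_paraboloidCoord (o : Option (Fin n)) :
    Measurable fun ζ : EuclideanSpace ℝ (Fin n) => paraboloidCoord ζ o := by
  cases o <;> simp only [paraboloidCoord] <;> fun_prop

theorem abs_coord_le_norm (x : EuclideanSpace ℝ (Fin n)) (i : Fin n) : |x i| ≤ ‖x‖ := by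
  simpa using PiLp.norm_apply_le x i

theorem norm_sq_le_of_abs_coord_le {x : EuclideanSpace ℝ (Fin n)} {r : ℝ}
    (hx : ∀ i, |x i| ≤ r) : ‖x‖ ^ 2 ≤ n * r ^ 2 := by
  rw [EuclideanSpace.norm_sq_eq]
  calc ∑ i, ‖x i‖ ^ 2 ≤ ∑ _i : Fin n, r ^ 2 := Finset.sum_le_sum fun i _ => by
        rw [Real.norm_eq_abs]
        exact pow_le_pow_left₀ (abs_nonneg _) (hx i) 2
    _ = n * r ^ 2 := by simp

theorem norm_le_of_abs_coord_le {x : EuclideanSpace ℝ (Fin n)} {r : ℝ} (hr : 0 ≤ r)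
    (hx : ∀ i, |x i| ≤ r) : ‖x‖ ≤ n * r := by
  refine abs_le_of_sq_le_sq' ?_ (by positivity) |>.2
  refine (norm_sq_le_of_abs_coord_le hx).trans ?_
  rcases Nat.eq_zero_or_pos n with h | h
  · simp [h]
  · have : (1 : ℝ) ≤ n := by exact_mod_cast h
    rw [mul_pow]
    gcongr
    nlinarith

theorem abs_paraboloidCoord_sub_le {ζ ζ' : EuclideanSpace ℝ (Fin n)} {B r : ℝ} (hB : 1 ≤ B)
    (h : ‖ζ‖ ≤ B) (h' : ‖ζ'‖ ≤ B) (hr : ‖ζ - ζ'‖ ≤ r) (o : Option (Fin n)) :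
    |paraboloidCoord ζ o - paraboloidCoord ζ' o| ≤ 4 * Real.pi * B * r := by
  have hπ := Real.pi_gt_three
  have hr0 : 0 ≤ r := (norm_nonneg _).trans hr
  cases o with
  | some i =>
    simp only [paraboloidCoord]
    calc |ζ i - ζ' i| ≤ ‖ζ - ζ'‖ := abs_coord_le_norm (ζ - ζ') i
      _ ≤ 1 * r := by linarith
      _ ≤ _ := by gcongr; nlinarith
  | none =>
    simp only [paraboloidCoord]
    have h1 : |‖ζ‖ - ‖ζ'‖| ≤ r := (abs_norm_sub_norm_le _ _).trans hr
    rw [show -(2 * Real.pi * ‖ζ‖ ^ 2) - -(2 * Real.pi * ‖ζ'‖ ^ 2) =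
      -(2 * Real.pi * ((‖ζ‖ + ‖ζ'‖) * (‖ζ‖ - ‖ζ'‖))) by ring, abs_neg, abs_mul,
      abs_of_pos (by positivity : 0 < 2 * Real.pi), abs_mul, abs_of_nonneg (by positivity : 0 ≤ ‖ζ‖ + ‖ζ'‖)]
    calc 2 * Real.pi * ((‖ζ‖ + ‖ζ'‖) * |‖ζ‖ - ‖ζ'‖|) ≤ 2 * Real.pi * ((B + B) * r) := by gcongr
      _ = _ := by ring

theorem abs_paraboloidCoord_le {ζ : EuclideanSpace ℝ (Fin n)} {B : ℝ} (hB : 1 ≤ B)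
    (h : ‖ζ‖ ≤ B) (o : Option (Fin n)) : |paraboloidCoord ζ o| ≤ 4 * Real.pi * B * B := by
  have := abs_paraboloidCoord_sub_le (ζ' := 0) hB h (by simp; linarith) (by simpa using h) o
  cases o <;> simpa [paraboloidCoord] using this

theorem abs_sub_cellCorner_le {h : ℝ} (hh : 0 < h) (ζ : EuclideanSpace ℝ (Fin n)) (i : Fin n) :
    |(ζ - cellCorner h (cellIndex (fun _ => h) ζ)) i| ≤ h := by
  have h1 := Int.floor_le (ζ i / h)
  have h2 := Int.lt_floor_add_one (ζ i / h)
  rw [le_div_iff₀ hh] at h1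
  rw [div_lt_iff₀ hh] at h2
  simp only [PiLp.sub_apply, cellCorner, cellIndex, abs_le]
  constructor <;> linarith

/-- Truncation to `[-1, 1]`. -/
noncomputable def truncOne (x : ℝ) : ℝ := max (-1) (min x 1)

theorem abs_truncOne_le (x : ℝ) : |truncOne x| ≤ 1 := by
  rw [abs_le, truncOne]
  exact ⟨le_max_left _ _, max_le (by norm_num) (min_le_right _ _)⟩

theorem truncOne_of_abs_le {x : ℝ} (hx : |x| ≤ 1) : truncOne x = x := by
  rw [abs_le] at hx
  rw [truncOne, min_eq_left hx.2, max_eq_right hx.1]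

@[fun_prop]
theorem measurable_truncOne : Measurable truncOne := by
  unfold truncOne
  fun_prop

/-- Write `z · Φ(ζ) - z' · Φ(ζ')`, for `Φ(ζ)` on the paraboloid, as
`z · (Φ(ζ) - Φ(ζ₀)) - z · (Φ(ζ') - Φ(ζ₀)) + (z - z') · Φ(ζ')` where `ζ₀` is the corner of the common
cell. These are the factors depending on `ζ`, scaled to be at most `1` and truncated. -/
noncomputable def cellFactor (h R L : ℝ) (j : Option (Fin n) × Fin 3)
    (ζ : EuclideanSpace ℝ (Fin n)) : ℂ :=
  if j.2 = 0 then
    truncOne (R / L * (paraboloidCoord ζ j.1 -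
      paraboloidCoord (cellCorner h (cellIndex (fun _ => h) ζ)) j.1))
  else 1

/-- The factors depending on `ζ'` in the decomposition described at `cellFactor`. -/
noncomputable def shiftFactor (h R L : ℝ) (w : EuclideanSpace ℝ (Fin n))
    (j : Option (Fin n) × Fin 3) (ζ' : EuclideanSpace ℝ (Fin n)) : ℂ :=
  if j.2 = 0 then 1 else if j.2 = 1 then
    truncOne (-(R / L) * (paraboloidCoord ζ' j.1 -
      paraboloidCoord (cellCorner h (cellIndex (fun _ => h) (ζ' - w))) j.1))
  else truncOne (paraboloidCoord ζ' j.1 / L)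

/-- The factors depending on `z` and `z'` in the decomposition described at `cellFactor`. -/
noncomputable def spaceTimeFactor (R : ℝ) (z z' : EuclideanSpace ℝ (Fin n) × ℝ)
    (j : Option (Fin n) × Fin 3) : ℂ :=
  if j.2 = 2 then (spaceTimeCoord (z - z') j.1 / 2 : ℝ) else (spaceTimeCoord z j.1 / (2 * R) : ℝ)

theorem measurable_comp_cellIndex {h : ℝ} (w : EuclideanSpace ℝ (Fin n)) {β : Type*}
    [MeasurableSpace β] (f : (Fin n → ℤ) → β) :
    Measurable fun ζ : EuclideanSpace ℝ (Fin n) => f (cellIndex (fun _ => h) (ζ - w)) :=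
  (measurable_of_countable f).comp ((measurable_cellIndex _).comp (measurable_id.sub_const w))

theorem measurable_cellFactor (h R L : ℝ) (j : Option (Fin n) × Fin 3) :
    Measurable (cellFactor h R L j) := by
  unfold cellFactor
  split_ifs
  · have := measurable_comp_cellIndex (h := h) (0 : EuclideanSpace ℝ (Fin n))
      fun k => paraboloidCoord (cellCorner h k) j.1
    simp only [sub_zero] at this
    fun_prop
  · fun_prop

theorem measurable_shiftFactor (h R L : ℝ) (w : EuclideanSpace ℝ (Fin n))
    (j : Option (Fin n) × Fin 3) : Measurable (shiftFactor h R L w j) := by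
  unfold shiftFactor
  split_ifs
  · fun_prop
  · have := measurable_comp_cellIndex (h := h) w fun k => paraboloidCoord (cellCorner h k) j.1
    fun_prop
  · fun_prop

theorem norm_cellFactor_le (h R L : ℝ) (j : Option (Fin n) × Fin 3)
    (ζ : EuclideanSpace ℝ (Fin n)) : ‖cellFactor h R L j ζ‖ ≤ 1 := by
  unfold cellFactor
  split_ifs
  · rw [Complex.norm_real]; exact abs_truncOne_le _
  · simp

theorem norm_shiftFactor_le (h R L : ℝ) (w : EuclideanSpace ℝ (Fin n))
    (j : Option (Fin n) × Fin 3) (ζ : EuclideanSpace ℝ (Fin n)) :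
    ‖shiftFactor h R L w j ζ‖ ≤ 1 := by
  unfold shiftFactor
  split_ifs
  · simp
  · rw [Complex.norm_real]; exact abs_truncOne_le _
  · rw [Complex.norm_real]; exact abs_truncOne_le _

theorem norm_spaceTimeFactor_le {R : ℝ} (hR : 0 < R) {z z' : EuclideanSpace ℝ (Fin n) × ℝ}
    (hz : ∀ o, |spaceTimeCoord z o| ≤ 2 * R) (hz' : ∀ o, |spaceTimeCoord (z - z') o| ≤ 2)
    (j : Option (Fin n) × Fin 3) : ‖spaceTimeFactor R z z' j‖ ≤ 1 := by
  unfold spaceTimeFactor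
  split_ifs
  · rw [Complex.norm_real, Real.norm_eq_abs, abs_div, abs_two, div_le_one two_pos]
    exact hz' _
  · rw [Complex.norm_real, Real.norm_eq_abs, abs_div, abs_of_pos (by positivity : 0 < 2 * R),
      div_le_one (by positivity)]
    exact hz _

theorem dist_shift_le {h : ℝ} (hh : 0 < h) {w ζ ζ' : EuclideanSpace ℝ (Fin n)}
    (hc : cellIndex (fun _ => h) (ζ' - w) = cellIndex (fun _ => h) ζ) :
    ‖ζ' - w - ζ‖ ≤ n * h := by
  refine norm_le_of_abs_coord_le hh.le fun i => ?_
  have h1 : |(ζ' - w) i / h - ζ i / h| < 1 := Int.abs_sub_lt_one_of_floor_eq_floor (congrFun hc i)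
  rw [← sub_div, abs_div, abs_of_pos hh, div_lt_one hh] at h1
  exact h1.le

/-- On the supports in question all truncations are inactive, so that the factors multiply to the
difference of the phases. -/
theorem waveChar_eq_mul_exp_factors {R V : ℝ} (hR : 1 ≤ R) (hV : 0 ≤ V) {h : ℝ}
    (hh : 0 < h) (hhn : n * h ≤ 1 / R) {w ζ ζ' : EuclideanSpace ℝ (Fin n)} (hw : ‖w‖ ≤ V / R)
    (hζ : ‖ζ‖ ≤ 1) (hc : cellIndex (fun _ => h) (ζ' - w) = cellIndex (fun _ => h) ζ)
    (z z' : EuclideanSpace ℝ (Fin n) × ℝ) :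
    waveChar z ζ = waveChar z' ζ' *
      Complex.exp (((2 * Real.pi * 2 * (4 * Real.pi * (V + 2) * (V + 2)) : ℝ) * Complex.I : ℂ) *
        ∑ j, spaceTimeFactor R z z' j *
          (cellFactor h R (4 * Real.pi * (V + 2) * (V + 2)) j ζ *
            shiftFactor h R (4 * Real.pi * (V + 2) * (V + 2)) w j ζ')) := by
  set L := 4 * Real.pi * (V + 2) * (V + 2) with hL
  have hπ := Real.pi_pos
  have hL0 : 0 < L := by positivity
  have hR0 : 0 < R := by linarith
  set ζ₀ := cellCorner h (cellIndex (fun _ => h) ζ) with hζ₀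
  have h0 : ‖ζ - ζ₀‖ ≤ 1 / R :=
    (norm_le_of_abs_coord_le hh.le (abs_sub_cellCorner_le hh ζ)).trans hhn
  have h1 : ‖ζ' - w - ζ₀‖ ≤ 1 / R := by
    have := norm_le_of_abs_coord_le hh.le (abs_sub_cellCorner_le hh (ζ' - w))
    rw [hc] at this
    exact this.trans hhn
  have hR1 : 1 / R ≤ 1 := by rw [div_le_one hR0]; exact hR
  have h2 : ‖ζ' - ζ₀‖ ≤ (V + 1) / R := by
    calc ‖ζ' - ζ₀‖ = ‖(ζ' - w - ζ₀) + w‖ := by congr 1; abel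
      _ ≤ ‖ζ' - w - ζ₀‖ + ‖w‖ := norm_add_le _ _
      _ ≤ 1 / R + V / R := add_le_add h1 hw
      _ = _ := by ring
  have hVR : (V + 1) / R ≤ V + 1 := div_le_self (by linarith) hR
  have h3 : ‖ζ₀‖ ≤ 2 := by
    have : ‖ζ₀‖ ≤ ‖ζ‖ + ‖ζ - ζ₀‖ := norm_le_norm_add_norm_sub' ζ₀ ζ |>.trans (by
      rw [norm_sub_rev])
    linarith
  have h4 : ‖ζ'‖ ≤ V + 2 := by
    have e1 : ‖ζ' - w - ζ‖ ≤ 1 / R := (dist_shift_le hh hc).trans hhn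
    have e2 : V / R ≤ V := div_le_self hV hR
    calc ‖ζ'‖ = ‖(ζ' - w - ζ) + w + ζ‖ := by congr 1; abel
      _ ≤ ‖ζ' - w - ζ‖ + ‖w‖ + ‖ζ‖ := norm_add₃_le
      _ ≤ _ := by linarith
  have hV2 : 1 ≤ V + 2 := by linarith
  have b0 : ∀ o, |R / L * (paraboloidCoord ζ o - paraboloidCoord ζ₀ o)| ≤ 1 := by
    intro o
    have := abs_paraboloidCoord_sub_le hV2 (by linarith : ‖ζ‖ ≤ V + 2)
      (by linarith : ‖ζ₀‖ ≤ V + 2) h0 o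
    rw [abs_mul, abs_of_pos (by positivity : 0 < R / L)]
    calc _ ≤ R / L * (4 * Real.pi * (V + 2) * (1 / R)) := by gcongr
      _ = 1 / (V + 2) := by rw [hL]; field_simp
      _ ≤ 1 := by rw [div_le_one (by linarith)]; exact hV2
  have b1 : ∀ o, |-(R / L) * (paraboloidCoord ζ' o - paraboloidCoord ζ₀ o)| ≤ 1 := by
    intro o
    have := abs_paraboloidCoord_sub_le hV2 h4 (by linarith : ‖ζ₀‖ ≤ V + 2) h2 o
    rw [abs_mul, abs_neg, abs_of_pos (by positivity : 0 < R / L)]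
    calc _ ≤ R / L * (4 * Real.pi * (V + 2) * ((V + 1) / R)) := by gcongr
      _ = (V + 1) / (V + 2) := by rw [hL]; field_simp
      _ ≤ 1 := by rw [div_le_one (by linarith)]; linarith
  have b2 : ∀ o, |paraboloidCoord ζ' o / L| ≤ 1 := by
    intro o
    rw [abs_div, abs_of_pos hL0, div_le_one hL0]
    exact abs_paraboloidCoord_le hV2 h4 o
  have hsum : ∑ j, spaceTimeFactor R z z' j * (cellFactor h R L j ζ * shiftFactor h R L w j ζ') =
      ((1 / (2 * L) * (wavePhase z ζ - wavePhase z' ζ') : ℝ) : ℂ) := by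
    rw [Fintype.sum_prod_type, wavePhase_eq_sum, wavePhase_eq_sum, ← Finset.sum_sub_distrib,
      Finset.mul_sum, Complex.ofReal_sum]
    refine Finset.sum_congr rfl fun o _ => ?_
    rw [Fin.sum_univ_three]
    simp only [spaceTimeFactor, cellFactor, shiftFactor, hc]
    rw [← hζ₀, truncOne_of_abs_le (b0 o), truncOne_of_abs_le (b1 o), truncOne_of_abs_le (b2 o)]
    have hsub : spaceTimeCoord (z - z') o = spaceTimeCoord z o - spaceTimeCoord z' o := by
      cases o <;> simp [spaceTimeCoord]
    rw [hsub]
    simp only [Fin.isValue, if_true, show (0 : Fin 3) ≠ 2 by decide, show (1 : Fin 3) ≠ 2 by decide,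
      show (1 : Fin 3) ≠ 0 by decide, show (2 : Fin 3) ≠ 0 by decide,
      show (2 : Fin 3) ≠ 1 by decide, if_false, one_mul, mul_one]
    rw [← Complex.ofReal_mul, ← Complex.ofReal_mul, ← Complex.ofReal_mul, ← Complex.ofReal_add,
      ← Complex.ofReal_add]
    congr 1
    field_simp
    ring
  rw [hsum, waveChar, waveChar, ← Complex.exp_add]
  congr 1
  have hLc : (L : ℂ) ≠ 0 := by exact_mod_cast hL0.ne'
  push_cast
  field_simp
  ring

end Localisation

section LocalPiece

variable {n : ℕ}

/-- The index set of the expansion of a wave near a point into localised waves. -/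
abbrev PieceIndex (n : ℕ) : Type := Σ l : ℕ, (Fin l → Option (Fin n) × Fin 3)

/-- The side length of the cells used to localise at scale `R`. -/
noncomputable def cellSide (n : ℕ) (R : ℝ) : ℝ := 1 / (n * R)

/-- The bound for the components of the points of the paraboloid that occur for shifts by at most
`V / R`. -/
noncomputable def coordBound (V : ℝ) : ℝ := 4 * Real.pi * (V + 2) * (V + 2)

/-- The `p`-th piece of `g` localised at scale `R` near the origin of space-time: on each cell, moved
by `w`, an average of `g` with bounded weights. -/
noncomputable def localPiece (R V : ℝ) (w : EuclideanSpace ℝ (Fin n)) (p : PieceIndex n)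
    (g : EuclideanSpace ℝ (Fin n) → ℂ) : EuclideanSpace ℝ (Fin n) → ℂ :=
  shiftedAverage volume (cellIndex fun _ => cellSide n R) w (cellSide n R ^ n)
    (fun ζ => (∏ l, cellFactor (cellSide n R) R (coordBound V) (p.2 l) ζ) * g ζ)
    (fun ζ' => ∏ l, shiftFactor (cellSide n R) R (coordBound V) w (p.2 l) ζ')

/-- The coefficients of the expansion of a wave near a point into localised waves. -/
noncomputable def pieceCoeff (V : ℝ) (p : PieceIndex n) : ℝ :=
  (2 * Real.pi * 2 * coordBound V) ^ p.1 / (p.1.factorial : ℝ)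

theorem coordBound_nonneg {V : ℝ} (hV : 0 ≤ V) : 0 ≤ coordBound V := by
  unfold coordBound
  positivity

theorem pieceCoeff_nonneg {V : ℝ} (hV : 0 ≤ V) (p : PieceIndex n) : 0 ≤ pieceCoeff V p := by
  have := coordBound_nonneg hV
  unfold pieceCoeff
  positivity

theorem summable_pieceCoeff {V : ℝ} (hV : 0 ≤ V) : Summable (pieceCoeff (n := n) V) := by
  have h := summable_norm_pow_div_factorial_sigma (Option (Fin n) × Fin 3)
    ((2 * Real.pi * 2 * coordBound V : ℝ) : ℂ)
  rw [Complex.norm_real, Real.norm_of_nonneg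
    (by have := coordBound_nonneg hV; positivity)] at h
  exact h

variable [NeZero n]

theorem cellSide_pos {R : ℝ} (hR : 1 ≤ R) : 0 < cellSide n R := by
  have : (0 : ℝ) < n := by exact_mod_cast Nat.pos_of_ne_zero (NeZero.ne n)
  unfold cellSide
  positivity

theorem natCast_mul_cellSide {R : ℝ} (hR : 1 ≤ R) : n * cellSide n R = 1 / R := by
  have : (n : ℝ) ≠ 0 := by exact_mod_cast NeZero.ne n
  have : R ≠ 0 := by positivity
  unfold cellSide
  field_simp

theorem cellSide_le_one {R : ℝ} (hR : 1 ≤ R) : cellSide n R ≤ 1 := by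
  have h1 : (1 : ℝ) ≤ n := by exact_mod_cast NeZero.one_le
  unfold cellSide
  rw [div_le_one (by positivity)]
  nlinarith

omit [NeZero n] in
theorem volume_cell {h : ℝ} (hh : 0 < h) (k : Fin n → ℤ) :
    volume (cellIndex (fun _ => h) ⁻¹' {k}) = ENNReal.ofReal (h ^ n) := by
  rw [volume_cellIndex_eq (fun _ => hh)]
  simp [ENNReal.ofReal_pow hh.le]

omit [NeZero n] in
theorem measurable_localPiece {R V : ℝ} (w : EuclideanSpace ℝ (Fin n))
    (p : PieceIndex n) (g : EuclideanSpace ℝ (Fin n) → ℂ) : Measurable (localPiece R V w p g) :=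
  measurable_shiftedAverage (measurable_cellIndex _) w _ <|
    Finset.measurable_prod _ fun _ _ => measurable_shiftFactor _ _ _ _ _

/-- The piece is supported near the shift by `w` of the support of `g`. -/
theorem exists_of_localPiece_ne_zero {R V : ℝ} (hR : 1 ≤ R) {w : EuclideanSpace ℝ (Fin n)}
    {p : PieceIndex n} {g : EuclideanSpace ℝ (Fin n) → ℂ} {ζ' : EuclideanSpace ℝ (Fin n)}
    (h : localPiece R V w p g ζ' ≠ 0) : ∃ ζ, g ζ ≠ 0 ∧ ‖ζ' - w - ζ‖ ≤ 1 / R := by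
  by_contra! hcon
  refine h ?_
  rw [localPiece, shiftedAverage, setIntegral_eq_zero_of_forall_eq_zero, mul_zero, mul_zero]
  intro ζ hζ
  by_contra h0
  have h1 := dist_shift_le (cellSide_pos (n := n) hR) (w := w) (ζ := ζ) (ζ' := ζ')
    (Eq.symm hζ)
  rw [natCast_mul_cellSide hR] at h1
  exact absurd h1 (not_le.2 (hcon ζ (right_ne_zero_of_mul h0)))

/-- Near the origin a wave is a rapidly convergent combination of the waves of its pieces; moreover
the latter may be evaluated at a nearby point. -/
theorem enorm_extendWave_le_tsum {R V : ℝ} (hR : 1 ≤ R) (hV : 0 ≤ V)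
    {w : EuclideanSpace ℝ (Fin n)} (hw : ‖w‖ ≤ V / R) {g : EuclideanSpace ℝ (Fin n) → ℂ}
    (hgm : Measurable g) (hg : Integrable g) (hg1 : ∀ ζ, g ζ ≠ 0 → ‖ζ‖ ≤ 1)
    {z z' : EuclideanSpace ℝ (Fin n) × ℝ} (hz : ∀ o, |spaceTimeCoord z o| ≤ 2 * R)
    (hz' : ∀ o, |spaceTimeCoord (z - z') o| ≤ 2) :
    ‖extendWave g z‖ₑ ≤ ∑' p : PieceIndex n, ENNReal.ofReal (pieceCoeff V p) *
      ‖extendWave (localPiece R V w p g) z'‖ₑ := by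
  have hh := cellSide_pos (n := n) hR
  have hR0 : 0 < R := by linarith
  have h := hasSum_integral_shiftedAverage (μ := volume)
    (measurable_cellIndex fun _ => cellSide n R) w
    (pow_pos hh n) (volume_cell hh) hg hgm (measurable_cellFactor (cellSide n R) R (coordBound V))
    (measurable_shiftFactor (cellSide n R) R (coordBound V) w)
    (norm_cellFactor_le _ _ _) (norm_shiftFactor_le _ _ _ _)
    ((2 * Real.pi * 2 * coordBound V : ℝ) * Complex.I)
    (norm_spaceTimeFactor_le hR0 hz hz') (continuous_waveChar z).measurable
    (continuous_waveChar z').measurable (fun ζ => (norm_waveChar _ _).le)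
    (fun ζ => (norm_waveChar _ _).le)
    (fun ζ ζ' h1 h2 => waveChar_eq_mul_exp_factors hR hV hh (natCast_mul_cellSide hR).le hw
      (hg1 ζ h1) h2 z z')
  have hcoef : ∀ p : PieceIndex n,
      ‖((2 * Real.pi * 2 * coordBound V : ℝ) * Complex.I : ℂ) ^ p.1 / (p.1.factorial : ℂ) *
        ∏ l, spaceTimeFactor R z z' (p.2 l)‖ ≤ pieceCoeff V p := by
    intro p
    rw [norm_mul, norm_div, norm_pow, norm_mul, Complex.norm_I, mul_one, Complex.norm_real,
      Complex.norm_natCast, Real.norm_of_nonneg (by have := coordBound_nonneg hV; positivity)]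
    exact mul_le_of_le_one_right (pieceCoeff_nonneg hV p)
      (norm_prod_le_one fun l => norm_spaceTimeFactor_le hR0 hz hz' (p.2 l))
  calc ‖extendWave g z‖ₑ = ‖∑' p : PieceIndex n, _‖ₑ := by
        rw [extendWave, ← h.tsum_eq]
    _ ≤ ∑' p : PieceIndex n, ‖_‖ₑ := enorm_tsum_le_tsum_enorm
    _ ≤ _ := by
      refine ENNReal.tsum_le_tsum fun p => ?_
      rw [enorm_mul]
      refine mul_le_mul' ?_ le_rfl
      rw [← ofReal_norm]
      exact ENNReal.ofReal_le_ofReal (hcoef p)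

/-- The pieces of `g` localised around a sparse family of points of space-time are almost
orthogonal. Here `D` bounds the number of points of the family close to a given one, and distant
ones are so far apart that the waves have decayed by the number of points. -/
theorem sum_lintegral_sq_localPiece_le {R V M : ℝ} (hR : 1 ≤ R) (hM : 1 ≤ M)
    {w : EuclideanSpace ℝ (Fin n)} (p : PieceIndex n)
    {g : EuclideanSpace ℝ (Fin n) → ℂ} (hgm : Measurable g) (hg : Integrable g) (hg2 : MemLp g 2)
    (hg1 : ∀ ζ, g ζ ≠ 0 → ‖ζ‖ ≤ 1) {ι : Type*} (I : Finset ι)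
    (Z : ι → EuclideanSpace ℝ (Fin n) × ℝ) (hI : (I.card : ℝ) ≤ M)
    (near : ι → ι → Prop) [DecidableRel near] (hnear : ∀ i j, near i j ↔ near j i)
    (hfar : ∀ i ∈ I, ∀ j ∈ I, ¬ near i j →
      41 * n ^ 2 * M ^ 3 * R ^ 2 ≤ ‖(Z i - Z j).1‖ ∨ 41 * n ^ 2 * M ^ 3 * R ^ 2 ≤ |(Z i - Z j).2|)
    {D : ℝ} (hD0 : 0 ≤ D) (hD : ∀ i ∈ I, ((I.filter (near i)).card : ℝ) ≤ D) :
    ∑ i ∈ I, ∫⁻ ζ, ‖localPiece R V w p (fun ζ => waveChar (Z i) ζ * g ζ) ζ‖ₑ ^ 2 ≤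
      ENNReal.ofReal (Real.exp (Real.pi * n) * (D + 1)) * ∫⁻ ζ, ‖g ζ‖ₑ ^ 2 := by
  set h := cellSide n R with hh
  have hh0 : 0 < h := cellSide_pos hR
  have hh1 : h ≤ 1 := cellSide_le_one hR
  have hn1 : (1 : ℝ) ≤ n := by exact_mod_cast NeZero.one_le
  set u : EuclideanSpace ℝ (Fin n) → ℂ := fun ζ =>
    (∏ l, cellFactor h R (coordBound V) (p.2 l) ζ) * g ζ with hu
  have hum : Measurable u := (Finset.measurable_prod _ fun l _ => measurable_cellFactor _ _ _ _).mul
    hgm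
  have hule : ∀ ζ, ‖u ζ‖ ≤ ‖g ζ‖ := fun ζ => by
    rw [hu, norm_mul]
    exact mul_le_of_le_one_left (norm_nonneg _)
      (norm_prod_le_one fun l => norm_cellFactor_le _ _ _ _ _)
  have huint : Integrable u := hg.norm.mono' hum.aestronglyMeasurable
    (Filter.Eventually.of_forall hule)
  have hu2 : Integrable fun ζ => ‖u ζ‖ ^ 2 :=
    (MemLp.of_le hg2 hum.aestronglyMeasurable (Filter.Eventually.of_forall hule)).integrable_norm_pow
      two_ne_zero
  have hcell : ∀ k : Fin n → ℤ, ∑ i ∈ I, (h ^ n)⁻¹ *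
      ‖∫ ζ in cellIndex (fun _ => h) ⁻¹' {k}, waveChar (Z i) ζ * u ζ‖ ^ 2 ≤
      Real.exp (Real.pi * n) * (D + 1) *
        ∫ ζ in cellIndex (fun _ => h) ⁻¹' {k}, ‖u ζ‖ ^ 2 := by
    intro k
    have hkm : MeasurableSet (cellIndex (fun _ : Fin n => h) ⁻¹' {k}) :=
      measurable_cellIndex _ (measurableSet_singleton k)
    by_cases hk : ∃ ζ, cellIndex (fun _ => h) ζ = k ∧ g ζ ≠ 0
    · obtain ⟨ζ₁, hζ₁, hgζ₁⟩ := hk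
      have hcorner : ‖cellCorner h k‖ ≤ 2 := by
        have h1 := norm_le_of_abs_coord_le hh0.le (abs_sub_cellCorner_le hh0 ζ₁)
        rw [hζ₁, natCast_mul_cellSide hR] at h1
        have h2 : 1 / R ≤ 1 := by rw [div_le_one (by linarith)]; exact hR
        have h3 := norm_le_norm_add_norm_sub' (cellCorner h k) ζ₁
        rw [norm_sub_rev] at h3
        linarith [hg1 ζ₁ hgζ₁]
      have := sum_sq_norm_integral_waveChar_le I Z hkm hh0 (D := h ^ n * (D + 1)) (by positivity)
        (cellCorner h k)
        (fun ζ hζ => by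
          have hζ' : cellIndex (fun _ => h) ζ = k := hζ
          rw [← hζ']
          exact norm_sq_le_of_abs_coord_le (abs_sub_cellCorner_le hh0 ζ))
        (fun i j => if near i j then h ^ n else h ^ n / M)
        (fun i j => by simp only [hnear i j])
        (fun i hi j hj => by
          by_cases hij : near i j
          · simp only [hij, if_true]
            exact norm_integral_gaussian_waveChar_le hh0 _ _
          · simp only [hij, if_false]
            refine norm_integral_gaussian_waveChar_le_div hh0 hh1 hM hcorner ?_
            have e : 41 * M ^ 3 / h ^ 2 = 41 * n ^ 2 * M ^ 3 * R ^ 2 := by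
              rw [hh, cellSide]; field_simp
            rw [e]
            exact hfar i hi j hj hij)
        (fun i hi => by
          rw [Finset.sum_ite, Finset.sum_const, Finset.sum_const, nsmul_eq_mul, nsmul_eq_mul,
            mul_add, mul_one]
          refine add_le_add ?_ ?_
          · rw [mul_comm]
            exact mul_le_mul_of_nonneg_left (hD i hi) (by positivity)
          · have h1 : ((I.filter fun j => ¬ near i j).card : ℝ) ≤ M :=
              le_trans (by exact_mod_cast Finset.card_filter_le _ _) hI
            calc _ ≤ M * (h ^ n / M) := by gcongr
              _ = h ^ n := by field_simp)
        huint hu2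
      rw [← Finset.mul_sum, inv_mul_le_iff₀ (by positivity)]
      refine this.trans (le_of_eq ?_)
      ring
    · push Not at hk
      have h0 : ∀ ζ ∈ cellIndex (fun _ : Fin n => h) ⁻¹' {k}, u ζ = 0 := fun ζ hζ => by
        simp [hu, hk ζ hζ]
      rw [Finset.sum_eq_zero]
      · positivity
      · intro i _
        rw [setIntegral_eq_zero_of_forall_eq_zero fun ζ hζ => by rw [h0 ζ hζ, mul_zero]]
        simp
  calc ∑ i ∈ I, ∫⁻ ζ, ‖localPiece R V w p (fun ζ => waveChar (Z i) ζ * g ζ) ζ‖ₑ ^ 2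
      ≤ ∑ i ∈ I, ∑' k, ENNReal.ofReal ((h ^ n)⁻¹ *
          ‖∫ ζ in cellIndex (fun _ => h) ⁻¹' {k}, waveChar (Z i) ζ * u ζ‖ ^ 2) := by
        refine Finset.sum_le_sum fun i _ => ?_
        refine (lintegral_sq_shiftedAverage_le (measurable_cellIndex _) w (pow_pos hh0 n)
          (volume_cell hh0) _ fun ζ => norm_prod_le_one fun l =>
            norm_shiftFactor_le _ _ _ _ _ _).trans (le_of_eq ?_)
        refine tsum_congr fun k => ?_
        congr 5
        ext ζ
        simp only [hu]
        ring
    _ = ∑' k, ENNReal.ofReal (∑ i ∈ I, (h ^ n)⁻¹ *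
          ‖∫ ζ in cellIndex (fun _ => h) ⁻¹' {k}, waveChar (Z i) ζ * u ζ‖ ^ 2) := by
        rw [← Summable.tsum_finsetSum fun _ _ => ENNReal.summable]
        refine tsum_congr fun k => ?_
        rw [ENNReal.ofReal_sum_of_nonneg fun i _ => by positivity]
    _ ≤ ∑' k, ENNReal.ofReal (Real.exp (Real.pi * n) * (D + 1)) *
          ∫⁻ ζ in cellIndex (fun _ => h) ⁻¹' {k}, ‖g ζ‖ₑ ^ 2 := by
        refine ENNReal.tsum_le_tsum fun k => ?_
        refine (ENNReal.ofReal_le_ofReal (hcell k)).trans ?_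
        rw [ENNReal.ofReal_mul (by positivity)]
        gcongr
        rw [ofReal_integral_eq_lintegral_ofReal hu2.integrableOn
          (Filter.Eventually.of_forall fun ζ => by simp only [Pi.zero_apply]; positivity)]
        refine lintegral_mono fun ζ => ?_
        rw [← ofReal_norm, ← ENNReal.ofReal_pow (norm_nonneg _)]
        exact ENNReal.ofReal_le_ofReal (pow_le_pow_left₀ (norm_nonneg _) (hule ζ) 2)
    _ = _ := by
        rw [ENNReal.tsum_mul_left, ← lintegral_eq_tsum_fiber (measurable_cellIndex _)]

end LocalPiece

/-! ### Discretisation of the mixed norm -/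

theorem map_eq_smul_count {α I : Type*} [MeasurableSpace α] [MeasurableSpace I] [Countable I]
    [MeasurableSingletonClass I] {μ : Measure α} {c : α → I} (hc : Measurable c) {m : ℝ≥0∞}
    (hm : ∀ k, μ (c ⁻¹' {k}) = m) : μ.map c = m • Measure.count := by
  refine Measure.ext_of_singleton fun k => ?_
  rw [Measure.map_apply hc (measurableSet_singleton k), hm]
  simp

theorem eLpNorm_comp_eq_of_fiber {α I : Type*} [MeasurableSpace α] [MeasurableSpace I] [Countable I]
    [MeasurableSingletonClass I] {μ : Measure α} {c : α → I} (hc : Measurable c) {m : ℝ≥0∞}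
    (hm0 : m ≠ 0) (hm : ∀ k, μ (c ⁻¹' {k}) = m) (p : ℝ≥0∞) (F : I → ℝ≥0∞) :
    eLpNorm (fun x => F (c x)) p μ = m ^ (1 / p).toReal * eLpNorm F p Measure.count := by
  have h1 := eLpNorm_map_measure (p := p) (μ := μ) (f := c) (g := F)
    (measurable_of_countable F).aestronglyMeasurable hc.aemeasurable
  rw [map_eq_smul_count hc hm, eLpNorm_smul_measure_of_ne_zero hm0, smul_eq_mul] at h1
  exact h1.symm

theorem eLpNorm_const_mul {α : Type*} [MeasurableSpace α] {μ : Measure α} {c : ℝ≥0∞}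
    (hc0 : c ≠ 0) (hc : c ≠ ∞) (p : ℝ≥0∞) (f : α → ℝ≥0∞) :
    eLpNorm (fun x => c * f x) p μ = c * eLpNorm f p μ := by
  refine le_antisymm (eLpNorm_const_mul_le hc p f) ?_
  have h1 := eLpNorm_const_mul_le (μ := μ) (c := c⁻¹) (by simpa using hc0) p fun x => c * f x
  simp only [← mul_assoc, ENNReal.inv_mul_cancel hc0 hc, one_mul] at h1
  calc c * eLpNorm f p μ ≤ c * (c⁻¹ * eLpNorm (fun x => c * f x) p μ) := by gcongr
    _ = _ := by rw [← mul_assoc, ENNReal.mul_inv_cancel hc0 hc, one_mul]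

section Discretisation

variable {n : ℕ} [NeZero n]

/-- The side lengths of the cells in space: a wave of speed `4πN` in the direction `e₁` does not
change essentially on such a cell once one moves along with it. -/
noncomputable def spaceScale (N : ℝ) (i : Fin n) : ℝ := if i = 0 then 4 * Real.pi * N else 1

/-- The index of the spatial cell that contains `x`. -/
noncomputable def spaceCell (N : ℝ) (x : EuclideanSpace ℝ (Fin n)) : Fin n → ℤ :=
  cellIndex (spaceScale N) x

/-- The index of the cell of time that contains `t`; the cells have length `1 / (4πN)` and their
position depends on `x`. -/
noncomputable def timeCell (N : ℝ) (x : EuclideanSpace ℝ (Fin n)) (t : ℝ) : ℤ :=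
  ⌊x 0 - 4 * Real.pi * N * t⌋

theorem measurable_spaceCell (N : ℝ) : Measurable (spaceCell (n := n) N) :=
  measurable_cellIndex _

theorem measurable_timeCell (N : ℝ) :
    Measurable fun z : EuclideanSpace ℝ (Fin n) × ℝ => timeCell N z.1 z.2 := by
  unfold timeCell
  refine Int.measurable_floor.comp ?_
  fun_prop

theorem volume_spaceCell_eq {N : ℝ} (hN : 1 ≤ N) (k : Fin n → ℤ) :
    volume (spaceCell N ⁻¹' {k}) = ENNReal.ofReal (4 * Real.pi * N) := by
  have hπ := Real.pi_pos
  have h := volume_cellIndex_eq (h := spaceScale (n := n) N)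
    (fun i => by unfold spaceScale; split_ifs <;> positivity) k
  refine h.trans ?_
  rw [Finset.prod_eq_single 0]
  · simp [spaceScale]
  · intro i _ hi
    simp [spaceScale, hi]
  · simp

theorem volume_timeCell_eq {N : ℝ} (hN : 1 ≤ N) (x : EuclideanSpace ℝ (Fin n)) (k : ℤ) :
    volume (timeCell N x ⁻¹' {k}) = ENNReal.ofReal (4 * Real.pi * N)⁻¹ := by
  have hκ : 0 < 4 * Real.pi * N := by have := Real.pi_pos; positivity
  have h : timeCell N x ⁻¹' {k} =
      Set.Ioc ((x 0 - k - 1) / (4 * Real.pi * N)) ((x 0 - k) / (4 * Real.pi * N)) := by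
    ext t
    simp only [Set.mem_preimage, Set.mem_singleton_iff, timeCell, Int.floor_eq_iff, Set.mem_Ioc,
      div_lt_iff₀ hκ, le_div_iff₀ hκ]
    constructor <;> rintro ⟨a, b⟩ <;> constructor <;> linarith
  rw [h, Real.volume_Ioc]
  congr 1
  field_simp
  ring

/-- The mixed norm `L^P_x L^Q_t` of a nonnegative function of `(x, t)`. -/
noncomputable def cNorm (P Q : ℝ≥0∞) (F : EuclideanSpace ℝ (Fin n) × ℝ → ℝ≥0∞) : ℝ≥0∞ :=
  eLpNorm (fun x => eLpNorm (fun t => F (x, t)) Q volume) P volume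

omit [NeZero n] in
theorem cNorm_mono {P Q : ℝ≥0∞} {F G : EuclideanSpace ℝ (Fin n) × ℝ → ℝ≥0∞} (h : ∀ z, F z ≤ G z) :
    cNorm P Q F ≤ cNorm P Q G :=
  eLpNorm_mono_enorm fun x => by
    simpa using eLpNorm_mono_enorm fun t => by simpa using h (x, t)

omit [NeZero n] in
theorem cNorm_tsum_le {ι : Type*} [Countable ι] {P Q : ℝ≥0∞} (hP : 1 ≤ P) (hQ : 1 ≤ Q)
    (hQ' : Q ≠ ∞) {F : ι → EuclideanSpace ℝ (Fin n) × ℝ → ℝ≥0∞} (hF : ∀ i, Measurable (F i)) :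
    cNorm P Q (fun z => ∑' i, F i z) ≤ ∑' i, cNorm P Q (F i) := by
  refine le_trans (eLpNorm_mono_enorm fun x => ?_)
    (eLpNorm_tsum_le hP (f := fun i x => eLpNorm (fun t => F i (x, t)) Q volume) fun i => ?_)
  · simpa [Function.comp_def] using eLpNorm_tsum_le hQ fun i => (hF i).comp measurable_prodMk_left
  · simp only [eLpNorm_eq_lintegral_rpow_enorm_toReal (zero_lt_one.trans_le hQ).ne' hQ',
      enorm_eq_self]
    exact (((hF i).pow_const _).lintegral_prod_right').pow_const _

omit [NeZero n] in
theorem cNorm_const_mul_le {c : ℝ≥0∞} (hc : c ≠ ∞) {P Q : ℝ≥0∞}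
    (F : EuclideanSpace ℝ (Fin n) × ℝ → ℝ≥0∞) :
    cNorm P Q (fun z => c * F z) ≤ c * cNorm P Q F := by
  refine le_trans (eLpNorm_mono_enorm fun y => ?_) (eLpNorm_const_mul_le hc P _)
  simpa using eLpNorm_const_mul_le hc Q fun t => F (y, t)

omit [NeZero n] in
theorem mixedNorm_rpow_half (p r : ℝ≥0∞) (S : Set (EuclideanSpace ℝ (Fin n) × ℝ))
    (F : EuclideanSpace ℝ (Fin n) × ℝ → ℂ) :
    mixedNorm p r S (fun z => ‖F z‖ ^ (1 / 2 : ℝ)) =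
      cNorm (p / 2) (r / 2) (S.indicator fun z => ‖F z‖ₑ) ^ (1 / 2 : ℝ) := by
  have hhalf : ∀ q : ℝ≥0∞, q * ENNReal.ofReal (1 / 2) = q / 2 := fun q => by
    rw [ENNReal.ofReal_div_of_pos two_pos, ENNReal.ofReal_one, ENNReal.ofReal_ofNat, one_div,
      div_eq_mul_inv]
  unfold mixedNorm cNorm
  have h1 : ∀ x, eLpNorm (fun t => S.indicator (fun z => ‖F z‖ ^ (1 / 2 : ℝ)) (x, t)) r volume =
      eLpNorm (fun t => S.indicator (fun z => ‖F z‖ₑ) (x, t)) (r / 2) volume ^ (1 / 2 : ℝ) := by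
    intro x
    rw [← hhalf, ← eLpNorm_enorm_rpow _ (by norm_num : (0 : ℝ) < 1 / 2)]
    refine eLpNorm_congr_enorm_ae (Filter.Eventually.of_forall fun t => ?_)
    simp only [enorm_eq_self]
    by_cases h : (x, t) ∈ S
    · rw [Set.indicator_of_mem h, Set.indicator_of_mem h,
        Real.enorm_rpow_of_nonneg (norm_nonneg _) (by norm_num), enorm_norm]
    · rw [Set.indicator_of_notMem h, Set.indicator_of_notMem h]
      simp
  simp only [h1]
  rw [← hhalf p, ← eLpNorm_enorm_rpow _ (by norm_num : (0 : ℝ) < 1 / 2)]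
  simp

/-- Under discretisation the mixed norm over space-time becomes the mixed norm over the lattice. -/
theorem cNorm_comp_cell {N : ℝ} (hN : 1 ≤ N) (P Q : ℝ≥0∞) (A : (Fin n → ℤ) → ℤ → ℝ≥0∞) :
    cNorm P Q (fun z => A (spaceCell N z.1) (timeCell N z.1 z.2)) =
      ENNReal.ofReal ((4 * Real.pi * N) ^ ((P⁻¹).toReal - (Q⁻¹).toReal)) * dNorm P Q A := by
  have hκ : 0 < 4 * Real.pi * N := by have := Real.pi_pos; positivity
  have h1 : ∀ x : EuclideanSpace ℝ (Fin n),
      eLpNorm (fun t => A (spaceCell N x) (timeCell N x t)) Q volume =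
        ENNReal.ofReal (4 * Real.pi * N)⁻¹ ^ (1 / Q).toReal *
          eLpNorm (A (spaceCell N x)) Q Measure.count := fun x =>
    eLpNorm_comp_eq_of_fiber ((measurable_timeCell N).comp measurable_prodMk_left)
      (ENNReal.ofReal_pos.2 (inv_pos.2 hκ)).ne' (volume_timeCell_eq hN x) Q _
  unfold cNorm dNorm
  simp only [h1]
  have hpos : 0 < ENNReal.ofReal (4 * Real.pi * N)⁻¹ := ENNReal.ofReal_pos.2 (inv_pos.2 hκ)
  rw [eLpNorm_const_mul (ENNReal.rpow_pos hpos ENNReal.ofReal_ne_top).ne'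
    (ENNReal.rpow_ne_top_of_nonneg ENNReal.toReal_nonneg ENNReal.ofReal_ne_top),
    eLpNorm_comp_eq_of_fiber (measurable_spaceCell N) (by simpa using hκ) (volume_spaceCell_eq hN) P
      (fun y => eLpNorm (A y) Q Measure.count), ← mul_assoc]
  congr 1
  rw [ENNReal.ofReal_rpow_of_pos (by positivity), ENNReal.ofReal_rpow_of_pos hκ,
    ← ENNReal.ofReal_mul (by positivity), Real.inv_rpow hκ.le, ← Real.rpow_neg hκ.le,
    ← Real.rpow_add hκ, one_div, one_div]
  ring_nf

/-- The point `(X, t)`, in the frame moving with velocity `4πN e₁`, that corresponds to a pair of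
indices of cells. -/
noncomputable def latticePoint (N : ℝ) (w : (Fin n → ℤ) × ℤ) : EuclideanSpace ℝ (Fin n) × ℝ :=
  (WithLp.toLp 2 fun i => if i = 0 then (w.2 : ℝ) else w.1 i, w.1 0 - w.2 / (4 * Real.pi * N))

/-- The change to the frame moving with velocity `4πN e₁`. -/
noncomputable def movingPoint (N : ℝ) (z : EuclideanSpace ℝ (Fin n) × ℝ) :
    EuclideanSpace ℝ (Fin n) × ℝ :=
  (z.1 - (4 * Real.pi * z.2 * N) • e1 n, z.2)

theorem latticePoint_add (N : ℝ) (w w' : (Fin n → ℤ) × ℤ) :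
    latticePoint N (w + w') = latticePoint N w + latticePoint N w' := by
  refine Prod.ext ?_ ?_
  · ext i
    simp only [latticePoint, Prod.fst_add, Prod.snd_add, PiLp.add_apply]
    split_ifs <;> simp
  · simp only [latticePoint, Prod.fst_add, Prod.snd_add, Pi.add_apply]
    push_cast
    ring

theorem latticePoint_sub (N : ℝ) (w w' : (Fin n → ℤ) × ℤ) :
    latticePoint N (w - w') = latticePoint N w - latticePoint N w' := by
  rw [eq_sub_iff_add_eq, ← latticePoint_add, sub_add_cancel]

theorem continuous_movingPoint (N : ℝ) : Continuous (movingPoint (n := n) N) := by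
  unfold movingPoint
  fun_prop

theorem four_pi_mul_ge {N : ℝ} (hN : 1 ≤ N) : 2 ≤ 4 * Real.pi * N := by
  nlinarith [Real.pi_gt_three]

theorem abs_coord_latticePoint_sub_movingPoint_le {N : ℝ} (hN : 1 ≤ N)
    (z : EuclideanSpace ℝ (Fin n) × ℝ) (o : Option (Fin n)) :
    |spaceTimeCoord (latticePoint N (spaceCell N z.1, timeCell N z.1 z.2) - movingPoint N z) o| ≤
      2 := by
  have hκ := four_pi_mul_ge hN
  set κ := 4 * Real.pi * N with hκdef
  have hκ0 : 0 < κ := by linarith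
  have h1 := Int.floor_le (z.1 0 - κ * z.2)
  have h2 := Int.lt_floor_add_one (z.1 0 - κ * z.2)
  have h3 := Int.floor_le (z.1 0 / κ)
  have h4 := Int.lt_floor_add_one (z.1 0 / κ)
  cases o with
  | some i =>
    simp only [spaceTimeCoord, latticePoint, movingPoint, Prod.fst_sub, PiLp.sub_apply,
      PiLp.smul_apply, e1, timeCell, spaceCell, cellIndex, spaceScale, smul_eq_mul]
    by_cases hi : i = 0
    · subst hi
      simp only [if_true, PiLp.single_apply, mul_one]
      rw [← hκdef, abs_le, show 4 * Real.pi * z.2 * N = κ * z.2 by rw [hκdef]; ring]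
      constructor <;> linarith
    · simp only [hi, if_false, PiLp.single_apply, div_one, mul_zero, sub_zero]
      have h5 := Int.floor_le (z.1 i)
      have h6 := Int.lt_floor_add_one (z.1 i)
      rw [abs_le]
      constructor <;> linarith
  | none =>
    simp only [spaceTimeCoord, latticePoint, movingPoint, Prod.snd_sub, timeCell, spaceCell,
      cellIndex, spaceScale, if_true, ← hκdef]
    have e1 : (⌊z.1 0 / κ⌋ : ℝ) - (⌊z.1 0 - κ * z.2⌋ : ℝ) / κ - z.2 =
        (⌊z.1 0 / κ⌋ - z.1 0 / κ) + (z.1 0 - κ * z.2 - ⌊z.1 0 - κ * z.2⌋) / κ := by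
      field_simp
      ring
    have h7 : (z.1 0 - κ * z.2 - ⌊z.1 0 - κ * z.2⌋) / κ ≤ 1 := by
      rw [div_le_one hκ0]; linarith
    have h8 : 0 ≤ (z.1 0 - κ * z.2 - ⌊z.1 0 - κ * z.2⌋) / κ := div_nonneg (by linarith) hκ0.le
    rw [e1, abs_le]
    constructor <;> linarith

theorem abs_coord_latticePoint_le {N : ℝ} (hN : 1 ≤ N) {R : ℝ} {w : (Fin n → ℤ) × ℤ}
    (hw : dist w 0 ≤ R) (o : Option (Fin n)) : |spaceTimeCoord (latticePoint N w) o| ≤ 2 * R := by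
  have hκ := four_pi_mul_ge hN
  have hR : 0 ≤ R := dist_nonneg.trans hw
  rw [Prod.dist_eq, max_le_iff] at hw
  have h1 : ∀ i, |(w.1 i : ℝ)| ≤ R := fun i => by
    have := (dist_le_pi_dist w.1 0 i).trans hw.1
    simpa [Int.norm_eq_abs] using this
  have h2 : |(w.2 : ℝ)| ≤ R := by simpa [Int.norm_eq_abs] using hw.2
  cases o with
  | some i =>
    simp only [spaceTimeCoord, latticePoint]
    split_ifs
    · linarith
    · linarith [h1 i]
  | none =>
    simp only [spaceTimeCoord, latticePoint]
    have h3 : |(w.2 : ℝ) / (4 * Real.pi * N)| ≤ R := by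
      rw [abs_div, abs_of_pos (by linarith : 0 < 4 * Real.pi * N), div_le_iff₀ (by linarith)]
      nlinarith
    calc _ ≤ |(w.1 0 : ℝ)| + |(w.2 : ℝ) / (4 * Real.pi * N)| := abs_sub _ _
      _ ≤ _ := by linarith [h1 0]

theorem mem_wavePipe_of_dist_cell_le {N : ℝ} (hN : 1 ≤ N) {R : ℝ} (hR : 1 ≤ R)
    {z : EuclideanSpace ℝ (Fin n) × ℝ}
    (hz : dist ((spaceCell N z.1, timeCell N z.1 z.2) : (Fin n → ℤ) × ℤ) 0 ≤ R) :
    z ∈ wavePipe n N (8 * R) := by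
  have h1 := abs_coord_latticePoint_sub_movingPoint_le hN z
  have h2 := abs_coord_latticePoint_le hN hz
  have h3 : ∀ o, |spaceTimeCoord (movingPoint N z) o| ≤ 4 * R := by
    intro o
    have e : spaceTimeCoord (movingPoint N z) o =
        spaceTimeCoord (latticePoint N (spaceCell N z.1, timeCell N z.1 z.2)) o -
        spaceTimeCoord (latticePoint N (spaceCell N z.1, timeCell N z.1 z.2) - movingPoint N z) o := by
      cases o <;> simp [spaceTimeCoord]
    rw [e]
    calc _ ≤ _ + _ := abs_sub _ _
      _ ≤ 2 * R + 2 := add_le_add (h2 o) (h1 o)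
      _ ≤ _ := by linarith
  refine ⟨?_, fun i => ?_⟩
  · have := h3 none
    rw [spaceTimeCoord, abs_le] at this
    simp only [movingPoint] at this
    constructor <;> linarith
  · have := h3 (some i)
    simp only [spaceTimeCoord, movingPoint] at this
    simp only [PiLp.zero_apply, sub_zero]
    linarith

/-- Lattice points that are far apart in the lattice are far apart in space-time. -/
theorem le_norm_or_le_abs_of_dist {N : ℝ} (hN : 1 ≤ N) {r : ℝ} {w : (Fin n → ℤ) × ℤ}
    (hw : 2 * r ≤ dist w 0) : r ≤ ‖(latticePoint N w).1‖ ∨ r ≤ |(latticePoint N w).2| := by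
  have hκ := four_pi_mul_ge hN
  rcases le_or_gt r 0 with hr | hr
  · exact Or.inl (hr.trans (norm_nonneg _))
  have hX : ∀ i, |(latticePoint N w).1 i| ≤ ‖(latticePoint N w).1‖ := fun i =>
    abs_coord_le_norm _ i
  rcases le_or_gt r |(w.2 : ℝ)| with h2 | h2
  · left
    refine h2.trans ((le_of_eq ?_).trans (hX 0))
    simp [latticePoint]
  have h1 : 2 * r ≤ dist w.1 0 := by
    rw [Prod.dist_eq, le_max_iff] at hw
    refine hw.resolve_right fun h => ?_
    have : dist w.2 (0 : (Fin n → ℤ) × ℤ).2 = |(w.2 : ℝ)| := by simp [Int.norm_eq_abs]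
    linarith
  obtain ⟨i, hi⟩ : ∃ i, 2 * r ≤ |(w.1 i : ℝ)| := by
    by_contra! h
    refine absurd h1 (not_le.2 ((dist_pi_lt_iff (by linarith)).2 fun i => ?_))
    simpa [Int.norm_eq_abs] using h i
  by_cases h0 : i = 0
  · right
    subst h0
    have h3 : |(w.2 : ℝ) / (4 * Real.pi * N)| ≤ r := by
      rw [abs_div, abs_of_pos (by linarith : 0 < 4 * Real.pi * N), div_le_iff₀ (by linarith)]
      nlinarith
    have := abs_sub_abs_le_abs_sub (w.1 0 : ℝ) (w.2 / (4 * Real.pi * N))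
    simp only [latticePoint]
    linarith
  · left
    have e : |(latticePoint N w).1 i| = |(w.1 i : ℝ)| := by simp [latticePoint, h0]
    linarith [hX i]

end Discretisation

/-! ### From waves to the extension operator and back -/

section Transfer

variable {n : ℕ}

/-- The analogue of admissibility for functions on the unit ball, after translating the frequency
`N e₁` to the origin. -/
def SeparatedPair (g₁ g₂ : EuclideanSpace ℝ (Fin n) → ℂ) : Prop :=
  (∀ ζ, g₁ ζ ≠ 0 → ‖ζ‖ ≤ 1) ∧ (∀ ζ, g₂ ζ ≠ 0 → ‖ζ‖ ≤ 1) ∧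
    ∀ ζ η, g₁ ζ ≠ 0 → g₂ η ≠ 0 → 1 / 2 ≤ dist ζ η

theorem isClosed_fourierSupport (f : L2Space n) : IsClosed (fourierSupport f) := by
  rw [← isOpen_compl_iff, isOpen_iff_mem_nhds]
  intro ξ hξ
  simp only [fourierSupport, Set.mem_compl_iff, Set.mem_ofPred_eq, not_forall, not_not] at hξ
  obtain ⟨U, hU, h⟩ := hξ
  filter_upwards [eventually_mem_nhds_iff.2 hU] with η hη
  simp only [fourierSupport, Set.mem_compl_iff, Set.mem_ofPred_eq, not_forall, not_not]
  exact ⟨U, hη, h⟩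

theorem ae_eq_zero_off_fourierSupport (f : L2Space n) :
    ∀ᵐ ξ, ξ ∉ fourierSupport f → (𝓕 f : L2Space n) ξ = 0 := by
  have hm : MeasurableSet {ξ | (𝓕 f : L2Space n) ξ = 0} :=
    (Lp.stronglyMeasurable (𝓕 f : L2Space n)).measurable (measurableSet_singleton 0)
  have h : volume ((fourierSupport f)ᶜ ∩ {ξ | (𝓕 f : L2Space n) ξ = 0}ᶜ) = 0 := by
    refine measure_null_of_locally_null _ fun ξ hξ => ?_
    have h1 := hξ.1
    simp only [fourierSupport, Set.mem_compl_iff, Set.mem_ofPred_eq, not_forall, not_not] at h1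
    obtain ⟨U, hU, h⟩ := h1
    obtain ⟨W, hWU, hWo, hξW⟩ := mem_nhds_iff.1 hU
    refine ⟨W ∩ {ξ | (𝓕 f : L2Space n) ξ = 0}ᶜ, ?_, ?_⟩
    · filter_upwards [mem_nhdsWithin_of_mem_nhds (hWo.mem_nhds hξW), self_mem_nhdsWithin]
        with η hη hη'
      exact ⟨hη, hη'.2⟩
    · have h2 := ae_restrict_of_ae_restrict_of_subset hWU h
      rw [ae_restrict_iff' hWo.measurableSet] at h2
      refine measure_mono_null ?_ h2
      intro η hη
      simpa using hη
  rw [ae_iff]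
  refine measure_mono_null (fun ξ hξ => ?_) h
  simpa using hξ

theorem fourierSupport_subset {f : L2Space n} {K : Set (EuclideanSpace ℝ (Fin n))}
    (hK : IsClosed K) (h : ∀ᵐ ξ, ξ ∉ K → (𝓕 f : L2Space n) ξ = 0) : fourierSupport f ⊆ K := by
  intro ξ hξ
  by_contra hξK
  refine hξ Kᶜ (hK.isOpen_compl.mem_nhds hξK) ?_
  rw [ae_restrict_iff' hK.measurableSet.compl]
  exact h

variable [NeZero n]

theorem norm_schrodingerWave_eq {N : ℝ} {f : L2Space n} {g : EuclideanSpace ℝ (Fin n) → ℂ}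
    (hfg : ∀ᵐ ξ, (𝓕 f : L2Space n) ξ = g (ξ - N • e1 n)) (z : EuclideanSpace ℝ (Fin n) × ℝ) :
    ‖schrodingerWave f z.1 z.2‖ = ‖extendWave g (movingPoint N z)‖ := by
  have h1 : schrodingerWave f z.1 z.2 = waveChar z (N • e1 n) * extendWave g (movingPoint N z) := by
    rw [schrodingerWave, extendWave, ← integral_const_mul,
      ← integral_add_right_eq_self _ (N • e1 n)]
    refine integral_congr_ae ?_
    have h2 : ∀ᵐ ζ, (𝓕 f : L2Space n) (ζ + N • e1 n) = g ζ := by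
      have := (measurePreserving_add_right volume (N • e1 n)).quasiMeasurePreserving.ae hfg
      simpa using this
    filter_upwards [h2] with ζ hζ
    rw [hζ, ← mul_assoc, waveChar, waveChar, ← Complex.exp_add]
    congr 2
    rw [← mul_add, ← Complex.ofReal_add]
    congr 2
    simp only [wavePhase, movingPoint, inner_add_right, inner_sub_left, real_inner_smul_left,
      real_inner_smul_right, norm_add_sq_real]
    rw [real_inner_comm ζ (e1 n)]
    ring
  rw [h1, norm_mul, norm_waveChar, one_mul]

theorem exists_L2Space_of_function (N : ℝ) {g : EuclideanSpace ℝ (Fin n) → ℂ}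
    (hg : MemLp g 2) : ∃ f : L2Space n, (∀ᵐ ξ, (𝓕 f : L2Space n) ξ = g (ξ - N • e1 n)) ∧
      ‖f‖ₑ = eLpNorm g 2 volume := by
  have hmp := measurePreserving_sub_right (volume : Measure (EuclideanSpace ℝ (Fin n))) (N • e1 n)
  have hg' : MemLp (fun ξ => g (ξ - N • e1 n)) 2 := hg.comp_measurePreserving hmp
  refine ⟨𝓕⁻ (hg'.toLp _), ?_, ?_⟩
  · rw [FourierTransform.fourier_fourierInv_eq]
    exact hg'.coeFn_toLp
  · rw [← ofReal_norm, ← Lp.norm_fourier_eq, FourierTransform.fourier_fourierInv_eq, ofReal_norm,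
      Lp.enorm_toLp]
    exact eLpNorm_comp_measurePreserving hg.aestronglyMeasurable hmp

theorem exists_function_of_L2Space (N : ℝ) (f : L2Space n) :
    ∃ g : EuclideanSpace ℝ (Fin n) → ℂ, Measurable g ∧ MemLp g 2 ∧
      (∀ᵐ ξ, (𝓕 f : L2Space n) ξ = g (ξ - N • e1 n)) ∧ eLpNorm g 2 volume = ‖f‖ₑ ∧
      ∀ ζ, g ζ ≠ 0 → ζ + N • e1 n ∈ fourierSupport f := by
  set F := (fourierSupport f).indicator fun ξ => (𝓕 f : L2Space n) ξ with hF
  have hFm : Measurable F := (Lp.stronglyMeasurable (𝓕 f : L2Space n)).measurable.indicator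
    (isClosed_fourierSupport f).measurableSet
  have hFf : F =ᵐ[volume] (𝓕 f : L2Space n) := by
    filter_upwards [ae_eq_zero_off_fourierSupport f] with ξ hξ
    by_cases h : ξ ∈ fourierSupport f
    · rw [hF, Set.indicator_of_mem h]
    · rw [hF, Set.indicator_of_notMem h, hξ h]
  have hF2 : MemLp F 2 := (memLp_congr_ae hFf).2 (Lp.memLp _)
  have hmp := measurePreserving_add_right (volume : Measure (EuclideanSpace ℝ (Fin n))) (N • e1 n)
  refine ⟨fun ζ => F (ζ + N • e1 n), hFm.comp (measurable_add_const _),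
    hF2.comp_measurePreserving hmp, ?_, ?_, fun ζ hζ => ?_⟩
  · filter_upwards [hFf] with ξ hξ
    rw [sub_add_cancel, hξ]
  · have := eLpNorm_comp_measurePreserving (p := 2) hF2.aestronglyMeasurable hmp
    refine this.trans ?_
    rw [eLpNorm_congr_ae hFf, ← Lp.enorm_def, ← ofReal_norm, Lp.norm_fourier_eq, ofReal_norm]
  · by_contra h
    exact hζ (Set.indicator_of_notMem h _)

omit [NeZero n] in
theorem fourierSupport_subset_closure {c : EuclideanSpace ℝ (Fin n)} {f : L2Space n}
    {g : EuclideanSpace ℝ (Fin n) → ℂ} (hfg : ∀ᵐ ξ, (𝓕 f : L2Space n) ξ = g (ξ - c)) :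
    fourierSupport f ⊆ closure {ξ | g (ξ - c) ≠ 0} := by
  refine fourierSupport_subset isClosed_closure ?_
  filter_upwards [hfg] with ξ hξ hξ'
  rw [hξ]
  by_contra h0
  exact hξ' (subset_closure h0)

theorem admissiblePair_of_separatedPair {N : ℝ} {f₁ f₂ : L2Space n}
    {g₁ g₂ : EuclideanSpace ℝ (Fin n) → ℂ} (h : SeparatedPair g₁ g₂)
    (h₁ : ∀ᵐ ξ, (𝓕 f₁ : L2Space n) ξ = g₁ (ξ - N • e1 n))
    (h₂ : ∀ᵐ ξ, (𝓕 f₂ : L2Space n) ξ = g₂ (ξ - N • e1 n)) : AdmissiblePair N f₁ f₂ := by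
  have hball : ∀ {g : EuclideanSpace ℝ (Fin n) → ℂ}, (∀ ζ, g ζ ≠ 0 → ‖ζ‖ ≤ 1) →
      closure {ξ | g (ξ - N • e1 n) ≠ 0} ⊆ Metric.closedBall (N • e1 n) 1 := by
    intro g hg
    refine closure_minimal (fun ξ hξ => ?_) Metric.isClosed_closedBall
    rw [mem_closedBall_iff_norm]
    exact hg _ hξ
  refine ⟨(fourierSupport_subset_closure h₁).trans (hball h.1),
    (fourierSupport_subset_closure h₂).trans (hball h.2.1), fun ξ hξ η hη => ?_⟩
  have hξ' := fourierSupport_subset_closure h₁ hξ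
  have hη' := fourierSupport_subset_closure h₂ hη
  rw [Metric.mem_closure_iff] at hξ' hη'
  refine le_of_forall_pos_le_add fun δ hδ => ?_
  obtain ⟨a, ha, hξa⟩ := hξ' (δ / 2) (by positivity)
  obtain ⟨b, hb, hηb⟩ := hη' (δ / 2) (by positivity)
  have h3 := h.2.2 (a - N • e1 n) (b - N • e1 n) ha hb
  rw [dist_sub_right] at h3
  have h4 := dist_triangle4 a ξ η b
  rw [dist_comm a ξ] at h4
  linarith

theorem bilinearWave_eq {N : ℝ} {f₁ f₂ : L2Space n} {g₁ g₂ : EuclideanSpace ℝ (Fin n) → ℂ}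
    (h₁ : ∀ᵐ ξ, (𝓕 f₁ : L2Space n) ξ = g₁ (ξ - N • e1 n))
    (h₂ : ∀ᵐ ξ, (𝓕 f₂ : L2Space n) ξ = g₂ (ξ - N • e1 n)) :
    bilinearWave f₁ f₂ = fun z =>
      ‖extendWave g₁ (movingPoint N z) * extendWave g₂ (movingPoint N z)‖ ^ (1 / 2 : ℝ) := by
  ext z
  rw [bilinearWave, norm_mul, norm_mul, norm_schrodingerWave_eq h₁, norm_schrodingerWave_eq h₂]

/-- The local estimate in terms of the extension operator. -/
theorem cNorm_indicator_wavePipe_le {N R θ ρ A : ℝ} {p₀ r₀ : ℝ≥0∞}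
    (H : ∀ f₁ f₂ : L2Space n, AdmissiblePair N f₁ f₂ →
      mixedNorm p₀ r₀ (wavePipe n N R) (bilinearWave f₁ f₂) ≤
        ENNReal.ofReal (A * θ * ρ * ‖f₁‖ ^ (1 / 2 : ℝ) * ‖f₂‖ ^ (1 / 2 : ℝ)))
    {g₁ g₂ : EuclideanSpace ℝ (Fin n) → ℂ} (hg₁ : MemLp g₁ 2) (hg₂ : MemLp g₂ 2)
    (hg : SeparatedPair g₁ g₂) :
    cNorm (p₀ / 2) (r₀ / 2) ((wavePipe n N R).indicator fun z =>
        ‖extendWave g₁ (movingPoint N z) * extendWave g₂ (movingPoint N z)‖ₑ) ≤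
      ENNReal.ofReal (A ^ 2 * θ ^ 2 * ρ ^ 2) * (eLpNorm g₁ 2 volume * eLpNorm g₂ 2 volume) := by
  obtain ⟨f₁, hf₁, hn₁⟩ := exists_L2Space_of_function N hg₁
  obtain ⟨f₂, hf₂, hn₂⟩ := exists_L2Space_of_function N hg₂
  have h := H f₁ f₂ (admissiblePair_of_separatedPair hg hf₁ hf₂)
  rw [bilinearWave_eq hf₁ hf₂, mixedNorm_rpow_half] at h
  have h2 := ENNReal.rpow_le_rpow h (by norm_num : (0 : ℝ) ≤ 2)
  rw [← ENNReal.rpow_mul, show (1 / 2 : ℝ) * 2 = 1 by norm_num, ENNReal.rpow_one] at h2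
  refine h2.trans ?_
  rw [← hn₁, ← hn₂, ← ofReal_norm f₁, ← ofReal_norm f₂, ← ENNReal.ofReal_mul (norm_nonneg _),
    ← ENNReal.ofReal_mul (by positivity), ENNReal.rpow_ofNat]
  have hsq : ∀ x : ℝ, ENNReal.ofReal x ^ 2 ≤ ENNReal.ofReal (x ^ 2) := fun x => by
    rcases le_total 0 x with hx | hx
    · rw [ENNReal.ofReal_pow hx]
    · simp [ENNReal.ofReal_of_nonpos hx]
  refine (hsq _).trans (ENNReal.ofReal_le_ofReal (le_of_eq ?_))
  have e : ∀ x : ℝ, 0 ≤ x → (x ^ (1 / 2 : ℝ)) ^ 2 = x := fun x hx => by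
    rw [← Real.rpow_natCast, ← Real.rpow_mul hx]; norm_num
  simp only [mul_pow, e _ (norm_nonneg f₁), e _ (norm_nonneg f₂)]
  ring

end Transfer

/-! ### Moving separated points of the unit ball inwards -/

section Geometry

variable {F : Type*} [NormedAddCommGroup F] [InnerProductSpace ℝ F]

/-- A small displacement that points inwards keeps a point in the unit ball; the condition is needed
only near the boundary. -/
theorem norm_add_le_one_of_inward {ρ : ℝ} (hρ0 : 0 ≤ ρ) (hρ : ρ ≤ 1 / 200) {ξ u : F}
    (hξ : ‖ξ‖ ≤ 1) (hu : ‖u‖ ≤ 14 * ρ) (h : 9 / 10 ≤ ‖ξ‖ → inner ℝ ξ u ≤ -ρ) : ‖ξ + u‖ ≤ 1 := by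
  rcases le_total (9 / 10) ‖ξ‖ with h1 | h1
  · have h2 := h h1
    have h3 := norm_add_sq_real ξ u
    have h4 : ‖u‖ ^ 2 ≤ (14 * ρ) ^ 2 := pow_le_pow_left₀ (norm_nonneg _) hu 2
    have h5 : ‖ξ‖ ^ 2 ≤ 1 := pow_le_one₀ (norm_nonneg _) hξ
    refine (sq_le_one_iff₀ (norm_nonneg _)).1 ?_
    nlinarith
  · linarith [norm_add_le ξ u]

/-- One of the two shifts when the points are close: towards the origin, and away from `η₀`. -/
theorem norm_shift_le_one_of_close {ρ : ℝ} (hρ0 : 0 ≤ ρ) (hρ : ρ ≤ 1 / 200) {ξ₀ η₀ ξ a : F}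
    (hξ₀ : ‖ξ₀‖ ≤ 1) (hη₀ : ‖η₀‖ ≤ 1) (hd : ‖ξ₀ - η₀‖ ≤ 6 / 10) (hξ : ‖ξ‖ ≤ 1)
    (hξξ : ‖ξ - ξ₀‖ ≤ 1 / 50) (ha : ‖a‖ ≤ ρ) :
    ‖ξ + (ρ • (-(5 : ℝ) • (ξ₀ + η₀) + (4 : ℝ) • (ξ₀ - η₀)) + a)‖ ≤ 1 := by
  refine norm_add_le_one_of_inward hρ0 hρ hξ ?_ fun h => ?_
  · have h1 : ‖-(5 : ℝ) • (ξ₀ + η₀) + (4 : ℝ) • (ξ₀ - η₀)‖ ≤ 13 := by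
      calc _ ≤ ‖-(5 : ℝ) • (ξ₀ + η₀)‖ + ‖(4 : ℝ) • (ξ₀ - η₀)‖ := norm_add_le _ _
        _ = 5 * ‖ξ₀ + η₀‖ + 4 * ‖ξ₀ - η₀‖ := by rw [norm_smul, norm_smul]; norm_num
        _ ≤ _ := by linarith [norm_add_le ξ₀ η₀]
    calc _ ≤ ‖ρ • (-(5 : ℝ) • (ξ₀ + η₀) + (4 : ℝ) • (ξ₀ - η₀))‖ + ‖a‖ := norm_add_le _ _
      _ ≤ ρ * 13 + ρ := by
        rw [norm_smul, Real.norm_of_nonneg hρ0]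
        gcongr
      _ = _ := by ring
  · have e1 : inner ℝ ξ (ρ • (-(5 : ℝ) • (ξ₀ + η₀) + (4 : ℝ) • (ξ₀ - η₀)) + a) =
        ρ * (-10 * ‖ξ‖ ^ 2 + 10 * inner ℝ ξ (ξ - ξ₀) + 9 * inner ℝ ξ (ξ₀ - η₀)) + inner ℝ ξ a := by
      simp only [inner_add_right, inner_sub_right, real_inner_smul_right,
        real_inner_self_eq_norm_sq]
      ring
    have b1 : inner ℝ ξ (ξ - ξ₀) ≤ 1 / 50 := (real_inner_le_norm _ _).trans (by
      nlinarith [norm_nonneg ξ, norm_nonneg (ξ - ξ₀)])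
    have b2 : inner ℝ ξ (ξ₀ - η₀) ≤ 6 / 10 := (real_inner_le_norm _ _).trans (by
      nlinarith [norm_nonneg ξ, norm_nonneg (ξ₀ - η₀)])
    have b3 : inner ℝ ξ a ≤ ρ := (real_inner_le_norm _ _).trans (by
      nlinarith [norm_nonneg ξ, norm_nonneg a])
    have b4 : (9 / 10 : ℝ) ^ 2 ≤ ‖ξ‖ ^ 2 := pow_le_pow_left₀ (by norm_num) h 2
    rw [e1]
    nlinarith

/-- If `ξ₀`, `η₀` lie in the unit ball, there are directions `v₁`, `v₂` such that moving points near
`ξ₀` and `η₀` a little in these directions, up to small errors, does not leave the unit ball and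
preserves the property of being at distance at least `1 / 2`. If `ξ₀`, `η₀` are not close, the
distance has room to spare and both points move towards the origin; otherwise they move towards the
origin in parallel and, in addition, away from each other. -/
theorem exists_inward_separating_shift {ξ₀ η₀ : F} (hξ₀ : ‖ξ₀‖ ≤ 1) (hη₀ : ‖η₀‖ ≤ 1) :
    ∃ v₁ v₂ : F, ‖v₁‖ ≤ 13 ∧ ‖v₂‖ ≤ 13 ∧ ∀ ρ : ℝ, 0 ≤ ρ → ρ ≤ 1 / 200 → ∀ ξ η a b : F,
      ‖ξ‖ ≤ 1 → ‖η‖ ≤ 1 → ‖ξ - ξ₀‖ ≤ 1 / 50 → ‖η - η₀‖ ≤ 1 / 50 → ‖a‖ ≤ ρ → ‖b‖ ≤ ρ →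
      ‖ξ + (ρ • v₁ + a)‖ ≤ 1 ∧ ‖η + (ρ • v₂ + b)‖ ≤ 1 ∧
      (1 / 2 ≤ ‖ξ - η‖ → 1 / 2 ≤ ‖(ξ + (ρ • v₁ + a)) - (η + (ρ • v₂ + b))‖) := by
  rcases le_total ‖ξ₀ - η₀‖ (6 / 10) with hd | hd
  · have hd' : ‖η₀ - ξ₀‖ ≤ 6 / 10 := by rwa [norm_sub_rev]
    have hv : ∀ {x y : F}, ‖x‖ ≤ 1 → ‖y‖ ≤ 1 → ‖x - y‖ ≤ 6 / 10 →
        ‖-(5 : ℝ) • (x + y) + (4 : ℝ) • (x - y)‖ ≤ 13 := by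
      intro x y hx hy hxy
      calc _ ≤ ‖-(5 : ℝ) • (x + y)‖ + ‖(4 : ℝ) • (x - y)‖ := norm_add_le _ _
        _ = 5 * ‖x + y‖ + 4 * ‖x - y‖ := by rw [norm_smul, norm_smul]; norm_num
        _ ≤ _ := by linarith [norm_add_le x y]
    refine ⟨_, _, hv hξ₀ hη₀ hd, hv hη₀ hξ₀ hd', fun ρ hρ0 hρ ξ η a b hξ hη hξξ hηη ha hb =>
      ⟨norm_shift_le_one_of_close hρ0 hρ hξ₀ hη₀ hd hξ hξξ ha,
        norm_shift_le_one_of_close hρ0 hρ hη₀ hξ₀ hd' hη hηη hb, fun h => ?_⟩⟩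
    set d := ξ - η with hdef
    set s := (ξ - ξ₀) - (η - η₀) with hs
    have e1 : (ξ + (ρ • (-(5 : ℝ) • (ξ₀ + η₀) + (4 : ℝ) • (ξ₀ - η₀)) + a)) -
        (η + (ρ • (-(5 : ℝ) • (η₀ + ξ₀) + (4 : ℝ) • (η₀ - ξ₀)) + b)) =
        d + ((8 * ρ) • (d - s) + (a - b)) := by
      rw [hdef, hs]
      module
    have hsn : ‖s‖ ≤ 1 / 25 := (norm_sub_le _ _).trans (by linarith)
    have hab : ‖a - b‖ ≤ 2 * ρ := (norm_sub_le _ _).trans (by linarith)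
    have b1 : 0 ≤ inner ℝ d ((8 * ρ) • (d - s) + (a - b)) := by
      rw [inner_add_right, real_inner_smul_right, inner_sub_right, real_inner_self_eq_norm_sq]
      have c1 : inner ℝ d s ≤ ‖d‖ * (1 / 25) := (real_inner_le_norm _ _).trans (by gcongr)
      have c2 : -(‖d‖ * (2 * ρ)) ≤ inner ℝ d (a - b) := by
        have := abs_real_inner_le_norm d (a - b)
        have c3 : ‖d‖ * ‖a - b‖ ≤ ‖d‖ * (2 * ρ) := by gcongr
        linarith [neg_abs_le (inner ℝ d (a - b))]
      have c4 : 8 * ρ * (‖d‖ * (1 / 2) - ‖d‖ * (1 / 25)) ≤ 8 * ρ * (‖d‖ ^ 2 - inner ℝ d s) := by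
        gcongr
        rw [sq]
        gcongr
      nlinarith [mul_nonneg hρ0 (norm_nonneg d)]
    rw [e1]
    have h3 := norm_add_sq_real d ((8 * ρ) • (d - s) + (a - b))
    have h4 : ‖d‖ ^ 2 ≤ ‖d + ((8 * ρ) • (d - s) + (a - b))‖ ^ 2 := by
      have : 0 ≤ ‖(8 * ρ) • (d - s) + (a - b)‖ ^ 2 := by positivity
      linarith
    exact h.trans (abs_le_of_sq_le_sq' h4 (norm_nonneg _)).2
  · have hv : ∀ {x : F}, ‖x‖ ≤ 1 → ‖-(3 : ℝ) • x‖ ≤ 3 := by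
      intro x hx
      rw [norm_smul]
      norm_num
      linarith
    have hin : ∀ {ρ : ℝ}, 0 ≤ ρ → ρ ≤ 1 / 200 → ∀ {x x₀ a : F}, ‖x₀‖ ≤ 1 → ‖x‖ ≤ 1 →
        ‖x - x₀‖ ≤ 1 / 50 → ‖a‖ ≤ ρ →
        ‖ρ • (-(3 : ℝ) • x₀) + a‖ ≤ 4 * ρ ∧ ‖x + (ρ • (-(3 : ℝ) • x₀) + a)‖ ≤ 1 := by
      intro ρ hρ0 hρ x x₀ a hx₀ hx hxx ha
      have h1 : ‖ρ • (-(3 : ℝ) • x₀) + a‖ ≤ 4 * ρ := by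
        refine (norm_add_le _ _).trans ?_
        rw [norm_smul, Real.norm_of_nonneg hρ0]
        have := mul_le_mul_of_nonneg_left (hv hx₀) hρ0
        linarith
      refine ⟨h1, norm_add_le_one_of_inward hρ0 hρ hx (by linarith) fun h => ?_⟩
      have e1 : inner ℝ x (ρ • (-(3 : ℝ) • x₀) + a) =
          ρ * (-3 * ‖x‖ ^ 2 + 3 * inner ℝ x (x - x₀)) + inner ℝ x a := by
        simp only [inner_add_right, inner_sub_right, real_inner_smul_right,
          real_inner_self_eq_norm_sq]
        ring
      have b1 : inner ℝ x (x - x₀) ≤ 1 / 50 := (real_inner_le_norm _ _).trans (by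
        nlinarith [norm_nonneg x, norm_nonneg (x - x₀)])
      have b3 : inner ℝ x a ≤ ρ := (real_inner_le_norm _ _).trans (by
        nlinarith [norm_nonneg x, norm_nonneg a])
      have b4 : (9 / 10 : ℝ) ^ 2 ≤ ‖x‖ ^ 2 := pow_le_pow_left₀ (by norm_num) h 2
      rw [e1]
      nlinarith
    refine ⟨_, _, (hv hξ₀).trans (by norm_num), (hv hη₀).trans (by norm_num),
      fun ρ hρ0 hρ ξ η a b hξ hη hξξ hηη ha hb => ?_⟩
    obtain ⟨h1, h2⟩ := hin hρ0 hρ hξ₀ hξ hξξ ha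
    obtain ⟨h3, h4⟩ := hin hρ0 hρ hη₀ hη hηη hb
    refine ⟨h2, h4, fun _ => ?_⟩
    set u := ρ • (-(3 : ℝ) • ξ₀) + a
    set u' := ρ • (-(3 : ℝ) • η₀) + b
    have e : ξ₀ - η₀ = ((ξ + u) - (η + u')) - (ξ - ξ₀) + (η - η₀) - u + u' := by abel
    have : ‖ξ₀ - η₀‖ ≤ ‖(ξ + u) - (η + u')‖ + ‖ξ - ξ₀‖ + ‖η - η₀‖ + ‖u‖ + ‖u'‖ := by
      rw [e]
      refine (norm_add_le _ _).trans (add_le_add ?_ le_rfl)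
      refine (norm_sub_le _ _).trans (add_le_add ?_ le_rfl)
      refine (norm_add_le _ _).trans (add_le_add ?_ le_rfl)
      exact norm_sub_le _ _
    linarith

end Geometry

/-! ### The local estimate on sparse unions of balls -/

section Sparse

variable {n : ℕ}

theorem integrable_of_memLp_of_norm_le_one {g : EuclideanSpace ℝ (Fin n) → ℂ} (hg : MemLp g 2)
    (hg1 : ∀ ζ, g ζ ≠ 0 → ‖ζ‖ ≤ 1) : Integrable g := by
  have h1 : IntegrableOn g (Metric.closedBall 0 1) := by
    have : IsFiniteMeasure (volume.restrict (Metric.closedBall (0 : EuclideanSpace ℝ (Fin n)) 1)) :=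
      ⟨by simpa using measure_closedBall_lt_top⟩
    exact (hg.restrict _).integrable one_le_two
  rwa [integrableOn_iff_integrable_of_support_subset] at h1
  intro ζ hζ
  simpa using hg1 ζ hζ

theorem continuous_extendWave {g : EuclideanSpace ℝ (Fin n) → ℂ} (hg : Integrable g) :
    Continuous (extendWave g) := by
  unfold extendWave
  refine continuous_of_dominated (bound := fun ζ => ‖g ζ‖) (fun z => ?_) (fun z => ?_) hg.norm ?_
  · exact (continuous_waveChar z).aestronglyMeasurable.mul hg.aestronglyMeasurable
  · exact Filter.Eventually.of_forall fun ζ => by rw [norm_mul, norm_waveChar, one_mul]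
  · refine Filter.Eventually.of_forall fun ζ => ?_
    unfold waveChar wavePhase
    fun_prop

theorem extendWave_add (g : EuclideanSpace ℝ (Fin n) → ℂ) (z z' : EuclideanSpace ℝ (Fin n) × ℝ) :
    extendWave g (z + z') = extendWave (fun ζ => waveChar z ζ * g ζ) z' := by
  unfold extendWave
  refine integral_congr_ae (Filter.Eventually.of_forall fun ζ => ?_)
  simp only [waveChar_add]
  ring

theorem eLpNorm_two_sq (g : EuclideanSpace ℝ (Fin n) → ℂ) :
    eLpNorm g 2 volume ^ 2 = ∫⁻ ζ, ‖g ζ‖ₑ ^ 2 := by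
  have := eLpNorm_nnreal_pow_eq_lintegral (f := g) (μ := volume) (p := 2) two_ne_zero
  simpa using this

theorem dNorm_comp_add {m : Type*} [Finite m] {P Q : ℝ≥0∞} (y₀ : m → ℤ) (s₀ : ℤ)
    (A : (m → ℤ) → ℤ → ℝ≥0∞) :
    dNorm P Q (fun y s => A (y₀ + y) (s₀ + s)) = dNorm P Q A := by
  have hs : ∀ k : ℤ, (Measure.count : Measure ℤ) ((fun s => s₀ + s) ⁻¹' {k}) = 1 := fun k => by
    have : (fun s => s₀ + s) ⁻¹' {k} = {-s₀ + k} := by simp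
    rw [this, Measure.count_singleton]
  have hy : ∀ k : m → ℤ, (Measure.count : Measure (m → ℤ)) ((fun y => y₀ + y) ⁻¹' {k}) = 1 :=
    fun k => by
      have : (fun y => y₀ + y) ⁻¹' {k} = {-y₀ + k} := by simp
      rw [this, Measure.count_singleton]
  unfold dNorm
  have h1 : ∀ y, eLpNorm (fun s => A (y₀ + y) (s₀ + s)) Q Measure.count =
      eLpNorm (A (y₀ + y)) Q Measure.count := fun y => by
    simpa using eLpNorm_comp_eq_of_fiber .of_discrete one_ne_zero hs Q (A (y₀ + y))
  simp only [h1]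
  simpa using eLpNorm_comp_eq_of_fiber .of_discrete one_ne_zero hy P
    fun y => eLpNorm (A y) Q Measure.count

variable [NeZero n]

/-- The product of two waves at the points of the lattice. -/
noncomputable def latticeProd (N : ℝ) (g₁ g₂ : EuclideanSpace ℝ (Fin n) → ℂ) (y : Fin n → ℤ)
    (s : ℤ) : ℝ≥0∞ :=
  ‖extendWave g₁ (latticePoint N (y, s)) * extendWave g₂ (latticePoint N (y, s))‖ₑ

/-- The bilinear estimate on the pipe of radius `R`, with constant `K`. -/
def LocalEstimate (n : ℕ) [NeZero n] (N : ℝ) (P Q : ℝ≥0∞) (R : ℝ) (K : ℝ≥0∞) : Prop :=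
  ∀ g₁ g₂ : EuclideanSpace ℝ (Fin n) → ℂ, MemLp g₁ 2 → MemLp g₂ 2 → SeparatedPair g₁ g₂ →
    cNorm P Q ((wavePipe n N R).indicator fun z =>
      ‖extendWave g₁ (movingPoint N z) * extendWave g₂ (movingPoint N z)‖ₑ) ≤
      K * (eLpNorm g₁ 2 volume * eLpNorm g₂ 2 volume)

theorem measurableSet_wavePipe (N R : ℝ) : MeasurableSet (wavePipe n N R) := by
  have h : IsClosed (wavePipe n N R) := by
    have : wavePipe n N R = {z | z.2 ∈ Set.Icc (-R) R} ∩
        ⋂ i, {z | |(z.1 - (4 * Real.pi * z.2 * N) • e1 n) i - (0 : EuclideanSpace ℝ (Fin n)) i| ≤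
          R / 2} := by
      ext z
      simp [wavePipe, cube]
    rw [this]
    refine IsClosed.inter (isClosed_Icc.preimage continuous_snd) (isClosed_iInter fun i => ?_)
    refine isClosed_le ?_ continuous_const
    fun_prop
  exact h.measurableSet

theorem memLp_localPiece {R V : ℝ} (hR : 1 ≤ R) {w : EuclideanSpace ℝ (Fin n)} (p : PieceIndex n)
    {g : EuclideanSpace ℝ (Fin n) → ℂ} (hgm : Measurable g) (hg2 : MemLp g 2)
    (hg1 : ∀ ζ, g ζ ≠ 0 → ‖ζ‖ ≤ 1) (z : EuclideanSpace ℝ (Fin n) × ℝ) :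
    MemLp (localPiece R V w p fun ζ => waveChar z ζ * g ζ) 2 := by
  classical
  refine ⟨(measurable_localPiece w p _).aestronglyMeasurable, ?_⟩
  have h := sum_lintegral_sq_localPiece_le (V := V) (w := w) hR (le_refl 1) p hgm
    (integrable_of_memLp_of_norm_le_one hg2 hg1) hg2 hg1 {()} (fun _ => z) (by simp)
    (fun _ _ => True) (by simp) (by simp) zero_le_one (by simp)
  rw [Finset.sum_singleton, ← eLpNorm_two_sq, ← eLpNorm_two_sq] at h
  have h2 : eLpNorm (localPiece R V w p fun ζ => waveChar z ζ * g ζ) 2 volume ^ 2 < ∞ :=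
    h.trans_lt (ENNReal.mul_lt_top ENNReal.ofReal_lt_top (ENNReal.pow_lt_top hg2.2))
  simpa using h2

/-- The bilinear estimate on the ball of radius `R` around a lattice point, in terms of the pieces
localised there. -/
theorem dNorm_ball_le {N : ℝ} (hN : 1 ≤ N) {P Q : ℝ≥0∞} (hP : 1 ≤ P) (hQ : 1 ≤ Q) (hQ' : Q ≠ ∞)
    {R V : ℝ} (hR : 1 ≤ R) (hV : 0 ≤ V) {K : ℝ≥0∞} (hK : LocalEstimate n N P Q (8 * R) K)
    {w₁ w₂ : EuclideanSpace ℝ (Fin n)} (hw₁ : ‖w₁‖ ≤ V / R) (hw₂ : ‖w₂‖ ≤ V / R)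
    {g₁ g₂ : EuclideanSpace ℝ (Fin n) → ℂ} (hgm₁ : Measurable g₁) (hgm₂ : Measurable g₂)
    (hg₁ : MemLp g₁ 2) (hg₂ : MemLp g₂ 2) (hb₁ : ∀ ζ, g₁ ζ ≠ 0 → ‖ζ‖ ≤ 1)
    (hb₂ : ∀ ζ, g₂ ζ ≠ 0 → ‖ζ‖ ≤ 1) (w : (Fin n → ℤ) × ℤ)
    (hsep : ∀ p q : PieceIndex n, SeparatedPair
      (localPiece R V w₁ p fun ζ => waveChar (latticePoint N w) ζ * g₁ ζ)
      (localPiece R V w₂ q fun ζ => waveChar (latticePoint N w) ζ * g₂ ζ)) :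
    ENNReal.ofReal ((4 * Real.pi * N) ^ ((P⁻¹).toReal - (Q⁻¹).toReal)) *
      dNorm P Q (fun y s => if dist ((y, s) : (Fin n → ℤ) × ℤ) w ≤ R then
        latticeProd N g₁ g₂ y s else 0) ≤
      ∑' pq : PieceIndex n × PieceIndex n,
        ENNReal.ofReal (pieceCoeff V pq.1) * ENNReal.ofReal (pieceCoeff V pq.2) * (K *
        (eLpNorm (localPiece R V w₁ pq.1 fun ζ => waveChar (latticePoint N w) ζ * g₁ ζ) 2 volume *
        eLpNorm (localPiece R V w₂ pq.2 fun ζ => waveChar (latticePoint N w) ζ * g₂ ζ) 2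
          volume)) := by
  set G₁ : PieceIndex n → EuclideanSpace ℝ (Fin n) → ℂ := fun p =>
    localPiece R V w₁ p fun ζ => waveChar (latticePoint N w) ζ * g₁ ζ with hG₁
  set G₂ : PieceIndex n → EuclideanSpace ℝ (Fin n) → ℂ := fun p =>
    localPiece R V w₂ p fun ζ => waveChar (latticePoint N w) ζ * g₂ ζ with hG₂
  set H : PieceIndex n × PieceIndex n → EuclideanSpace ℝ (Fin n) × ℝ → ℝ≥0∞ := fun pq =>
    (wavePipe n N (8 * R)).indicator fun z =>
      ‖extendWave (G₁ pq.1) (movingPoint N z) * extendWave (G₂ pq.2) (movingPoint N z)‖ₑ with hH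
  have hG₁2 : ∀ p, MemLp (G₁ p) 2 := fun p => memLp_localPiece hR p hgm₁ hg₁ hb₁ _
  have hG₂2 : ∀ p, MemLp (G₂ p) 2 := fun p => memLp_localPiece hR p hgm₂ hg₂ hb₂ _
  have hHm : ∀ pq, Measurable (H pq) := by
    intro pq
    refine Measurable.indicator ?_ (measurableSet_wavePipe _ _)
    have c1 := (continuous_extendWave (integrable_of_memLp_of_norm_le_one (hG₁2 pq.1)
      (hsep pq.1 pq.2).1)).comp (continuous_movingPoint N)
    have c2 := (continuous_extendWave (integrable_of_memLp_of_norm_le_one (hG₂2 pq.2)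
      (hsep pq.1 pq.2).2.1)).comp (continuous_movingPoint N)
    exact (c1.mul c2).enorm.measurable
  have hfact : ∀ {g : EuclideanSpace ℝ (Fin n) → ℂ} {w' : EuclideanSpace ℝ (Fin n)},
      Measurable g → MemLp g 2 → (∀ ζ, g ζ ≠ 0 → ‖ζ‖ ≤ 1) → ‖w'‖ ≤ V / R →
      ∀ z : EuclideanSpace ℝ (Fin n) × ℝ,
      dist ((spaceCell N z.1, timeCell N z.1 z.2) : (Fin n → ℤ) × ℤ) 0 ≤ R →
      ‖extendWave g (latticePoint N (w + (spaceCell N z.1, timeCell N z.1 z.2)))‖ₑ ≤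
        ∑' p : PieceIndex n, ENNReal.ofReal (pieceCoeff V p) * ‖extendWave
          (localPiece R V w' p fun ζ => waveChar (latticePoint N w) ζ * g ζ)
            (movingPoint N z)‖ₑ := by
    intro g w' hgm hg hb hw' z hz
    rw [latticePoint_add, extendWave_add]
    refine enorm_extendWave_le_tsum hR hV hw' ((continuous_waveChar _).measurable.mul hgm)
      ((integrable_of_memLp_of_norm_le_one hg hb).bdd_mul (c := 1)
        (continuous_waveChar _).aestronglyMeasurable
        (Filter.Eventually.of_forall fun ζ => (norm_waveChar _ _).le))
      (fun ζ hζ => hb ζ (right_ne_zero_of_mul hζ)) (abs_coord_latticePoint_le hN hz)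
      (abs_coord_latticePoint_sub_movingPoint_le hN z)
  have htrans : dNorm P Q (fun y s => if dist ((y, s) : (Fin n → ℤ) × ℤ) w ≤ R then
        latticeProd N g₁ g₂ y s else 0) =
      dNorm P Q (fun y s => if dist ((y, s) : (Fin n → ℤ) × ℤ) 0 ≤ R then
        latticeProd N g₁ g₂ (w.1 + y) (w.2 + s) else 0) := by
    rw [← dNorm_comp_add w.1 w.2]
    congr 1
    funext y s
    have : dist ((w.1 + y, w.2 + s) : (Fin n → ℤ) × ℤ) w = dist ((y, s) : (Fin n → ℤ) × ℤ) 0 := by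
      rw [Prod.dist_eq, Prod.dist_eq]
      simp
    rw [this]
  rw [htrans, ← cNorm_comp_cell hN]
  calc _ ≤ cNorm P Q fun z => ∑' pq : PieceIndex n × PieceIndex n,
          ENNReal.ofReal (pieceCoeff V pq.1) * ENNReal.ofReal (pieceCoeff V pq.2) * H pq z := by
        refine cNorm_mono fun z => ?_
        by_cases hz : dist ((spaceCell N z.1, timeCell N z.1 z.2) : (Fin n → ℤ) × ℤ) 0 ≤ R
        · rw [if_pos hz, latticeProd, enorm_mul]
          refine (mul_le_mul' (hfact hgm₁ hg₁ hb₁ hw₁ z hz) (hfact hgm₂ hg₂ hb₂ hw₂ z hz)).trans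
            (le_of_eq ?_)
          rw [ENNReal.tsum_prod (f := fun p q => ENNReal.ofReal (pieceCoeff V p) *
            ENNReal.ofReal (pieceCoeff V q) * H (p, q) z), ← ENNReal.tsum_mul_right]
          refine tsum_congr fun p => ?_
          rw [← ENNReal.tsum_mul_left]
          refine tsum_congr fun q => ?_
          simp only [hH]
          rw [Set.indicator_of_mem (mem_wavePipe_of_dist_cell_le hN hR hz), enorm_mul]
          ring
        · rw [if_neg hz]
          exact zero_le
    _ ≤ ∑' pq : PieceIndex n × PieceIndex n, cNorm P Q fun z =>
          ENNReal.ofReal (pieceCoeff V pq.1) * ENNReal.ofReal (pieceCoeff V pq.2) * H pq z :=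
        cNorm_tsum_le hP hQ hQ' fun pq => (hHm pq).const_mul _
    _ ≤ _ := by
        refine ENNReal.tsum_le_tsum fun pq => ?_
        refine (cNorm_const_mul_le (ENNReal.mul_ne_top ENNReal.ofReal_ne_top
          ENNReal.ofReal_ne_top) _).trans ?_
        gcongr
        exact hK _ _ (hG₁2 _) (hG₂2 _) (hsep _ _)

end Sparse

section SparseSum

theorem sum_mul_le_of_sum_sq_le {ι : Type*} {S : Finset ι} {a b : ι → ℝ≥0∞} {c x y : ℝ≥0∞}
    (ha : ∑ i ∈ S, a i ^ 2 ≤ c * x ^ 2) (hb : ∑ i ∈ S, b i ^ 2 ≤ c * y ^ 2) :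
    ∑ i ∈ S, a i * b i ≤ c * (x * y) := by
  have h := ENNReal.inner_le_Lp_mul_Lq S a b Real.HolderConjugate.two_two
  simp only [ENNReal.rpow_ofNat] at h
  have hr : ∀ u : ℝ≥0∞, (u ^ 2) ^ (1 / 2 : ℝ) = u := fun u => by
    rw [← ENNReal.rpow_natCast, ← ENNReal.rpow_mul]
    norm_num
  calc _ ≤ _ := h
    _ ≤ (c * x ^ 2) ^ (1 / 2 : ℝ) * (c * y ^ 2) ^ (1 / 2 : ℝ) := by gcongr
    _ = c * (x * y) := by
      rw [← ENNReal.mul_rpow_of_nonneg _ _ (by norm_num), ← hr (c * (x * y))]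
      congr 1
      ring

variable {n : ℕ} [NeZero n]

/-- The sum over all pieces of the coefficients of the localisation. -/
noncomputable def pieceSum (n : ℕ) : ℝ≥0∞ := ∑' p : PieceIndex n, ENNReal.ofReal (pieceCoeff 13 p)

omit [NeZero n] in
theorem pieceSum_ne_top : pieceSum n ≠ ∞ :=
  (summable_pieceCoeff (n := n) (by norm_num : (0 : ℝ) ≤ 13)).tsum_ofReal_ne_top

/-- The bilinear estimate on a union of balls with sparse centres loses only the number `D` of
centres close to a given one. -/
theorem dNorm_sparse_le {N : ℝ} (hN : 1 ≤ N) {P Q : ℝ≥0∞} (hP : 1 ≤ P) (hQ : 1 ≤ Q) (hQ' : Q ≠ ∞)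
    {R : ℝ} (hR : 200 ≤ R) {K : ℝ≥0∞} (hK : LocalEstimate n N P Q (8 * R) K)
    {g₁ g₂ : EuclideanSpace ℝ (Fin n) → ℂ} (hgm₁ : Measurable g₁) (hgm₂ : Measurable g₂)
    (hg₁ : MemLp g₁ 2) (hg₂ : MemLp g₂ 2) (hsep : SeparatedPair g₁ g₂)
    {ξ₀ η₀ : EuclideanSpace ℝ (Fin n)} (hξ₀ : ‖ξ₀‖ ≤ 1) (hη₀ : ‖η₀‖ ≤ 1)
    (hξ : ∀ ζ, g₁ ζ ≠ 0 → ‖ζ - ξ₀‖ ≤ 1 / 50) (hη : ∀ ζ, g₂ ζ ≠ 0 → ‖ζ - η₀‖ ≤ 1 / 50)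
    {M : ℝ} (hM : 1 ≤ M) (I : Finset ((Fin n → ℤ) × ℤ)) (hI : (I.card : ℝ) ≤ M) {D : ℝ}
    (hD0 : 0 ≤ D)
    (hD : ∀ z ∈ I, ((I.filter fun z' => dist z z' ≤ 82 * n ^ 2 * M ^ 3 * R ^ 2).card : ℝ) ≤ D) :
    ENNReal.ofReal ((4 * Real.pi * N) ^ ((P⁻¹).toReal - (Q⁻¹).toReal)) *
      ∑ w ∈ I, dNorm P Q (fun y s => if dist ((y, s) : (Fin n → ℤ) × ℤ) w ≤ R then
        latticeProd N g₁ g₂ y s else 0) ≤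
      pieceSum n ^ 2 * (K * (ENNReal.ofReal (Real.exp (Real.pi * n) * (D + 1)) *
        (eLpNorm g₁ 2 volume * eLpNorm g₂ 2 volume))) := by
  classical
  obtain ⟨v₁, v₂, hv₁, hv₂, hshift⟩ := exists_inward_separating_shift hξ₀ hη₀
  have hR1 : 1 ≤ R := by linarith
  have hR0 : 0 < R := by linarith
  have hρ0 : 0 ≤ R⁻¹ := by positivity
  have hρ : R⁻¹ ≤ 1 / 200 := by
    rw [one_div]
    exact inv_anti₀ (by norm_num) hR
  have hw : ∀ {v : EuclideanSpace ℝ (Fin n)}, ‖v‖ ≤ 13 → ‖R⁻¹ • v‖ ≤ 13 / R := by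
    intro v hv
    rw [norm_smul, Real.norm_of_nonneg hρ0, inv_mul_eq_div]
    gcongr
  have hpiece : ∀ {g : EuclideanSpace ℝ (Fin n) → ℂ} {v ζ' : EuclideanSpace ℝ (Fin n)}
      (p : PieceIndex n) (w : (Fin n → ℤ) × ℤ),
      localPiece R 13 (R⁻¹ • v) p (fun ζ => waveChar (latticePoint N w) ζ * g ζ) ζ' ≠ 0 →
      ∃ ζ a, g ζ ≠ 0 ∧ ‖a‖ ≤ R⁻¹ ∧ ζ' = ζ + (R⁻¹ • v + a) := by
    intro g v ζ' p w h
    obtain ⟨ζ, hζ, hd⟩ := exists_of_localPiece_ne_zero hR1 h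
    exact ⟨ζ, ζ' - R⁻¹ • v - ζ, right_ne_zero_of_mul hζ, by rwa [one_div] at hd, by abel⟩
  have hsep' : ∀ (w : (Fin n → ℤ) × ℤ) (p q : PieceIndex n), SeparatedPair
      (localPiece R 13 (R⁻¹ • v₁) p fun ζ => waveChar (latticePoint N w) ζ * g₁ ζ)
      (localPiece R 13 (R⁻¹ • v₂) q fun ζ => waveChar (latticePoint N w) ζ * g₂ ζ) := by
    intro w p q
    refine ⟨fun ζ' h => ?_, fun ζ' h => ?_, fun ζ' η' h h' => ?_⟩
    · obtain ⟨ζ, a, hζ, ha, rfl⟩ := hpiece p w h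
      exact (hshift _ hρ0 hρ ζ η₀ a 0 (hsep.1 _ hζ) hη₀ (hξ _ hζ) (by simp) ha
        (by simpa using hR0.le)).1
    · obtain ⟨ζ, a, hζ, ha, rfl⟩ := hpiece q w h
      exact (hshift _ hρ0 hρ ξ₀ ζ 0 a hξ₀ (hsep.2.1 _ hζ) (by simp) (hη _ hζ) (by simpa using hR0.le) ha).2.1
    · obtain ⟨ζ, a, hζ, ha, rfl⟩ := hpiece p w h
      obtain ⟨η, b, hη', hb, rfl⟩ := hpiece q w h'
      rw [dist_eq_norm]
      refine (hshift _ hρ0 hρ ζ η a b (hsep.1 _ hζ) (hsep.2.1 _ hη') (hξ _ hζ) (hη _ hη') ha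
        hb).2.2 ?_
      rw [← dist_eq_norm]
      exact hsep.2.2 _ _ hζ hη'
  set G₁ : PieceIndex n → (Fin n → ℤ) × ℤ → ℝ≥0∞ := fun p w => eLpNorm
    (localPiece R 13 (R⁻¹ • v₁) p fun ζ => waveChar (latticePoint N w) ζ * g₁ ζ) 2 volume with hG₁
  set G₂ : PieceIndex n → (Fin n → ℤ) × ℤ → ℝ≥0∞ := fun p w => eLpNorm
    (localPiece R 13 (R⁻¹ • v₂) p fun ζ => waveChar (latticePoint N w) ζ * g₂ ζ) 2 volume with hG₂
  set c := ENNReal.ofReal (Real.exp (Real.pi * n) * (D + 1)) with hc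
  have hbessel : ∀ {g : EuclideanSpace ℝ (Fin n) → ℂ} (v : EuclideanSpace ℝ (Fin n))
      (p : PieceIndex n), Measurable g → MemLp g 2 → (∀ ζ, g ζ ≠ 0 → ‖ζ‖ ≤ 1) →
      ∑ w ∈ I, eLpNorm (localPiece R 13 v p
        fun ζ => waveChar (latticePoint N w) ζ * g ζ) 2 volume ^ 2 ≤ c * eLpNorm g 2 volume ^ 2 := by
    intro g v p hgm hg hb
    simp only [eLpNorm_two_sq]
    refine sum_lintegral_sq_localPiece_le hR1 hM p hgm (integrable_of_memLp_of_norm_le_one hg hb)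
      hg hb I (latticePoint N) hI (fun z z' => dist z z' ≤ 82 * n ^ 2 * M ^ 3 * R ^ 2)
      (fun z z' => by rw [dist_comm]) (fun z _ z' _ h => ?_) hD0 hD
    rw [← latticePoint_sub]
    refine le_norm_or_le_abs_of_dist hN ?_
    have e : dist (z - z') 0 = dist z z' := by
      rw [Prod.dist_eq, Prod.dist_eq]
      simp [dist_eq_norm]
    rw [e]
    linarith [not_le.1 h]
  rw [Finset.mul_sum]
  calc _ ≤ ∑ w ∈ I, ∑' pq : PieceIndex n × PieceIndex n,
        ENNReal.ofReal (pieceCoeff 13 pq.1) * ENNReal.ofReal (pieceCoeff 13 pq.2) *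
          (K * (G₁ pq.1 w * G₂ pq.2 w)) := Finset.sum_le_sum fun w _ =>
        dNorm_ball_le hN hP hQ hQ' hR1 (by norm_num) hK (hw hv₁) (hw hv₂) hgm₁ hgm₂ hg₁ hg₂ hsep.1
          hsep.2.1 w (hsep' w)
    _ = ∑' pq : PieceIndex n × PieceIndex n,
        ENNReal.ofReal (pieceCoeff 13 pq.1) * ENNReal.ofReal (pieceCoeff 13 pq.2) *
          (K * ∑ w ∈ I, G₁ pq.1 w * G₂ pq.2 w) := by
        rw [← Summable.tsum_finsetSum fun _ _ => ENNReal.summable]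
        simp only [Finset.mul_sum]
    _ ≤ ∑' pq : PieceIndex n × PieceIndex n,
        ENNReal.ofReal (pieceCoeff 13 pq.1) * ENNReal.ofReal (pieceCoeff 13 pq.2) *
          (K * (c * (eLpNorm g₁ 2 volume * eLpNorm g₂ 2 volume))) := by
        refine ENNReal.tsum_le_tsum fun pq => ?_
        gcongr
        exact sum_mul_le_of_sum_sq_le (hbessel _ _ hgm₁ hg₁ hsep.1) (hbessel _ _ hgm₂ hg₂ hsep.2.1)
    _ = _ := by
        rw [ENNReal.tsum_mul_right, ENNReal.tsum_prod (f := fun p q =>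
          ENNReal.ofReal (pieceCoeff 13 p) * ENNReal.ofReal (pieceCoeff 13 q))]
        simp only [ENNReal.tsum_mul_left, ENNReal.tsum_mul_right]
        rw [← pieceSum, sq]

end SparseSum

/-! ### The bilinear estimate on finite sets of lattice points -/

section FiniteSets

variable {n : ℕ} [NeZero n]

/-- The radii `B ^ 6 ^ k` grow so fast that the separation required by almost orthogonality at one
scale is reached at the next one. -/
theorem sparse_radius_bound {m B : ℝ} (hm : 1 ≤ m) (hB : 1312 * n ^ 2 * m ≤ B) (k : ℕ) :
    200 ≤ 2 * B ^ 6 ^ k ∧ 2 * B ^ 6 ^ k ≤ B ^ 6 ^ (k + 1) ∧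
      82 * n ^ 2 * m ^ 3 * (2 * B ^ 6 ^ k) ^ 2 ≤ B ^ 6 ^ (k + 1) / 4 := by
  have hn : (1 : ℝ) ≤ n := by exact_mod_cast NeZero.one_le
  have hn2 : (1 : ℝ) ≤ n ^ 2 := one_le_pow₀ hn
  have hB1 : 1312 ≤ B := by nlinarith
  have hBm : m ≤ B := by nlinarith
  have hBn : 1312 * n ^ 2 ≤ B := by nlinarith
  have hr : B ≤ B ^ 6 ^ k := le_self_pow₀ (by linarith) (by positivity)
  set r := B ^ 6 ^ k with hrdef
  have hr6 : B ^ 6 ^ (k + 1) = r ^ 6 := by rw [hrdef, ← pow_mul, pow_succ]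
  have hr0 : 0 < r := by linarith
  rw [hr6]
  refine ⟨by linarith, ?_, ?_⟩
  · calc 2 * r ≤ r * r := by nlinarith
      _ = r ^ 2 := by ring
      _ ≤ r ^ 6 := pow_le_pow_right₀ (by linarith) (by norm_num)
  · have h1 : m ^ 3 ≤ r ^ 3 := pow_le_pow_left₀ (by linarith) (by linarith) _
    calc 82 * n ^ 2 * m ^ 3 * (2 * r) ^ 2 = 1312 * n ^ 2 * m ^ 3 * r ^ 2 / 4 := by ring
      _ ≤ r * r ^ 3 * r ^ 2 / 4 := by
        gcongr
        linarith
      _ = r ^ 6 / 4 := by ring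

theorem dNorm_zero {α β : Type*} [MeasurableSpace α] [MeasurableSpace β] (P Q : ℝ≥0∞) :
    dNorm P Q (fun (_ : α) (_ : β) => 0) = 0 := by
  simp [dNorm]

/-- The local estimates with an arbitrarily small power loss in the radius give an estimate on
finite sets with an arbitrarily small power loss in the number of points. -/
theorem exists_dNorm_finset_le (n : ℕ) [NeZero n] {A : ℝ → ℝ} (hA : ∀ ε, 0 ≤ A ε) {κ : ℝ}
    (hκ : 0 < κ) : ∃ C : ℝ, ∀ (N : ℝ) (P Q : ℝ≥0∞), 1 ≤ N → 1 ≤ P → P ≤ Q → Q ≠ ∞ →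
    (∀ ε : ℝ, 0 < ε → ∀ R : ℝ, 1 ≤ R → LocalEstimate n N P Q R
      (ENNReal.ofReal (A ε * N ^ ((P⁻¹).toReal - (Q⁻¹).toReal) * R ^ ε))) →
    ∀ g₁ g₂ : EuclideanSpace ℝ (Fin n) → ℂ, Measurable g₁ → Measurable g₂ → MemLp g₁ 2 →
    MemLp g₂ 2 → SeparatedPair g₁ g₂ → ∀ ξ₀ η₀ : EuclideanSpace ℝ (Fin n), ‖ξ₀‖ ≤ 1 → ‖η₀‖ ≤ 1 →
    (∀ ζ, g₁ ζ ≠ 0 → ‖ζ - ξ₀‖ ≤ 1 / 50) → (∀ ζ, g₂ ζ ≠ 0 → ‖ζ - η₀‖ ≤ 1 / 50) →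
    ∀ F : Finset ((Fin n → ℤ) × ℤ),
      dNorm P Q (fun y s => if (y, s) ∈ F then latticeProd N g₁ g₂ y s else 0) ≤
        ENNReal.ofReal C * (F.card : ℝ≥0∞) ^ κ * (eLpNorm g₁ 2 volume * eLpNorm g₂ 2 volume) := by
  classical
  -- `K` scales lose a factor `card ^ (1 / K)` in the sparsity, and `ε` is so small that the radius
  -- at the largest scale, to the power `ε`, loses no more
  set K : ℕ := ⌈2 / κ⌉₊ with hKdef
  have hK0 : 0 < K := Nat.ceil_pos.2 (by positivity)
  have hKκ : (1 : ℝ) / K ≤ κ / 2 := by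
    rw [div_le_iff₀ (by exact_mod_cast hK0)]
    have := Nat.le_ceil (2 / κ)
    rw [← hKdef, div_le_iff₀ hκ] at this
    linarith
  set ε : ℝ := κ / (2 * 6 ^ K) with hε
  have hε0 : 0 < ε := by positivity
  set S := (pieceSum n).toReal with hS
  have hS0 : 0 ≤ S := ENNReal.toReal_nonneg
  have hS' : pieceSum n = ENNReal.ofReal S := (ENNReal.ofReal_toReal pieceSum_ne_top).symm
  set c : ℝ := S ^ 2 * (A ε * (16 ^ ε * (1312 * n ^ 2 : ℝ) ^ (κ / 2)) *
    (Real.exp (Real.pi * n) * 2)) with hc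
  have hc0 : 0 ≤ c := by have := hA ε; positivity
  refine ⟨K * c, fun N P Q hN hP hPQ hQ' hloc g₁ g₂ hgm₁ hgm₂ hg₁ hg₂ hsep ξ₀ η₀ hξ₀ hη₀ hξ hη F =>
    ?_⟩
  have hQ : 1 ≤ Q := hP.trans hPQ
  rcases F.eq_empty_or_nonempty with rfl | hF
  · simp [dNorm_zero]
  obtain ⟨m, hm⟩ : ∃ m : ℝ, m = F.card := ⟨_, rfl⟩
  have hm1 : 1 ≤ m := by rw [hm]; exact_mod_cast hF.card_pos
  have hm0 : 0 < m := by linarith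
  have hn : (1 : ℝ) ≤ n := by exact_mod_cast NeZero.one_le
  obtain ⟨B, hB⟩ : ∃ B : ℝ, B = 1312 * n ^ 2 * m := ⟨_, rfl⟩
  have hB1 : 1 ≤ B := by
    have : (1 : ℝ) ≤ n ^ 2 := one_le_pow₀ hn
    nlinarith
  have hB0 : 0 < B := by linarith
  have hrad := sparse_radius_bound (n := n) hm1 hB.ge
  obtain ⟨G, hGF, hcover, hG⟩ := exists_sparse_cover F K (fun k => B ^ 6 ^ k)
    (fun k => by positivity) (fun k => (hrad k).2.1) hK0.ne'
  set θ := (P⁻¹).toReal - (Q⁻¹).toReal with hθ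
  have hθ0 : 0 ≤ θ := sub_nonneg.2 (ENNReal.toReal_mono
    (ENNReal.inv_ne_top.2 (zero_lt_one.trans_le hP).ne') (ENNReal.inv_le_inv.2 hPQ))
  set X := eLpNorm g₁ 2 volume * eLpNorm g₂ 2 volume with hX
  have hlevel : ∀ k < K, ∑ w ∈ G k, dNorm P Q (fun y s =>
      if dist ((y, s) : (Fin n → ℤ) × ℤ) w ≤ 2 * B ^ 6 ^ k then latticeProd N g₁ g₂ y s else 0) ≤
      ENNReal.ofReal (c * m ^ κ) * X := by
    intro k hk
    have hR1 : 1 ≤ 8 * (2 * B ^ 6 ^ k) := by linarith [(hrad k).1]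
    have h := dNorm_sparse_le hN hP hQ hQ' (hrad k).1 (hloc ε hε0 _ hR1) hgm₁ hgm₂ hg₁ hg₂ hsep hξ₀
      hη₀ hξ hη hm1 (G k) (by rw [hm]; exact_mod_cast Finset.card_le_card (hGF k))
      (D := m ^ (1 / K : ℝ)) (by positivity) (fun z hz => by
        refine le_trans ?_ ((hG k z hz).trans_eq (by rw [hm]))
        refine Nat.cast_le.2 (Finset.card_le_card fun z' => ?_)
        simp only [Finset.mem_filter]
        exact fun h => ⟨h.1, h.2.trans (hrad k).2.2⟩)
    have hNpos : 0 < N ^ θ := Real.rpow_pos_of_pos (by linarith) _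
    -- the power of `N` in the local estimate is the one produced by the discretisation
    have hcancel : ENNReal.ofReal (N ^ θ) ≤ ENNReal.ofReal ((4 * Real.pi * N) ^ θ) := by
      refine ENNReal.ofReal_le_ofReal (Real.rpow_le_rpow (by linarith) ?_ hθ0)
      nlinarith [Real.pi_gt_three]
    have h' := (mul_le_mul_left hcancel _).trans h
    have hreal : S ^ 2 * (A ε * (8 * (2 * B ^ 6 ^ k)) ^ ε *
        (Real.exp (Real.pi * n) * (m ^ (1 / K : ℝ) + 1))) ≤ c * m ^ κ := by
      have h1 : (8 * (2 * B ^ 6 ^ k)) ^ ε ≤ 16 ^ ε * (1312 * n ^ 2 : ℝ) ^ (κ / 2) * m ^ (κ / 2) := by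
        calc (8 * (2 * B ^ 6 ^ k)) ^ ε ≤ (16 * B ^ 6 ^ K) ^ ε := by
              refine Real.rpow_le_rpow (by positivity) ?_ hε0.le
              have := pow_le_pow_right₀ hB1 (Nat.pow_le_pow_right (by norm_num : 0 < 6) hk.le)
              linarith
          _ = 16 ^ ε * B ^ (κ / 2) := by
              rw [Real.mul_rpow (by norm_num) (by positivity), ← Real.rpow_natCast,
                ← Real.rpow_mul (by positivity)]
              congr 2
              rw [hε]
              push_cast
              field_simp
          _ = _ := by rw [hB, Real.mul_rpow (by positivity) hm0.le, mul_assoc]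
      have h2 : m ^ (1 / K : ℝ) + 1 ≤ 2 * m ^ (κ / 2) := by
        have := Real.rpow_le_rpow_of_exponent_le hm1 hKκ
        have := Real.one_le_rpow hm1 (by positivity : 0 ≤ κ / 2)
        linarith
      have := hA ε
      calc _ ≤ S ^ 2 * (A ε * (16 ^ ε * (1312 * n ^ 2 : ℝ) ^ (κ / 2) * m ^ (κ / 2)) *
            (Real.exp (Real.pi * n) * (2 * m ^ (κ / 2)))) := by gcongr
        _ = c * (m ^ (κ / 2) * m ^ (κ / 2)) := by rw [hc]; ring
        _ = c * m ^ κ := by rw [← Real.rpow_add hm0, add_halves]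
    have h'' : ENNReal.ofReal (N ^ θ) * ∑ w ∈ G k, dNorm P Q (fun y s =>
        if dist ((y, s) : (Fin n → ℤ) × ℤ) w ≤ 2 * B ^ 6 ^ k then latticeProd N g₁ g₂ y s else 0) ≤
        ENNReal.ofReal (N ^ θ) * (ENNReal.ofReal (c * m ^ κ) * X) := by
      refine h'.trans ?_
      calc _ = ENNReal.ofReal (N ^ θ) * (ENNReal.ofReal (S ^ 2 * (A ε * (8 * (2 * B ^ 6 ^ k)) ^ ε *
            (Real.exp (Real.pi * n) * (m ^ (1 / K : ℝ) + 1)))) * X) := by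
            have hA' := hA ε
            have e1 : A ε * N ^ θ * (8 * (2 * B ^ 6 ^ k)) ^ ε =
              N ^ θ * (A ε * (8 * (2 * B ^ 6 ^ k)) ^ ε) := by ring
            rw [hS', e1, ENNReal.ofReal_mul hNpos.le, ENNReal.ofReal_mul (sq_nonneg S),
              ENNReal.ofReal_mul (by positivity : 0 ≤ A ε * (8 * (2 * B ^ 6 ^ k)) ^ ε),
              ENNReal.ofReal_pow hS0]
            ring
        _ ≤ _ := by gcongr
    exact (ENNReal.mul_le_mul_iff_right (by simpa using hNpos) ENNReal.ofReal_ne_top).1 h''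
  calc dNorm P Q (fun y s => if (y, s) ∈ F then latticeProd N g₁ g₂ y s else 0)
      ≤ dNorm P Q (fun y s => ∑ k ∈ Finset.range K, ∑ w ∈ G k,
          if dist ((y, s) : (Fin n → ℤ) × ℤ) w ≤ 2 * B ^ 6 ^ k then latticeProd N g₁ g₂ y s
          else 0) := by
        refine dNorm_mono fun y s => ?_
        split_ifs with hys
        · obtain ⟨k, hk, z, hz, hd⟩ := hcover _ hys
          refine le_trans ?_ (Finset.single_le_sum (f := fun k => ∑ w ∈ G k,
            if dist ((y, s) : (Fin n → ℤ) × ℤ) w ≤ 2 * B ^ 6 ^ k then latticeProd N g₁ g₂ y s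
            else 0) (fun _ _ => zero_le) (Finset.mem_range.2 hk))
          refine le_trans ?_ (Finset.single_le_sum (f := fun w =>
            if dist ((y, s) : (Fin n → ℤ) × ℤ) w ≤ 2 * B ^ 6 ^ k then latticeProd N g₁ g₂ y s
            else 0) (fun _ _ => zero_le) hz)
          rw [if_pos hd]
        · exact zero_le
    _ ≤ ∑ k ∈ Finset.range K, ∑ w ∈ G k, dNorm P Q (fun y s =>
          if dist ((y, s) : (Fin n → ℤ) × ℤ) w ≤ 2 * B ^ 6 ^ k then latticeProd N g₁ g₂ y s
          else 0) :=
        (dNorm_sum_le _ hP hQ _).trans (Finset.sum_le_sum fun k _ => dNorm_sum_le _ hP hQ _)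
    _ ≤ ∑ k ∈ Finset.range K, ENNReal.ofReal (c * m ^ κ) * X :=
        Finset.sum_le_sum fun k hk => hlevel k (Finset.mem_range.1 hk)
    _ = ENNReal.ofReal (K * c) * (F.card : ℝ≥0∞) ^ κ * X := by
        rw [Finset.sum_const, Finset.card_range, nsmul_eq_mul, ENNReal.ofReal_mul hc0,
          ENNReal.ofReal_mul (Nat.cast_nonneg _), ENNReal.ofReal_natCast,
          ← ENNReal.ofReal_rpow_of_pos hm0, hm, ENNReal.ofReal_natCast]
        ring

end FiniteSets

/-! ### The global bilinear estimate on the lattice -/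

section LatticeEstimate

variable {n : ℕ} [NeZero n]

theorem latticeProd_eq_zero {N : ℝ} {g₁ g₂ : EuclideanSpace ℝ (Fin n) → ℂ} (hgm₁ : Measurable g₁)
    (hgm₂ : Measurable g₂) (h : eLpNorm g₁ 2 volume * eLpNorm g₂ 2 volume = 0) (y : Fin n → ℤ)
    (s : ℤ) : latticeProd N g₁ g₂ y s = 0 := by
  have h0 : ∀ {g : EuclideanSpace ℝ (Fin n) → ℂ}, Measurable g → eLpNorm g 2 volume = 0 →
      ∀ z, extendWave g z = 0 := by
    intro g hgm hg z
    rw [eLpNorm_eq_zero_iff hgm.aestronglyMeasurable two_ne_zero] at hg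
    refine integral_eq_zero_of_ae ?_
    filter_upwards [hg] with ζ hζ
    simp [hζ]
  rcases mul_eq_zero.1 h with h | h
  · simp [latticeProd, h0 hgm₁ h]
  · simp [latticeProd, h0 hgm₂ h]

/-- The global estimate on the lattice, for functions with supports of small diameter: after
normalisation the estimates on finite sets hold with constants independent of `N` and the
functions. -/
theorem exists_dNorm_le_of_small_support (n : ℕ) [NeZero n] {A : ℝ → ℝ} (hA : ∀ ε, 0 ≤ A ε)
    {P₀ Q₀ P Q : ℝ≥0∞} (hP₀ : 1 ≤ P₀) (hPQ : P₀ ≤ Q₀) (hP : P₀ < P) (hQ : Q₀ < Q) :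
    ∃ C : ℝ, ∀ N : ℝ, 1 ≤ N →
    (∀ ε : ℝ, 0 < ε → ∀ R : ℝ, 1 ≤ R → LocalEstimate n N P₀ Q₀ R
      (ENNReal.ofReal (A ε * N ^ ((P₀⁻¹).toReal - (Q₀⁻¹).toReal) * R ^ ε))) →
    ∀ g₁ g₂ : EuclideanSpace ℝ (Fin n) → ℂ, Measurable g₁ → Measurable g₂ → MemLp g₁ 2 →
    MemLp g₂ 2 → SeparatedPair g₁ g₂ → ∀ ξ₀ η₀ : EuclideanSpace ℝ (Fin n), ‖ξ₀‖ ≤ 1 → ‖η₀‖ ≤ 1 →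
    (∀ ζ, g₁ ζ ≠ 0 → ‖ζ - ξ₀‖ ≤ 1 / 50) → (∀ ζ, g₂ ζ ≠ 0 → ‖ζ - η₀‖ ≤ 1 / 50) →
      dNorm P Q (latticeProd N g₁ g₂) ≤
        ENNReal.ofReal C * (eLpNorm g₁ 2 volume * eLpNorm g₂ 2 volume) := by
  have hW : ∀ κ : ℝ, 0 < κ → _ := fun κ hκ => exists_dNorm_finset_le n hA hκ
  choose K hK using hW
  obtain ⟨C, hC⟩ := exists_dNorm_le_of_finset_bound (α := Fin n → ℤ) (β := ℤ) hP₀ (hP₀.trans hPQ) hP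
    hQ fun κ => if h : 0 < κ then K κ h else 0
  refine ⟨C, fun N hN hloc g₁ g₂ hgm₁ hgm₂ hg₁ hg₂ hsep ξ₀ η₀ hξ₀ hη₀ hξ hη => ?_⟩
  set X := eLpNorm g₁ 2 volume * eLpNorm g₂ 2 volume with hX
  have hXt : X ≠ ∞ := ENNReal.mul_ne_top hg₁.2.ne hg₂.2.ne
  rcases eq_or_ne X 0 with hX0 | hX0
  · have : latticeProd N g₁ g₂ = fun _ _ => 0 := by
      ext y s
      exact latticeProd_eq_zero hgm₁ hgm₂ hX0 y s
    rw [this, dNorm_zero]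
    exact zero_le
  have hXi : X⁻¹ ≠ ∞ := ENNReal.inv_ne_top.2 hX0
  have h := hC (fun y s => X⁻¹ * latticeProd N g₁ g₂ y s) fun κ hκ F => ?_
  · calc dNorm P Q (latticeProd N g₁ g₂)
        = dNorm P Q fun y s => X * (X⁻¹ * latticeProd N g₁ g₂ y s) := by
          simp only [← mul_assoc, ENNReal.mul_inv_cancel hX0 hXt, one_mul]
      _ ≤ X * dNorm P Q fun y s => X⁻¹ * latticeProd N g₁ g₂ y s := dNorm_const_mul_le hXt _
      _ ≤ ENNReal.ofReal C * X := by
          rw [mul_comm]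
          gcongr
  · rw [dif_pos hκ]
    have h1 := hK κ hκ N P₀ Q₀ hN hP₀ hPQ hQ.ne_top hloc g₁ g₂ hgm₁ hgm₂ hg₁ hg₂ hsep ξ₀ η₀ hξ₀ hη₀
      hξ hη F
    calc _ ≤ dNorm P₀ Q₀ fun y s =>
            X⁻¹ * if (y, s) ∈ F then latticeProd N g₁ g₂ y s else 0 := by
          refine dNorm_mono fun y s => ?_
          split_ifs <;> simp
      _ ≤ X⁻¹ * (ENNReal.ofReal (K κ hκ) * (F.card : ℝ≥0∞) ^ κ * X) :=
          (dNorm_const_mul_le hXi _).trans (by gcongr)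
      _ = (X⁻¹ * X) * (ENNReal.ofReal (K κ hκ) * (F.card : ℝ≥0∞) ^ κ) := by ring
      _ = _ := by rw [ENNReal.inv_mul_cancel hX0 hXt, one_mul]

/-- The restriction of `g` to the cell of side `h` with index `k`. -/
noncomputable def cellPart (h : ℝ) (k : Fin n → ℤ) (g : EuclideanSpace ℝ (Fin n) → ℂ) :
    EuclideanSpace ℝ (Fin n) → ℂ :=
  (cellIndex (fun _ => h) ⁻¹' {k}).indicator g

/-- The indices of the cells of side `1 / (50 n)` that meet the unit ball. -/
noncomputable def ballCells (n : ℕ) : Finset (Fin n → ℤ) :=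
  Fintype.piFinset fun _ => Finset.Icc (-(50 * n : ℤ)) (50 * n)

theorem cellIndex_mem_ballCells {ζ : EuclideanSpace ℝ (Fin n)} (hζ : ‖ζ‖ ≤ 1) :
    cellIndex (fun _ => 1 / (50 * n : ℝ)) ζ ∈ ballCells n := by
  have hn : (0 : ℝ) < n := by exact_mod_cast NeZero.pos n
  rw [ballCells, Fintype.mem_piFinset]
  intro i
  have h := abs_le.1 ((abs_coord_le_norm ζ i).trans hζ)
  have e : ζ i / (1 / (50 * n : ℝ)) = ζ i * (50 * n) := by rw [div_div_eq_mul_div, div_one]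
  rw [Finset.mem_Icc]
  simp only [cellIndex, e]
  constructor
  · rw [Int.le_floor]
    push_cast
    nlinarith
  · have h1 := Int.floor_le (ζ i * (50 * n))
    have : ((⌊ζ i * (50 * n)⌋ : ℤ) : ℝ) ≤ ((50 * n : ℤ) : ℝ) := by
      push_cast
      nlinarith
    exact Int.cast_le.1 this

theorem extendWave_eq_sum_cellPart {g : EuclideanSpace ℝ (Fin n) → ℂ} (hg : Integrable g)
    (hb : ∀ ζ, g ζ ≠ 0 → ‖ζ‖ ≤ 1) (z : EuclideanSpace ℝ (Fin n) × ℝ) :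
    extendWave g z = ∑ k ∈ ballCells n, extendWave (cellPart (1 / (50 * n : ℝ)) k g) z := by
  classical
  unfold extendWave
  rw [← integral_finsetSum]
  · refine integral_congr_ae (Filter.Eventually.of_forall fun ζ => ?_)
    simp only [← Finset.mul_sum]
    congr 1
    by_cases hζ : g ζ = 0
    · rw [hζ]
      exact (Finset.sum_eq_zero fun k _ => by simp [cellPart, Set.indicator_apply, hζ]).symm
    · rw [Finset.sum_eq_single (cellIndex (fun _ => 1 / (50 * n : ℝ)) ζ)]
      · rw [cellPart, Set.indicator_of_mem (by simp)]
      · intro k _ hk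
        rw [cellPart, Set.indicator_of_notMem]
        exact fun h => hk h.symm
      · exact fun h => absurd (cellIndex_mem_ballCells (hb ζ hζ)) h
  · intro k _
    have : Integrable (cellPart (1 / (50 * n : ℝ)) k g) :=
      hg.indicator (measurable_cellIndex _ (measurableSet_singleton _))
    exact this.bdd_mul (c := 1) (continuous_waveChar z).aestronglyMeasurable
      (Filter.Eventually.of_forall fun ζ => (norm_waveChar _ _).le)

omit [NeZero n] in
theorem cellPart_ne_zero {h : ℝ} {k : Fin n → ℤ} {g : EuclideanSpace ℝ (Fin n) → ℂ}
    {ζ : EuclideanSpace ℝ (Fin n)} (hζ : cellPart h k g ζ ≠ 0) :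
    g ζ ≠ 0 ∧ cellIndex (fun _ => h) ζ = k := by
  have := Set.indicator_apply_ne_zero.1 hζ
  exact ⟨this.2, this.1⟩

theorem exists_center_cellPart {k : Fin n → ℤ} {g : EuclideanSpace ℝ (Fin n) → ℂ}
    (hb : ∀ ζ, g ζ ≠ 0 → ‖ζ‖ ≤ 1) : ∃ ξ₀ : EuclideanSpace ℝ (Fin n), ‖ξ₀‖ ≤ 1 ∧
      ∀ ζ, cellPart (1 / (50 * n : ℝ)) k g ζ ≠ 0 → ‖ζ - ξ₀‖ ≤ 1 / 50 := by
  have hn : (0 : ℝ) < n := by exact_mod_cast NeZero.pos n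
  by_cases h : ∃ ξ₀, cellPart (1 / (50 * n : ℝ)) k g ξ₀ ≠ 0
  · obtain ⟨ξ₀, h0⟩ := h
    obtain ⟨h1, h2⟩ := cellPart_ne_zero h0
    refine ⟨ξ₀, hb _ h1, fun ζ hζ => ?_⟩
    have h3 := dist_shift_le (h := 1 / (50 * n : ℝ)) (by positivity) (w := 0) (ζ := ξ₀) (ζ' := ζ)
      (by rw [sub_zero, h2, (cellPart_ne_zero hζ).2])
    rw [sub_zero] at h3
    refine h3.trans (le_of_eq ?_)
    field_simp
  · push Not at h
    exact ⟨0, by simp, fun ζ hζ => absurd (h ζ) hζ⟩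

/-- The global estimate on the lattice. -/
theorem exists_dNorm_latticeProd_le (n : ℕ) [NeZero n] {A : ℝ → ℝ} (hA : ∀ ε, 0 ≤ A ε)
    {P₀ Q₀ P Q : ℝ≥0∞} (hP₀ : 1 ≤ P₀) (hPQ : P₀ ≤ Q₀) (hP : P₀ < P) (hQ : Q₀ < Q) :
    ∃ C : ℝ, ∀ N : ℝ, 1 ≤ N →
    (∀ ε : ℝ, 0 < ε → ∀ R : ℝ, 1 ≤ R → LocalEstimate n N P₀ Q₀ R
      (ENNReal.ofReal (A ε * N ^ ((P₀⁻¹).toReal - (Q₀⁻¹).toReal) * R ^ ε))) →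
    ∀ g₁ g₂ : EuclideanSpace ℝ (Fin n) → ℂ, Measurable g₁ → Measurable g₂ → MemLp g₁ 2 →
    MemLp g₂ 2 → SeparatedPair g₁ g₂ →
      dNorm P Q (latticeProd N g₁ g₂) ≤
        ENNReal.ofReal C * (eLpNorm g₁ 2 volume * eLpNorm g₂ 2 volume) := by
  obtain ⟨C, hC⟩ := exists_dNorm_le_of_small_support n hA hP₀ hPQ hP hQ
  have hP1 : 1 ≤ P := hP₀.trans hP.le
  have hQ1 : 1 ≤ Q := (hP₀.trans hPQ).trans hQ.le
  refine ⟨(ballCells n).card * ((ballCells n).card * C), fun N hN hloc g₁ g₂ hgm₁ hgm₂ hg₁ hg₂ hsep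
    => ?_⟩
  set h : ℝ := 1 / (50 * n : ℝ) with hh
  have hms : ∀ k : Fin n → ℤ, MeasurableSet (cellIndex (fun _ : Fin n => h) ⁻¹' {k}) := fun k =>
    measurable_cellIndex _ (measurableSet_singleton k)
  have hpart : ∀ k l, dNorm P Q (latticeProd N (cellPart h k g₁) (cellPart h l g₂)) ≤
      ENNReal.ofReal C * (eLpNorm g₁ 2 volume * eLpNorm g₂ 2 volume) := by
    intro k l
    obtain ⟨ξ₀, hξ₀, hξ⟩ := exists_center_cellPart (k := k) hsep.1
    obtain ⟨η₀, hη₀, hη⟩ := exists_center_cellPart (k := l) hsep.2.1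
    refine (hC N hN hloc _ _ (hgm₁.indicator (hms k)) (hgm₂.indicator (hms l))
      (hg₁.indicator (hms k)) (hg₂.indicator (hms l))
      ⟨fun ζ hζ => hsep.1 ζ (cellPart_ne_zero hζ).1, fun ζ hζ => hsep.2.1 ζ (cellPart_ne_zero hζ).1,
        fun ζ η hζ hη => hsep.2.2 ζ η (cellPart_ne_zero hζ).1 (cellPart_ne_zero hη).1⟩
      ξ₀ η₀ hξ₀ hη₀ hξ hη).trans ?_
    gcongr
    · exact eLpNorm_indicator_le _
    · exact eLpNorm_indicator_le _
  have hI₁ := integrable_of_memLp_of_norm_le_one hg₁ hsep.1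
  have hI₂ := integrable_of_memLp_of_norm_le_one hg₂ hsep.2.1
  calc dNorm P Q (latticeProd N g₁ g₂)
      ≤ dNorm P Q fun y s => ∑ k ∈ ballCells n, ∑ l ∈ ballCells n,
          latticeProd N (cellPart h k g₁) (cellPart h l g₂) y s := by
        refine dNorm_mono fun y s => ?_
        simp only [latticeProd]
        rw [extendWave_eq_sum_cellPart hI₁ hsep.1, extendWave_eq_sum_cellPart hI₂ hsep.2.1,
          Finset.sum_mul_sum]
        exact (enorm_sum_le _ _).trans (Finset.sum_le_sum fun k _ => enorm_sum_le _ _)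
    _ ≤ ∑ k ∈ ballCells n, ∑ l ∈ ballCells n,
          dNorm P Q (latticeProd N (cellPart h k g₁) (cellPart h l g₂)) :=
        (dNorm_sum_le _ hP1 hQ1 _).trans (Finset.sum_le_sum fun k _ => dNorm_sum_le _ hP1 hQ1 _)
    _ ≤ ∑ k ∈ ballCells n, ∑ l ∈ ballCells n,
          ENNReal.ofReal C * (eLpNorm g₁ 2 volume * eLpNorm g₂ 2 volume) :=
        Finset.sum_le_sum fun k _ => Finset.sum_le_sum fun l _ => hpart k l
    _ = _ := by
        simp only [Finset.sum_const, nsmul_eq_mul]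
        rw [ENNReal.ofReal_mul (Nat.cast_nonneg _), ENNReal.ofReal_mul (Nat.cast_nonneg _),
          ENNReal.ofReal_natCast]
        ring

end LatticeEstimate

/-! ### From the lattice back to space-time -/

section Transfer

variable {n : ℕ}

/-- The products of components of `(ζ, -2π|ζ|²)`, normalised to be at most `1` on the unit ball,
that appear in the expansion of `waveChar`. -/
noncomputable def paraboloidMonomial (p : Σ l : ℕ, Fin l → Option (Fin n))
    (ζ : EuclideanSpace ℝ (Fin n)) : ℂ :=
  ∏ l, (truncOne (paraboloidCoord ζ (p.2 l) / (4 * Real.pi)) : ℂ)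

/-- The coefficients in the expansion of `waveChar`. -/
noncomputable def monomialCoeff (p : Σ l : ℕ, Fin l → Option (Fin n)) : ℝ :=
  (16 * Real.pi ^ 2) ^ p.1 / (p.1.factorial : ℝ)

theorem measurable_paraboloidMonomial (p : Σ l : ℕ, Fin l → Option (Fin n)) :
    Measurable (paraboloidMonomial p) := by
  refine Finset.measurable_prod _ fun l _ => Complex.measurable_ofReal.comp
    (measurable_truncOne.comp ((measurable_paraboloidCoord _).div_const _))

theorem norm_paraboloidMonomial_le (p : Σ l : ℕ, Fin l → Option (Fin n))
    (ζ : EuclideanSpace ℝ (Fin n)) : ‖paraboloidMonomial p ζ‖ ≤ 1 :=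
  norm_prod_le_one fun l => by
    rw [Complex.norm_real]
    exact abs_truncOne_le _

theorem summable_monomialCoeff : Summable (monomialCoeff (n := n)) := by
  have h := summable_norm_pow_div_factorial_sigma (Option (Fin n)) ((16 * Real.pi ^ 2 : ℝ) : ℂ)
  rwa [Complex.norm_real, Real.norm_of_nonneg (by positivity)] at h

/-- A wave at a point is dominated by a rapidly convergent combination of waves at any nearby point,
the frequency functions of which are obtained from the original one by bounded multipliers. -/
theorem enorm_extendWave_le_tsum_monomial {g : EuclideanSpace ℝ (Fin n) → ℂ} (hg : Integrable g)
    (hb : ∀ ζ, g ζ ≠ 0 → ‖ζ‖ ≤ 1) {z z' : EuclideanSpace ℝ (Fin n) × ℝ}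
    (hz : ∀ o, |spaceTimeCoord (z - z') o| ≤ 2) :
    ‖extendWave g z‖ₑ ≤ ∑' p, ENNReal.ofReal (monomialCoeff p) *
      ‖extendWave (fun ζ => paraboloidMonomial p ζ * g ζ) z'‖ₑ := by
  have hπ := Real.pi_pos
  set Λ : ℂ := ((16 * Real.pi ^ 2 : ℝ) : ℂ) * Complex.I with hΛ
  have hΛn : ‖Λ‖ = 16 * Real.pi ^ 2 := by
    rw [hΛ, norm_mul, Complex.norm_I, mul_one, Complex.norm_real,
      Real.norm_of_nonneg (by positivity)]
  set u : Option (Fin n) → ℂ := fun o => ((spaceTimeCoord (z - z') o / 2 : ℝ) : ℂ) with hu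
  have hu1 : ∀ o, ‖u o‖ ≤ 1 := fun o => by
    rw [hu, Complex.norm_real, Real.norm_eq_abs, abs_div, abs_two, div_le_one two_pos]
    exact hz o
  set F : (Σ l : ℕ, Fin l → Option (Fin n)) → EuclideanSpace ℝ (Fin n) → ℂ := fun p ζ =>
    Λ ^ p.1 / (p.1.factorial : ℂ) * (∏ l, u (p.2 l)) *
      (waveChar z' ζ * (paraboloidMonomial p ζ * g ζ)) with hF
  have hcoef : ∀ p : Σ l : ℕ, Fin l → Option (Fin n),
      ‖Λ ^ p.1 / (p.1.factorial : ℂ) * (∏ l, u (p.2 l))‖ ≤ monomialCoeff p := fun p => by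
    rw [norm_mul, norm_div, norm_pow, hΛn, Complex.norm_natCast]
    exact mul_le_of_le_one_right (by positivity) (norm_prod_le_one fun l => hu1 _)
  have hint : ∀ p, Integrable (F p) := fun p => by
    refine Integrable.const_mul (Integrable.bdd_mul (c := 1) (Integrable.bdd_mul (c := 1) hg
      (measurable_paraboloidMonomial p).aestronglyMeasurable
      (Filter.Eventually.of_forall (norm_paraboloidMonomial_le p)))
      (continuous_waveChar z').aestronglyMeasurable
      (Filter.Eventually.of_forall fun ζ => (norm_waveChar _ _).le)) _
  have hpt : ∀ ζ, HasSum (fun p => F p ζ) (waveChar z ζ * g ζ) := by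
    intro ζ
    by_cases hζ : g ζ = 0
    · simp [hF, hζ]
    have h := hasSum_cexp_dot Λ hu1
      (v := fun o => (truncOne (paraboloidCoord ζ o / (4 * Real.pi)) : ℂ))
      fun o => by rw [Complex.norm_real]; exact abs_truncOne_le _
    have e1 : waveChar z ζ = Complex.exp (Λ * ∑ o, u o *
        (truncOne (paraboloidCoord ζ o / (4 * Real.pi)) : ℂ)) * waveChar z' ζ := by
      conv_lhs => rw [← sub_add_cancel z z', waveChar_add]
      congr 1
      rw [waveChar, wavePhase_eq_sum]
      congr 1
      push_cast
      rw [Finset.mul_sum, Finset.mul_sum]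
      refine Finset.sum_congr rfl fun o _ => ?_
      rw [truncOne_of_abs_le]
      · simp only [hu, hΛ]
        push_cast
        field_simp
        ring
      · rw [abs_div, abs_of_pos (by positivity : 0 < 4 * Real.pi), div_le_one (by positivity)]
        simpa using abs_paraboloidCoord_le le_rfl (hb ζ hζ) o
    rw [e1, mul_assoc]
    refine (h.mul_right (waveChar z' ζ * g ζ)).congr_fun fun p => ?_
    simp only [hF, paraboloidMonomial]
    ring
  have hsum : Summable fun p => ∫ ζ, ‖F p ζ‖ := by
    refine Summable.of_nonneg_of_le (fun p => integral_nonneg fun ζ => norm_nonneg _) (fun p => ?_)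
      (summable_monomialCoeff.mul_right (∫ ζ, ‖g ζ‖))
    rw [← integral_const_mul]
    refine integral_mono (hint p).norm (hg.norm.const_mul _) fun ζ => ?_
    simp only [hF]
    rw [norm_mul _ (_ * _), norm_mul (waveChar z' ζ), norm_waveChar, one_mul, norm_mul _ (g ζ)]
    exact mul_le_mul (hcoef p) (mul_le_of_le_one_left (norm_nonneg _)
      (norm_paraboloidMonomial_le p ζ)) (by positivity) ((norm_nonneg _).trans (hcoef p))
  have hI := hasSum_integral_of_summable_integral_norm hint hsum
  have e : extendWave g z = ∑' p, ∫ ζ, F p ζ := by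
    rw [hI.tsum_eq, extendWave]
    exact integral_congr_ae (Filter.Eventually.of_forall fun ζ => (hpt ζ).tsum_eq.symm)
  rw [e]
  refine enorm_tsum_le_tsum_enorm.trans (ENNReal.tsum_le_tsum fun p => ?_)
  simp only [hF]
  rw [integral_const_mul, enorm_mul]
  refine mul_le_mul' ?_ le_rfl
  rw [← ofReal_norm]
  exact ENNReal.ofReal_le_ofReal (hcoef p)

variable [NeZero n]

/-- The sum of the coefficients in the expansion of `waveChar`. -/
noncomputable def monomialSum (n : ℕ) : ℝ≥0∞ :=
  ∑' p : Σ l : ℕ, Fin l → Option (Fin n), ENNReal.ofReal (monomialCoeff p)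

omit [NeZero n] in
theorem monomialSum_ne_top : monomialSum n ≠ ∞ :=
  (summable_monomialCoeff (n := n)).tsum_ofReal_ne_top

/-- A bilinear estimate on the lattice implies one in space-time. -/
theorem cNorm_le_of_dNorm_le {N : ℝ} (hN : 1 ≤ N) {P Q : ℝ≥0∞} (hP : 1 ≤ P) (hQ : 1 ≤ Q)
    {C : ℝ≥0∞} (h : ∀ g₁ g₂ : EuclideanSpace ℝ (Fin n) → ℂ, Measurable g₁ → Measurable g₂ →
      MemLp g₁ 2 → MemLp g₂ 2 → SeparatedPair g₁ g₂ →
      dNorm P Q (latticeProd N g₁ g₂) ≤ C * (eLpNorm g₁ 2 volume * eLpNorm g₂ 2 volume))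
    {g₁ g₂ : EuclideanSpace ℝ (Fin n) → ℂ} (hgm₁ : Measurable g₁) (hgm₂ : Measurable g₂)
    (hg₁ : MemLp g₁ 2) (hg₂ : MemLp g₂ 2) (hsep : SeparatedPair g₁ g₂) :
    cNorm P Q (fun z => ‖extendWave g₁ (movingPoint N z) * extendWave g₂ (movingPoint N z)‖ₑ) ≤
      ENNReal.ofReal ((4 * Real.pi * N) ^ ((P⁻¹).toReal - (Q⁻¹).toReal)) *
        (monomialSum n ^ 2 * (C * (eLpNorm g₁ 2 volume * eLpNorm g₂ 2 volume))) := by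
  set G₁ : (Σ l : ℕ, Fin l → Option (Fin n)) → EuclideanSpace ℝ (Fin n) → ℂ := fun p ζ =>
    paraboloidMonomial p ζ * g₁ ζ with hG₁
  set G₂ : (Σ l : ℕ, Fin l → Option (Fin n)) → EuclideanSpace ℝ (Fin n) → ℂ := fun p ζ =>
    paraboloidMonomial p ζ * g₂ ζ with hG₂
  have hle : ∀ {g : EuclideanSpace ℝ (Fin n) → ℂ} (p : Σ l : ℕ, Fin l → Option (Fin n)) ζ,
      ‖paraboloidMonomial p ζ * g ζ‖ ≤ ‖g ζ‖ := fun p ζ => by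
    rw [norm_mul]
    exact mul_le_of_le_one_left (norm_nonneg _) (norm_paraboloidMonomial_le p ζ)
  have hmem : ∀ {g : EuclideanSpace ℝ (Fin n) → ℂ} (p : Σ l : ℕ, Fin l → Option (Fin n)),
      MemLp g 2 → MemLp (fun ζ => paraboloidMonomial p ζ * g ζ) 2 := fun p hg =>
    hg.of_le ((measurable_paraboloidMonomial p).aestronglyMeasurable.mul hg.1)
      (Filter.Eventually.of_forall (hle p))
  have hpart : ∀ p q, dNorm P Q (latticeProd N (G₁ p) (G₂ q)) ≤
      C * (eLpNorm g₁ 2 volume * eLpNorm g₂ 2 volume) := by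
    intro p q
    refine (h _ _ ((measurable_paraboloidMonomial p).mul hgm₁)
      ((measurable_paraboloidMonomial q).mul hgm₂) (hmem p hg₁) (hmem q hg₂)
      ⟨fun ζ hζ => hsep.1 ζ (right_ne_zero_of_mul hζ),
        fun ζ hζ => hsep.2.1 ζ (right_ne_zero_of_mul hζ), fun ζ η hζ hη =>
        hsep.2.2 ζ η (right_ne_zero_of_mul hζ) (right_ne_zero_of_mul hη)⟩).trans ?_
    gcongr
    · exact eLpNorm_mono (hle p)
    · exact eLpNorm_mono (hle q)
  have hz : ∀ (z : EuclideanSpace ℝ (Fin n) × ℝ) o, |spaceTimeCoord (movingPoint N z -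
      latticePoint N (spaceCell N z.1, timeCell N z.1 z.2)) o| ≤ 2 := fun z o => by
    refine le_trans (le_of_eq ?_) (abs_coord_latticePoint_sub_movingPoint_le hN z o)
    cases o <;> exact abs_sub_comm _ _
  set B : (Fin n → ℤ) → ℤ → ℝ≥0∞ := fun y s => ∑' pq : (Σ l : ℕ, Fin l → Option (Fin n)) ×
    (Σ l : ℕ, Fin l → Option (Fin n)), ENNReal.ofReal (monomialCoeff pq.1) *
    ENNReal.ofReal (monomialCoeff pq.2) * latticeProd N (G₁ pq.1) (G₂ pq.2) y s with hB
  have hpoint : ∀ z : EuclideanSpace ℝ (Fin n) × ℝ,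
      ‖extendWave g₁ (movingPoint N z) * extendWave g₂ (movingPoint N z)‖ₑ ≤
        B (spaceCell N z.1) (timeCell N z.1 z.2) := by
    intro z
    rw [enorm_mul]
    refine (mul_le_mul' (enorm_extendWave_le_tsum_monomial
      (integrable_of_memLp_of_norm_le_one hg₁ hsep.1) hsep.1 (hz z))
      (enorm_extendWave_le_tsum_monomial
      (integrable_of_memLp_of_norm_le_one hg₂ hsep.2.1) hsep.2.1 (hz z))).trans (le_of_eq ?_)
    simp only [hB]
    rw [ENNReal.tsum_prod (f := fun p q => ENNReal.ofReal (monomialCoeff p) *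
      ENNReal.ofReal (monomialCoeff q) * latticeProd N (G₁ p) (G₂ q) (spaceCell N z.1)
        (timeCell N z.1 z.2)), ← ENNReal.tsum_mul_right]
    refine tsum_congr fun p => ?_
    rw [← ENNReal.tsum_mul_left]
    refine tsum_congr fun q => ?_
    rw [latticeProd, enorm_mul, hG₁, hG₂]
    ring
  have hBnorm : dNorm P Q B ≤
      monomialSum n ^ 2 * (C * (eLpNorm g₁ 2 volume * eLpNorm g₂ 2 volume)) := by
    calc _ ≤ ∑' pq : (Σ l : ℕ, Fin l → Option (Fin n)) × (Σ l : ℕ, Fin l → Option (Fin n)),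
          dNorm P Q fun y s => ENNReal.ofReal (monomialCoeff pq.1) *
            ENNReal.ofReal (monomialCoeff pq.2) * latticeProd N (G₁ pq.1) (G₂ pq.2) y s :=
        dNorm_tsum_le hP hQ _
      _ ≤ ∑' pq : (Σ l : ℕ, Fin l → Option (Fin n)) × (Σ l : ℕ, Fin l → Option (Fin n)),
          ENNReal.ofReal (monomialCoeff pq.1) * ENNReal.ofReal (monomialCoeff pq.2) *
            (C * (eLpNorm g₁ 2 volume * eLpNorm g₂ 2 volume)) := by
        refine ENNReal.tsum_le_tsum fun pq => ?_
        refine (dNorm_const_mul_le (ENNReal.mul_ne_top ENNReal.ofReal_ne_top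
          ENNReal.ofReal_ne_top) _).trans ?_
        exact mul_le_mul_right (hpart _ _) _
      _ = _ := by
        rw [ENNReal.tsum_mul_right, ENNReal.tsum_prod (f := fun p q =>
          ENNReal.ofReal (monomialCoeff p) * ENNReal.ofReal (monomialCoeff q))]
        simp only [ENNReal.tsum_mul_left, ENNReal.tsum_mul_right]
        rw [← monomialSum, sq]
  refine (cNorm_mono hpoint).trans ?_
  rw [cNorm_comp_cell hN P Q B]
  exact mul_le_mul_right hBnorm _

end Transfer

theorem toReal_inv_div_two (p : ℝ≥0∞) : ((p / 2)⁻¹).toReal = 2 * (p⁻¹).toReal := by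
  rw [ENNReal.inv_div (Or.inl ENNReal.ofNat_ne_top) (Or.inl two_ne_zero), div_eq_mul_inv,
    ENNReal.toReal_mul]
  simp

theorem propositionA1 (n : ℕ) [NeZero n] (p₀ r₀ p r : ℝ≥0∞)
    (hp₀ : 2 ≤ p₀) (hr₀ : p₀ ≤ r₀) (hp : p₀ < p) (hr : r₀ < r) (A : ℝ → ℝ) :
    ∃ C : ℝ, ∀ N : ℝ, 1 ≤ N →
      (∀ ε : ℝ, 0 < ε → ∀ R : ℝ, 1 ≤ R → ∀ f₁ f₂ : L2Space n, AdmissiblePair N f₁ f₂ →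
        mixedNorm p₀ r₀ (wavePipe n N R) (bilinearWave f₁ f₂) ≤
          ENNReal.ofReal (A ε * N ^ ((p₀⁻¹).toReal - (r₀⁻¹).toReal) * R ^ ε *
            ‖f₁‖ ^ (1 / 2 : ℝ) * ‖f₂‖ ^ (1 / 2 : ℝ))) →
      ∀ f₁ f₂ : L2Space n, AdmissiblePair N f₁ f₂ →
        mixedNorm p r Set.univ (bilinearWave f₁ f₂) ≤
          ENNReal.ofReal (C * N ^ ((p⁻¹).toReal - (r⁻¹).toReal) *
            ‖f₁‖ ^ (1 / 2 : ℝ) * ‖f₂‖ ^ (1 / 2 : ℝ)) := by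
  have hdiv : ∀ {a b : ℝ≥0∞}, a < b → a / 2 < b / 2 := fun h =>
    ENNReal.div_lt_div_right two_ne_zero ENNReal.ofNat_ne_top h
  have hP₀ : 1 ≤ p₀ / 2 := by
    rw [ENNReal.le_div_iff_mul_le (Or.inl two_ne_zero) (Or.inl ENNReal.ofNat_ne_top), one_mul]
    exact hp₀
  have hPQ : p₀ / 2 ≤ r₀ / 2 := ENNReal.div_le_div_right hr₀ 2
  -- passing to `|e^{itΔ}f₁ e^{itΔ}f₂|` halves the exponents and squares the constants
  obtain ⟨C₀, hC₀⟩ := exists_dNorm_latticeProd_le n (A := fun ε => A (ε / 2) ^ 2)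
    (fun ε => sq_nonneg _) hP₀ hPQ (hdiv hp) (hdiv hr)
  set C₁ : ℝ := max C₀ 0 with hC₁
  have hC₁0 : 0 ≤ C₁ := le_max_right _ _
  set S := (monomialSum n).toReal with hS
  have hS0 : 0 ≤ S := ENNReal.toReal_nonneg
  have hS' : monomialSum n = ENNReal.ofReal S := (ENNReal.ofReal_toReal monomialSum_ne_top).symm
  set θ := (p⁻¹).toReal - (r⁻¹).toReal with hθ
  have hπ := Real.pi_pos
  refine ⟨(4 * Real.pi) ^ θ * (S * C₁ ^ (1 / 2 : ℝ)), fun N hN H f₁ f₂ hf => ?_⟩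
  have hN0 : 0 < N := by linarith
  have hloc : ∀ ε : ℝ, 0 < ε → ∀ R : ℝ, 1 ≤ R → LocalEstimate n N (p₀ / 2) (r₀ / 2) R
      (ENNReal.ofReal (A (ε / 2) ^ 2 *
        N ^ (((p₀ / 2)⁻¹).toReal - ((r₀ / 2)⁻¹).toReal) * R ^ ε)) := by
    intro ε hε R hR g₁ g₂ hg₁ hg₂ hg
    have hR0 : 0 < R := by linarith
    have h := cNorm_indicator_wavePipe_le (H (ε / 2) (by positivity) R hR) hg₁ hg₂ hg
    rw [← Real.rpow_mul_natCast hN0.le, ← Real.rpow_mul_natCast hR0.le] at h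
    convert h using 5
    · rw [toReal_inv_div_two, toReal_inv_div_two]
      congr 1
      push_cast
      ring
    · push_cast
      ring
  obtain ⟨g₁, hgm₁, hg₁, hfg₁, hn₁, hs₁⟩ := exists_function_of_L2Space N f₁
  obtain ⟨g₂, hgm₂, hg₂, hfg₂, hn₂, hs₂⟩ := exists_function_of_L2Space N f₂
  have hsep : SeparatedPair g₁ g₂ := by
    refine ⟨fun ζ hζ => ?_, fun ζ hζ => ?_, fun ζ η hζ hη => ?_⟩
    · simpa using hf.1 (hs₁ ζ hζ)
    · simpa using hf.2.1 (hs₂ ζ hζ)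
    · simpa using hf.2.2 _ (hs₁ ζ hζ) _ (hs₂ η hη)
  have hmain := cNorm_le_of_dNorm_le hN (hP₀.trans (hdiv hp).le)
    ((hP₀.trans hPQ).trans (hdiv hr).le) (hC₀ N hN hloc) hgm₁ hgm₂ hg₁ hg₂ hsep
  rw [bilinearWave_eq hfg₁ hfg₂, mixedNorm_rpow_half, Set.indicator_univ]
  have hreal : cNorm (p / 2) (r / 2)
      (fun z => ‖extendWave g₁ (movingPoint N z) * extendWave g₂ (movingPoint N z)‖ₑ) ≤
      ENNReal.ofReal (((4 * Real.pi * N) ^ θ) ^ 2 * (S ^ 2 * (C₁ * (‖f₁‖ * ‖f₂‖)))) := by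
    refine hmain.trans ?_
    rw [hn₁, hn₂, hS', toReal_inv_div_two, toReal_inv_div_two, ← mul_sub, ← hθ, mul_comm 2 θ,
      ← ofReal_norm, ← ofReal_norm, ENNReal.ofReal_mul (by positivity),
      ENNReal.ofReal_mul (sq_nonneg S), ENNReal.ofReal_mul hC₁0,
      ENNReal.ofReal_mul (norm_nonneg _), ENNReal.ofReal_pow hS0,
      ← Real.rpow_mul_natCast (by positivity)]
    push_cast
    gcongr
    exact le_max_left _ _
  refine (ENNReal.rpow_le_rpow hreal (by norm_num : (0 : ℝ) ≤ 1 / 2)).trans (le_of_eq ?_)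
  rw [ENNReal.ofReal_rpow_of_nonneg (by positivity) (by norm_num)]
  congr 1
  have hsq : ∀ x : ℝ, 0 ≤ x → (x ^ 2) ^ (1 / 2 : ℝ) = x := fun x hx => by
    rw [← Real.sqrt_eq_rpow, Real.sqrt_sq hx]
  have e : ((4 * Real.pi * N) ^ θ) ^ 2 * (S ^ 2 * (C₁ * (‖f₁‖ * ‖f₂‖))) =
      ((4 * Real.pi) ^ θ * N ^ θ * S) ^ 2 * (C₁ * (‖f₁‖ * ‖f₂‖)) := by
    rw [Real.mul_rpow (by positivity) hN0.le]
    ring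
  rw [e, Real.mul_rpow (sq_nonneg _) (by positivity), hsq _ (by positivity),
    Real.mul_rpow hC₁0 (by positivity), Real.mul_rpow (norm_nonneg _) (norm_nonneg _)]
  ring
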